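/- For $(a,b,c)$ equal to one of the six triples below define functions $t$ and $f$ on the upper half-plane $\mathbb H$ as follows, where $\eta$ is the Dedekind eta function, $\eta_m=\eta(m\tau)$ and $q=e^{2\pi i\tau}$: - $(7,2,-8)$: $t=\dfrac{\eta_1^3\eta_6^9}{\eta_2^3\eta_3^9}$, $f=\dfrac{\eta_2\eta_3^6}{\eta_1^2\eta_6^3}$; - $(10,3,9)$: $t=\dfrac{\eta_1^4\eta_6^8}{\eta_2^8\eta_3^4}$, $f=\dfrac{\eta_2^6\eta_3}{\eta_1^3\eta_6^2}$; - $(-17,-6,72)$: $t=\dfrac{\eta_2\eta_6^5}{\eta_1^5\eta_3}$, $f=\dfrac{\eta_1^6\eta_6}{\eta_2^3\eta_3^2}$; - $(12,4,32)$: $t=\dfrac{\eta_1^4\eta_4^2\eta_8^4}{\eta_2^{10}}$, $f=\dfrac{\eta_2^{10}}{\eta_1^4\eta_4^4}$; - $(-9,-3,27)$: $t=\dfrac{\eta_9^3}{\eta_1^3}$, $f=\dfrac{\eta_1^3}{\eta_3}$; - $(11,3,-1)$: $t=q\prod_{n\ge1}(1-q^n)^{5\left(\frac n5\right)}$, where $\left(\frac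 n5\right)$ is the Legendre symbol, and $f=\prod_{n\ge1}(1-q^{5n})^2\prod_{n\equiv1,4\,(5)}(1-q^n)^{-3}\prod_{n\equiv2,3\,(5)}(1-q^n)^2$ (products over $n\ge1$). With $t_j=t(\tau_j)$ for $(\tau_1,\tau_2)\in\mathbb H^2$, let $$x=\frac{(t_1+t_2)(1+ct_1t_2)-2at_1t_2}{(1-ct_1t_2)^2},\qquad y=\frac{t_1t_2(1-at_1+ct_1^2)(1-at_2+ct_2^2)}{((t_1+t_2)(1+ct_1t_2)-2at_1t_2)^2},$$ $$F(\tau_1,\tau_2)=(1-ct_1t_2)f(\tau_1)f(\tau_2).$$ Then, in each of the six cases, $F$ as a function of $x$ and $y$ satisfies the system of partial differential equations $$\theta_x(\theta_x-2\theta_y)F-x(a\theta_x^2+a\theta_x+b)F+cx^2(\theta_x+1)^2F+cx^2(\theta_x+1)\bigl(4y\theta_x+(2-8y)\theta_y\bigr)F=0,$$ $$\theta_y^2F-y(2\theta_y-\theta_x+1)(2\theta_y-\theta_x)F=0,$$ where $\theta_x=x\,\partial/\partial x$ and $\theta_y=y\,\partial/\partial y$. Precisely, call $(\tau_1,\tau_2)\in\mathbb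 H^2$ regular if the denominators of $x$ and $y$ do not vanish there. The regular points where the Jacobian determinant $\partial(x,y)/\partial(\tau_1,\tau_2)$ is nonzero are dense in $\mathbb H^2$; near each of them $F=\Phi(x,y)$ for a function $\Phi$ that is holomorphic near the point $(x(\tau_1,\tau_2),y(\tau_1,\tau_2))$; and at any regular point $(\tau_1,\tau_2)$, every holomorphic $\Phi$ of this kind satisfies the two equations in a neighbourhood of $(x(\tau_1,\tau_2),y(\tau_1,\tau_2))$. -/

import Mathlib

open Complex Filter Topology

/-- The six sporadic cases of Apéry-like sequences, named after the parameters `(a, b, c)`. -/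
inductive SporadicCase : Type
  /-- `(a, b, c) = (7, 2, -8)`, group `Γ₀(6)` -/
  | case7
  /-- `(a, b, c) = (10, 3, 9)`, group `Γ₀(6)` -/
  | case10
  /-- `(a, b, c) = (-17, -6, 72)`, group `Γ₀(6)` -/
  | case17
  /-- `(a, b, c) = (12, 4, 32)`, group `Γ₀(8)` -/
  | case12
  /-- `(a, b, c) = (-9, -3, 27)`, group `Γ₀(9)` -/
  | case9
  /-- `(a, b, c) = (11, 3, -1)`, group `Γ₁(5)` -/
  | case11

namespace SporadicCase

/-- The parameter `a`. -/
def a : SporadicCase → ℂ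
  | case7 => 7
  | case10 => 10
  | case17 => -17
  | case12 => 12
  | case9 => -9
  | case11 => 11

/-- The parameter `b`. -/
def b : SporadicCase → ℂ
  | case7 => 2
  | case10 => 3
  | case17 => -6
  | case12 => 4
  | case9 => -3
  | case11 => 3

/-- The parameter `c`. -/
def c : SporadicCase → ℂ
  | case7 => -8
  | case10 => 9
  | case17 => 72
  | case12 => 32
  | case9 => 27
  | case11 => -1

/-- `η(m τ)`, with `η` the Dedekind eta function. -/
noncomputable def etaMul (m : ℕ) (τ : ℂ) : ℂ := ModularForm.eta (m * τ)

/-- The nome `q = exp (2 π i τ)`. -/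
noncomputable def nome (τ : ℂ) : ℂ := Complex.exp (2 * Real.pi * Complex.I * τ)

/-- `q ∏_{n ≥ 1} (1 - q ^ n) ^ (5 (n/5))`, with `(n/5)` the Legendre symbol. -/
noncomputable def tFive (τ : ℂ) : ℂ :=
  nome τ * ∏' n : ℕ, (1 - nome τ ^ (n + 1)) ^ (5 * jacobiSym ((n : ℤ) + 1) 5)

/-- `∏_{n ≥ 1} (1 - q ^ (5 n)) ^ 2 · ∏_{n ≡ 1, 4 (5)} (1 - q ^ n) ^ (-3) ·
∏_{n ≡ 2, 3 (5)} (1 - q ^ n) ^ 2`. -/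
noncomputable def fFive (τ : ℂ) : ℂ :=
  (∏' n : ℕ, (1 - nome τ ^ (5 * (n + 1))) ^ 2) *
    (∏' n : ℕ, if (n + 1) % 5 = 1 ∨ (n + 1) % 5 = 4 then (1 - nome τ ^ (n + 1)) ^ (-3 : ℤ) else 1) *
    (∏' n : ℕ, if (n + 1) % 5 = 2 ∨ (n + 1) % 5 = 3 then (1 - nome τ ^ (n + 1)) ^ 2 else 1)

/-- The modular function `t(τ)` (meaningful on the upper half-plane `0 < τ.im`). -/
noncomputable def t : SporadicCase → ℂ → ℂ
  | case7, τ => etaMul 1 τ ^ 3 * etaMul 6 τ ^ 9 / (etaMul 2 τ ^ 3 * etaMul 3 τ ^ 9)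
  | case10, τ => etaMul 1 τ ^ 4 * etaMul 6 τ ^ 8 / (etaMul 2 τ ^ 8 * etaMul 3 τ ^ 4)
  | case17, τ => etaMul 2 τ * etaMul 6 τ ^ 5 / (etaMul 1 τ ^ 5 * etaMul 3 τ)
  | case12, τ => etaMul 1 τ ^ 4 * etaMul 4 τ ^ 2 * etaMul 8 τ ^ 4 / etaMul 2 τ ^ 10
  | case9, τ => etaMul 9 τ ^ 3 / etaMul 1 τ ^ 3
  | case11, τ => tFive τ

/-- The modular form `f(τ)` of weight one (meaningful on the upper half-plane `0 < τ.im`). -/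
noncomputable def f : SporadicCase → ℂ → ℂ
  | case7, τ => etaMul 2 τ * etaMul 3 τ ^ 6 / (etaMul 1 τ ^ 2 * etaMul 6 τ ^ 3)
  | case10, τ => etaMul 2 τ ^ 6 * etaMul 3 τ / (etaMul 1 τ ^ 3 * etaMul 6 τ ^ 2)
  | case17, τ => etaMul 1 τ ^ 6 * etaMul 6 τ / (etaMul 2 τ ^ 3 * etaMul 3 τ ^ 2)
  | case12, τ => etaMul 2 τ ^ 10 / (etaMul 1 τ ^ 4 * etaMul 4 τ ^ 4)
  | case9, τ => etaMul 1 τ ^ 3 / etaMul 3 τ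
  | case11, τ => fFive τ

/-- `(t₁ + t₂)(1 + c t₁ t₂) - 2 a t₁ t₂`, where `t_j = t(τ_j)`. -/
noncomputable def num (s : SporadicCase) (τ : ℂ × ℂ) : ℂ :=
  (s.t τ.1 + s.t τ.2) * (1 + s.c * s.t τ.1 * s.t τ.2) - 2 * s.a * s.t τ.1 * s.t τ.2

/-- The bimodular function `x(τ₁, τ₂)`. -/
noncomputable def x (s : SporadicCase) (τ : ℂ × ℂ) : ℂ :=
  s.num τ / (1 - s.c * s.t τ.1 * s.t τ.2) ^ 2

/-- The bimodular function `y(τ₁, τ₂)`. -/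
noncomputable def y (s : SporadicCase) (τ : ℂ × ℂ) : ℂ :=
  s.t τ.1 * s.t τ.2 * (1 - s.a * s.t τ.1 + s.c * s.t τ.1 ^ 2) *
    (1 - s.a * s.t τ.2 + s.c * s.t τ.2 ^ 2) / s.num τ ^ 2

/-- The bimodular form `F(τ₁, τ₂)` of weight one. -/
noncomputable def F (s : SporadicCase) (τ : ℂ × ℂ) : ℂ :=
  (1 - s.c * s.t τ.1 * s.t τ.2) * s.f τ.1 * s.f τ.2

/-- The points of `ℍ × ℍ` at which neither `x` nor `y` has a vanishing denominator. -/
def regularSet (s : SporadicCase) : Set (ℂ × ℂ) :=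
  {τ | 0 < τ.1.im ∧ 0 < τ.2.im ∧ 1 - s.c * s.t τ.1 * s.t τ.2 ≠ 0 ∧ s.num τ ≠ 0}

/-- The Jacobian determinant `∂(x, y) / ∂(τ₁, τ₂)`. -/
noncomputable def jacobian (s : SporadicCase) (τ : ℂ × ℂ) : ℂ :=
  deriv (fun z => s.x (z, τ.2)) τ.1 * deriv (fun z => s.y (τ.1, z)) τ.2 -
    deriv (fun z => s.x (τ.1, z)) τ.2 * deriv (fun z => s.y (z, τ.2)) τ.1

/-- The points of `ℍ × ℍ` at which `x` and `y` are regular and form local coordinates. -/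
def coordinateSet (s : SporadicCase) : Set (ℂ × ℂ) :=
  {τ | τ ∈ s.regularSet ∧ s.jacobian τ ≠ 0}

/-- `Φ` is a holomorphic function of two variables near `(x(τ), y(τ))` with
`F = Φ(x, y)` near `τ`, i.e. `Φ` is a local expression of `F` as a function of `x` and `y`. -/
def IsLocalExpression (s : SporadicCase) (τ : ℂ × ℂ) (Φ : ℂ × ℂ → ℂ) : Prop :=
  AnalyticAt ℂ Φ (s.x τ, s.y τ) ∧ ∀ᶠ σ in 𝓝 τ, s.F σ = Φ (s.x σ, s.y σ)

end SporadicCase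

/-- The operator `θ_x = x ∂/∂x` on functions of `p = (x, y)`. -/
noncomputable def thetaX (Φ : ℂ × ℂ → ℂ) (p : ℂ × ℂ) : ℂ :=
  p.1 * deriv (fun z => Φ (z, p.2)) p.1

/-- The operator `θ_y = y ∂/∂y` on functions of `p = (x, y)`. -/
noncomputable def thetaY (Φ : ℂ × ℂ → ℂ) (p : ℂ × ℂ) : ℂ :=
  p.2 * deriv (fun z => Φ (p.1, z)) p.2

/-- The operator
`θ_x (θ_x - 2 θ_y) - x (a θ_x² + a θ_x + b) + c x² (θ_x + 1)²
  + c x² (θ_x + 1) (4 y θ_x + (2 - 8 y) θ_y)`. -/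
noncomputable def pdeOne (a b c : ℂ) (Φ : ℂ × ℂ → ℂ) (p : ℂ × ℂ) : ℂ :=
  thetaX (fun r => thetaX Φ r - 2 * thetaY Φ r) p
    - p.1 * (a * thetaX (thetaX Φ) p + a * thetaX Φ p + b * Φ p)
    + c * p.1 ^ 2 * (thetaX (fun r => thetaX Φ r + Φ r) p + (thetaX Φ p + Φ p))
    + c * p.1 ^ 2 *
      (thetaX (fun r => 4 * r.2 * thetaX Φ r + (2 - 8 * r.2) * thetaY Φ r) p
        + (4 * p.2 * thetaX Φ p + (2 - 8 * p.2) * thetaY Φ p))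

/-- The operator `θ_y² - y (2 θ_y - θ_x + 1) (2 θ_y - θ_x)`. -/
noncomputable def pdeTwo (Φ : ℂ × ℂ → ℂ) (p : ℂ × ℂ) : ℂ :=
  thetaY (thetaY Φ) p
    - p.2 * (2 * thetaY (fun r => 2 * thetaY Φ r - thetaX Φ r) p
      - thetaX (fun r => 2 * thetaY Φ r - thetaX Φ r) p
      + (2 * thetaY Φ p - thetaX Φ p))

/-! The functions `t` and `f` are modular, of weights zero and one, for a group of finite index in
`SL(2, ℤ)`, and the system of partial differential equations is a formal consequence of the
differential equations which they satisfy on the upper half-plane.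

**The differential equations in one variable.** Put `D = (2πi)⁻¹ d/dτ`. In each case there is a
modular unit `E` of weight two such that at every cusp exactly one of the following holds: `t` has a
simple zero; `E` has a simple zero and `t` is finite and nonzero; `t` has a simple pole and `f` a
simple zero; all other orders are zero (`CuspCondition`). A holomorphic function of weight zero
without poles at the cusps is constant. Applied to `D t / (t E)`, to the second derivative of
`E / f²` with respect to `t`, and, by Bol's identity, to the first derivative with respect to `t` of
`D² (1 / f) / (E f t)`, this gives
`D t = t E`, `E = f² (1 - a t + c t²)`, `D² (1 / f) = -f³ (1 - a t + c t²) t (b - c t)`,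
where the constants are read off from the `q`-expansions to second order
(`IsModularSystem.of_isModularUnit`).

**Modularity.** Five cases concern eta quotients. Their 24th powers are products of powers of
functions `Δ(m τ)`, whose behaviour under `SL(2, ℤ)` and whose orders at the cusps are elementary,
and a holomorphic root of a modular unit is a modular unit (`IsModularUnit.root`). In level five,
`t` is a quotient of values of the odd theta function at points of order five
(`thetaPow_div_pow_five`). The inversion formula of this theta function, up to a constant, follows
from Liouville's theorem since its zeros are simple and form the lattice
(`exists_thetaProd_inversion`); so `SL(2, ℤ)` permutes the division values up to a common factor
(`exists_thetaPow_smul`). As `f² t` is an eta quotient, `f` is a modular unit as well.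

**The system in two variables.** With `h = D f / f²`, the equations above say that `t`, `f`, `h`
satisfy a first order system with polynomial coefficients (`IsFirstOrderSystem`). For fixed `τ₂`,
the product `F` therefore satisfies a second order equation in `τ₁`. If `F = Φ(x, y)`, then the
chain rule turns it into
`t₁ (1 - a t₁ + c t₁²) / x · (first equation) + (1 - c t₁²)² · (second equation) = 0`
(`combination_eq_zero`, resting on the rational function identities in `coeff_identity`). By
symmetry the same holds with `τ₁` and `τ₂` exchanged. The determinant of these two combinations is,
up to a factor without zeros, the Jacobian of `(x, y)` (`jacobian_ne_zero_iff`). So both equations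
hold where the Jacobian does not vanish (`pde_eq_zero`). For fixed `τ₁`, the Jacobian and the
denominators vanish only where `t₂` is a root of a nonzero polynomial, whence density
(`subset_closure_coordinateSet`). At coordinate points `Φ` exists by the inverse function theorem
(`exists_isLocalExpression`), and at an arbitrary regular point the system follows by analytic
continuation from nearby coordinate points (`eventually_pde_eq_zero`). -/

namespace Bimodular

open UpperHalfPlane hiding I
open scoped MatrixGroups ModularForm Manifold Real Derivative

local notation "𝕢" => Function.Periodic.qParam

/-! ### Expansions at infinity -/

/-- `G(τ) = w ^ n * A(w)` with `w = exp (2 π i τ / W)` for `τ` of large imaginary part, where `A` is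
analytic at `0`. The leading coefficient `A 0` may vanish, so `n` only bounds the order from
below. -/
def HasExpansion (W : ℕ) (n : ℤ) (A : ℂ → ℂ) (G : ℍ → ℂ) : Prop :=
  AnalyticAt ℂ A 0 ∧ ∀ᶠ τ : ℍ in atImInfty, G τ = 𝕢 W τ ^ n * A (𝕢 W τ)

lemma tendsto_qParam {W : ℕ} (hW : 0 < W) :
    Tendsto (fun τ : ℍ ↦ 𝕢 W τ) atImInfty (𝓝 0) :=
  qParam_tendsto_atImInfty (by exact_mod_cast hW)

namespace HasExpansion

variable {W : ℕ} {n m : ℤ} {A B : ℂ → ℂ} {G H : ℍ → ℂ}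

lemma congr (h : HasExpansion W n A G) (hGH : H =ᶠ[atImInfty] G) : HasExpansion W n A H :=
  ⟨h.1, by filter_upwards [h.2, hGH] with τ h1 h2; rw [h2, h1]⟩

lemma congr_coeff (hW : 0 < W) (h : HasExpansion W n A G) (hAB : B =ᶠ[𝓝 0] A) :
    HasExpansion W n B G :=
  ⟨h.1.congr hAB.symm, by
    filter_upwards [h.2, (tendsto_qParam hW).eventually hAB] with τ h1 h2; rw [h2, h1]⟩

lemma mul (h : HasExpansion W n A G) (h' : HasExpansion W m B H) :
    HasExpansion W (n + m) (fun w ↦ A w * B w) (fun τ ↦ G τ * H τ) :=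
  ⟨h.1.mul h'.1, by
    filter_upwards [h.2, h'.2] with τ h1 h2
    rw [h1, h2, zpow_add₀ (Function.Periodic.qParam_ne_zero _)]; ring⟩

lemma inv (h : HasExpansion W n A G) (hA : A 0 ≠ 0) :
    HasExpansion W (-n) (fun w ↦ (A w)⁻¹) (fun τ ↦ (G τ)⁻¹) :=
  ⟨h.1.inv hA, by filter_upwards [h.2] with τ h1; rw [h1, zpow_neg, mul_inv]⟩

lemma div (h : HasExpansion W n A G) (h' : HasExpansion W m B H) (hB : B 0 ≠ 0) :
    HasExpansion W (n - m) (fun w ↦ A w / B w) (fun τ ↦ G τ / H τ) := by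
  simpa only [div_eq_mul_inv, sub_eq_add_neg] using h.mul (h'.inv hB)

/-- A lower bound for the order may be weakened. -/
lemma mono (h : HasExpansion W n A G) (hmn : m ≤ n) :
    HasExpansion W m (fun w ↦ w ^ (n - m).toNat * A w) G :=
  ⟨(analyticAt_id.pow _).mul h.1, by
    filter_upwards [h.2] with τ h1
    have h2 : ((n - m).toNat : ℤ) = n - m := Int.toNat_of_nonneg (by lia)
    have h3 : 𝕢 W τ ^ n = 𝕢 W τ ^ m * 𝕢 W τ ^ (n - m).toNat := by
      rw [← zpow_natCast, h2, ← zpow_add₀ (Function.Periodic.qParam_ne_zero _)]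
      congr 1; ring
    rw [h1, h3]; ring⟩

lemma tendsto (hW : 0 < W) (h : HasExpansion W 0 A G) : Tendsto G atImInfty (𝓝 (A 0)) := by
  have h1 : Tendsto (fun τ : ℍ ↦ A (𝕢 W τ)) atImInfty (𝓝 (A 0)) :=
    h.1.continuousAt.tendsto.comp (tendsto_qParam hW)
  refine h1.congr' ?_
  filter_upwards [h.2] with τ h2
  simp [h2]

lemma bounded (hW : 0 < W) (h : HasExpansion W n A G) (hn : 0 ≤ n) : IsBoundedAtImInfty G :=
  ((h.mono hn).tendsto hW).isBigO_one ℝ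

/-- The term-by-term derivative of an expansion. -/
lemma deriv (hW : 0 < W) (h : HasExpansion W n A G) :
    HasExpansion W n (fun w ↦ (n * A w + w * deriv A w) / W) (D G) := by
  refine ⟨((analyticAt_const.mul h.1).add (analyticAt_id.mul h.1.deriv)).div_const, ?_⟩
  obtain ⟨R, hR⟩ := (atImInfty_mem _).1 h.2
  filter_upwards [(tendsto_qParam hW).eventually h.1.eventually_analyticAt,
    (atImInfty_mem _).2 ⟨R + 1, fun z hz ↦ hz⟩] with τ hA hτ
  have hW' : (W : ℂ) ≠ 0 := by exact_mod_cast hW.ne'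
  have hW2 : ((W : ℝ) : ℂ) ≠ 0 := by exact_mod_cast hW.ne'
  have heq : G ∘ ofComplex =ᶠ[𝓝 (τ : ℂ)] fun z ↦ 𝕢 W z ^ n * A (𝕢 W z) := by
    have h1 : {z : ℂ | max R 0 < z.im} ∈ 𝓝 (τ : ℂ) := by
      apply (isOpen_lt continuous_const Complex.continuous_im).mem_nhds
      have : R + 1 ≤ τ.im := hτ
      simp only [Set.mem_ofPred_eq, coe_im, sup_lt_iff]
      exact ⟨by linarith, τ.im_pos⟩
    filter_upwards [h1] with z hz
    simp only [sup_lt_iff] at hz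
    have := hR ⟨z, hz.2⟩ hz.1.le
    simpa [Function.comp_apply, ofComplex_apply_of_im_pos hz.2] using this
  have hq : HasDerivAt (𝕢 W) (2 * π * I / W * 𝕢 W τ) (τ : ℂ) := by
    have h1 : HasDerivAt (fun z : ℂ ↦ 2 * π * I * z / (W : ℝ)) (2 * π * I / W) (τ : ℂ) := by
      have := ((hasDerivAt_id (τ : ℂ)).const_mul (2 * π * I)).div_const ((W : ℝ) : ℂ)
      simpa using this
    have h2 := h1.cexp
    rw [mul_comm (cexp _)] at h2
    exact h2
  have hq0 := Function.Periodic.qParam_ne_zero (h := (W : ℝ)) (τ : ℂ)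
  have hd : HasDerivAt (fun z ↦ 𝕢 W z ^ n * A (𝕢 W z)) _ (τ : ℂ) :=
    ((hasDerivAt_zpow n (𝕢 W τ) (Or.inl hq0)).comp (τ : ℂ) hq).mul
      (hA.differentiableAt.hasDerivAt.comp (τ : ℂ) hq)
  rw [Derivative.normalizedDerivOfComplex, heq.deriv_eq]
  rw [hd.deriv, zpow_sub_one₀ hq0]
  simp only [Function.comp_apply]
  have hpi : (π : ℂ) ≠ 0 := by exact_mod_cast Real.pi_ne_zero
  field_simp

/-- The derivative of a function with nonnegative order has positive order. -/
lemma deriv_zero (hW : 0 < W) (h : HasExpansion W 0 A G) :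
    HasExpansion W 1 (fun w ↦ _root_.deriv A w / W) (D G) := by
  refine ⟨h.1.deriv.div_const, ?_⟩
  filter_upwards [(h.deriv hW).2] with τ h1
  rw [h1]; simp; ring

end HasExpansion

/-! ### Constancy criteria -/

lemma isPreconnected_im_gt (R : ℝ) : IsPreconnected {τ : ℍ | R < τ.im} := by
  have h1 : IsPreconnected {z : ℂ | max R 0 < z.im} :=
    (convex_halfSpace_im_gt _).isPreconnected
  have h2 : ContinuousOn (ofComplex : ℂ → ℍ) {z : ℂ | max R 0 < z.im} := fun z hz ↦
    (mdifferentiableAt_ofComplex ((le_max_right R 0).trans_lt hz)).continuousAt.continuousWithinAt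
  convert h1.image _ h2 using 1
  ext τ
  constructor
  · intro h
    refine ⟨τ, ?_, ofComplex_apply τ⟩
    have h' : R < τ.im := h
    simp only [Set.mem_ofPred_eq, coe_im, sup_lt_iff]
    exact ⟨h', τ.im_pos⟩
  · rintro ⟨z, hz, rfl⟩
    have hz' : max R 0 < z.im := hz
    have h0 : 0 < z.im := (le_max_right R 0).trans_lt hz'
    have : R < (ofComplex z).im := by
      rw [ofComplex_apply_of_im_pos h0]
      exact (le_max_left R 0).trans_lt hz'
    exact this

/-- A continuous function on a half-plane, some power of which is constant, is constant. -/
lemma exists_const_of_pow_eq {R : ℝ} {ρ : ℍ → ℂ} (hρ : ContinuousOn ρ {τ : ℍ | R < τ.im}) {n : ℕ}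
    (hn : n ≠ 0) {c : ℂ} (h : ∀ τ : ℍ, R < τ.im → ρ τ ^ n = c) :
    ∃ ζ : ℂ, ζ ^ n = c ∧ ∀ τ : ℍ, R < τ.im → ρ τ = ζ := by
  have hpre := (isPreconnected_im_gt R).image _ hρ
  have hfin : {z : ℂ | z ^ n = c}.Finite := by
    refine ((Polynomial.nthRoots n c).toFinset.finite_toSet).subset fun z hz ↦ ?_
    simpa [Polynomial.mem_nthRoots (Nat.pos_of_ne_zero hn)] using hz
  have hsub : (ρ '' {τ : ℍ | R < τ.im}).Subsingleton := by
    refine hfin.countable.isTotallyDisconnected _ ?_ hpre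
    rintro _ ⟨τ, hτ, rfl⟩
    exact h τ hτ
  obtain ⟨τ₀, hτ₀⟩ : ∃ τ₀ : ℍ, R < τ₀.im :=
    ⟨⟨⟨0, max R 0 + 1⟩, by positivity⟩, lt_of_le_of_lt (le_max_left R 0) (lt_add_one _)⟩
  exact ⟨ρ τ₀, h τ₀ hτ₀, fun τ hτ ↦ hsub ⟨τ, hτ, rfl⟩ ⟨τ₀, hτ₀, rfl⟩⟩

lemma exists_const_of_pow_eq_univ {ρ : ℍ → ℂ} (hρ : Continuous ρ) {n : ℕ}
    (hn : n ≠ 0) {c : ℂ} (h : ∀ τ : ℍ, ρ τ ^ n = c) :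
    ∃ ζ : ℂ, ζ ^ n = c ∧ ∀ τ : ℍ, ρ τ = ζ := by
  obtain ⟨ζ, h1, h2⟩ := exists_const_of_pow_eq (R := 0) hρ.continuousOn hn (fun τ _ ↦ h τ)
  exact ⟨ζ, h1, fun τ ↦ h2 τ τ.im_pos⟩

/-- A holomorphic function of weight zero which is invariant under a subgroup of finite index up to
roots of unity, and bounded at all cusps, is constant. -/
lemma exists_const_of_bounded_at_cusps (Γ : Subgroup SL(2, ℤ)) [Γ.FiniteIndex] {H : ℍ → ℂ}
    (hH : MDiff H) {n : ℕ} (hn : n ≠ 0)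
    (hinv : ∀ γ ∈ Γ, ∃ ζ : ℂ, ζ ^ n = 1 ∧ ∀ τ, H (γ • τ) = ζ * H τ)
    (hb : ∀ γ : SL(2, ℤ), IsBoundedAtImInfty fun τ ↦ H (γ • τ)) :
    ∃ c : ℂ, ∀ τ, H τ = c := by
  let φ : ModularForm (Γ : Subgroup (GL (Fin 2) ℝ)) 0 :=
    { toFun := fun τ ↦ H τ ^ n
      slash_action_eq' := by
        rintro _ ⟨γ, hγ, rfl⟩
        ext τ
        obtain ⟨ζ, h1, h2⟩ := hinv γ hγ
        have := ModularForm.SL_slash_apply (k := 0) (f := fun τ ↦ H τ ^ n) γ τ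
        rw [ModularForm.SL_slash] at this
        refine this.trans ?_
        rw [neg_zero, zpow_zero, mul_one]
        rw [h2, mul_pow, h1, one_mul]
      holo' := by
        rw [UpperHalfPlane.mdifferentiable_iff] at hH ⊢
        exact hH.pow n
      bdd_at_cusps' := by
        intro c hc
        rw [Subgroup.IsArithmetic.isCusp_iff_isCusp_SL2Z] at hc
        rw [OnePoint.isBoundedAt_iff_forall_SL2Z hc]
        intro γ _
        have h1 : (fun τ ↦ H τ ^ n) ∣[(0 : ℤ)] γ = fun τ ↦ H (γ • τ) ^ n := by
          ext τ; simp [ModularForm.SL_slash_apply]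
        rw [h1]
        have := (hb γ).pow n
        simpa [IsBoundedAtImInfty, BoundedAtFilter, Pi.one_def] using this }
  obtain ⟨c, hc⟩ := ModularForm.eq_const_of_weight_zero φ
  obtain ⟨ζ, -, h⟩ := exists_const_of_pow_eq_univ hH.continuous hn (c := c)
    (fun τ ↦ congrFun hc τ)
  exact ⟨ζ, h⟩

/-- A holomorphic function with vanishing derivative is constant. -/
lemma eq_of_deriv_eq_zero {G : ℍ → ℂ} (hG : MDiff G) (h : ∀ τ, D G τ = 0) (τ σ : ℍ) :
    G τ = G σ := by
  have hd := UpperHalfPlane.mdifferentiable_iff.1 hG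
  have := isOpen_upperHalfPlaneSet.is_const_of_deriv_eq_zero
    (convex_halfSpace_im_gt 0).isPreconnected hd (fun z hz ↦ ?_) τ.2 σ.2
  · simpa using this
  · have h1 := h ⟨z, hz⟩
    have hpi : (2 * π * I : ℂ)⁻¹ ≠ 0 := inv_ne_zero Complex.two_pi_I_ne_zero
    simpa [Derivative.normalizedDerivOfComplex, hpi] using h1

/-- A function some power of which has an expansion with nonzero leading coefficient has such an
expansion itself. -/
lemma HasExpansion.root {W : ℕ} (hW : 0 < W) {n : ℕ} (hn : n ≠ 0) {o : ℤ} {A : ℂ → ℂ} {G : ℍ → ℂ}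
    (hG : Continuous G) (h : HasExpansion W (n * o) A (fun τ ↦ G τ ^ n)) (hA : A 0 ≠ 0) :
    ∃ B, HasExpansion W o B G ∧ B 0 ≠ 0 := by
  -- `A = A 0 * exp (log (A / A 0))` near `0`, so `A` has an analytic root `r` there
  let r : ℂ → ℂ := fun w ↦ (A 0) ^ (1 / n : ℂ) * (A w / A 0) ^ (1 / n : ℂ)
  have hn' : (n : ℂ) ≠ 0 := by exact_mod_cast hn
  have hr : AnalyticAt ℂ r 0 := by
    refine analyticAt_const.mul (AnalyticAt.cpow (h.1.div analyticAt_const hA) analyticAt_const ?_)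
    simp [hA]
  have hrA : ∀ w, r w ^ n = A w := by
    intro w
    simp only [r, mul_pow, one_div]
    rw [cpow_nat_inv_pow _ hn, cpow_nat_inv_pow _ hn]
    field_simp
  have hr0 : r 0 ≠ 0 := fun h0 ↦ hA (by rw [← hrA, h0, zero_pow hn])
  have hne : ∀ᶠ w in 𝓝 (0 : ℂ), r w ≠ 0 ∧ AnalyticAt ℂ r w :=
    (hr.continuousAt.eventually_ne hr0).and hr.eventually_analyticAt
  obtain ⟨R, hR⟩ := (atImInfty_mem _).1 (((tendsto_qParam hW).eventually hne).and h.2)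
  let ρ : ℍ → ℂ := fun τ ↦ G τ / (𝕢 W τ ^ o * r (𝕢 W τ))
  have hq (τ : ℍ) : 𝕢 W τ ≠ 0 := Function.Periodic.qParam_ne_zero _
  have hqc : Continuous fun τ : ℍ ↦ 𝕢 W τ :=
    Function.Periodic.continuous_qParam.comp UpperHalfPlane.continuous_coe
  have hρ : ContinuousOn ρ {τ : ℍ | R < τ.im} := by
    intro τ hτ
    obtain ⟨⟨h1, h2⟩, -⟩ := hR τ (le_of_lt hτ)
    refine ContinuousAt.continuousWithinAt (hG.continuousAt.div ?_
      (mul_ne_zero (zpow_ne_zero _ (hq τ)) h1))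
    exact (hqc.continuousAt.zpow₀ _ (Or.inl (hq τ))).mul
      (ContinuousAt.comp (f := fun τ : ℍ ↦ 𝕢 W τ) h2.continuousAt hqc.continuousAt)
  obtain ⟨ζ, hζ, hζ'⟩ := exists_const_of_pow_eq hρ hn (c := 1) fun τ hτ ↦ by
    obtain ⟨⟨h1, -⟩, h2⟩ := hR τ (le_of_lt hτ)
    have h2' : G τ ^ n = 𝕢 W τ ^ ((n : ℤ) * o) * A (𝕢 W τ) := h2
    have : (𝕢 W τ ^ o) ^ n = 𝕢 W τ ^ ((n : ℤ) * o) := by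
      rw [← zpow_natCast, ← zpow_mul, mul_comm]
    rw [div_pow, h2', mul_pow, hrA, this]
    refine div_self (mul_ne_zero (zpow_ne_zero _ (hq τ)) ?_)
    rw [← hrA]; exact pow_ne_zero _ h1
  refine ⟨fun w ↦ ζ * r w, ⟨analyticAt_const.mul hr, ?_⟩, mul_ne_zero ?_ hr0⟩
  · filter_upwards [(atImInfty_mem _).2 ⟨R + 1, fun z hz ↦ hz⟩] with τ hτ
    have hτ' : R < τ.im := (lt_add_one R).trans_le hτ
    have h1 := hζ' τ hτ'
    have h2 := (hR τ hτ'.le).1.1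
    rw [div_eq_iff (mul_ne_zero (zpow_ne_zero _ (hq τ)) h2)] at h1
    rw [h1]; ring
  · rintro rfl
    simp [hn] at hζ

/-! ### Modular units -/

/-- A modular unit of weight `k` for the group `Γ`, with a character: a nowhere vanishing
holomorphic function on the upper half-plane, invariant under `Γ` up to roots of unity of bounded
order, and of exact order `o γ` in `exp (2 π i τ / W γ)` at the cusp `γ ∞`, for all `γ`. -/
structure IsModularUnit (Γ : Subgroup SL(2, ℤ)) (W : SL(2, ℤ) → ℕ) (k : ℤ) (o : SL(2, ℤ) → ℤ)
    (G : ℍ → ℂ) : Prop where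
  mdiff : MDiff G
  ne_zero : ∀ τ, G τ ≠ 0
  char : ∃ n : ℕ, n ≠ 0 ∧ ∀ γ ∈ Γ, ∃ ζ : ℂ, ζ ^ n = 1 ∧ ∀ τ, (G ∣[k] γ) τ = ζ * G τ
  expansion : ∀ γ : SL(2, ℤ), ∃ A, HasExpansion (W γ) (o γ) A (G ∣[k] γ) ∧ A 0 ≠ 0

lemma mdifferentiable_zpow {G : ℍ → ℂ} (hG : MDiff G) (h : ∀ τ, G τ ≠ 0) (r : ℤ) :
    MDiff fun τ ↦ G τ ^ r := by
  rw [UpperHalfPlane.mdifferentiable_iff] at hG ⊢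
  exact fun z hz ↦ (hG z hz).zpow (Or.inl (h _))

lemma mdifferentiable_inv {G : ℍ → ℂ} (hG : MDiff G) (h : ∀ τ, G τ ≠ 0) :
    MDiff fun τ ↦ (G τ)⁻¹ := by
  simpa using mdifferentiable_zpow hG h (-1)

lemma mdifferentiable_mul {G H : ℍ → ℂ} (hG : MDiff G) (hH : MDiff H) :
    MDiff fun τ ↦ G τ * H τ := by
  rw [UpperHalfPlane.mdifferentiable_iff] at hG hH ⊢
  exact hG.mul hH

lemma mdifferentiable_div {G H : ℍ → ℂ} (hG : MDiff G) (hH : MDiff H) (h : ∀ τ, H τ ≠ 0) :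
    MDiff fun τ ↦ G τ / H τ := by
  simpa only [div_eq_mul_inv] using mdifferentiable_mul hG (mdifferentiable_inv hH h)

namespace IsModularUnit

variable {Γ : Subgroup SL(2, ℤ)} {W : SL(2, ℤ) → ℕ} {k l : ℤ} {o o' : SL(2, ℤ) → ℤ} {G H : ℍ → ℂ}

lemma mul (hG : IsModularUnit Γ W k o G) (hH : IsModularUnit Γ W l o' H) :
    IsModularUnit Γ W (k + l) (fun γ ↦ o γ + o' γ) (fun τ ↦ G τ * H τ) where
  mdiff := mdifferentiable_mul hG.mdiff hH.mdiff
  ne_zero τ := mul_ne_zero (hG.ne_zero τ) (hH.ne_zero τ)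
  char := by
    obtain ⟨n, hn, h⟩ := hG.char
    obtain ⟨n', hn', h'⟩ := hH.char
    refine ⟨n * n', mul_ne_zero hn hn', fun γ hγ ↦ ?_⟩
    obtain ⟨ζ, h1, h2⟩ := h γ hγ
    obtain ⟨ζ', h1', h2'⟩ := h' γ hγ
    refine ⟨ζ * ζ', ?_, fun τ ↦ ?_⟩
    · rw [mul_pow, pow_mul, h1, mul_comm n, pow_mul, h1']; simp
    · have := congrFun (ModularForm.mul_slash_SL2 k l γ G H) τ
      refine this.trans ?_
      rw [Pi.mul_apply, h2, h2']; ring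
  expansion γ := by
    obtain ⟨A, h1, h2⟩ := hG.expansion γ
    obtain ⟨B, h1', h2'⟩ := hH.expansion γ
    refine ⟨_, (h1.mul h1').congr (Eventually.of_forall fun τ ↦ ?_), mul_ne_zero h2 h2'⟩
    exact congrFun (ModularForm.mul_slash_SL2 k l γ G H) τ

lemma zpow (hG : IsModularUnit Γ W k o G) (r : ℤ) :
    IsModularUnit Γ W (r * k) (fun γ ↦ r * o γ) (fun τ ↦ G τ ^ r) := by
  have key (γ : SL(2, ℤ)) (τ : ℍ) :
      ((fun τ ↦ G τ ^ r) ∣[r * k] γ) τ = ((G ∣[k] γ) τ) ^ r := by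
    rw [ModularForm.SL_slash_apply, ModularForm.SL_slash_apply, mul_zpow, ← zpow_mul]
    congr 2; ring
  refine ⟨mdifferentiable_zpow hG.mdiff hG.ne_zero r, fun τ ↦ zpow_ne_zero _ (hG.ne_zero τ),
    ?_, fun γ ↦ ?_⟩
  · obtain ⟨n, hn, h⟩ := hG.char
    refine ⟨n, hn, fun γ hγ ↦ ?_⟩
    obtain ⟨ζ, h1, h2⟩ := h γ hγ
    refine ⟨ζ ^ r, ?_, fun τ ↦ ?_⟩
    · rw [← zpow_natCast, ← zpow_mul, mul_comm, zpow_mul, zpow_natCast, h1, one_zpow]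
    · rw [key, h2, mul_zpow]
  · obtain ⟨A, h1, h2⟩ := hG.expansion γ
    refine ⟨fun w ↦ A w ^ r, ⟨h1.1.fun_zpow h2, ?_⟩, zpow_ne_zero _ h2⟩
    filter_upwards [h1.2] with τ h
    rw [key, h, mul_zpow, ← zpow_mul, mul_comm r]

lemma congr (hG : IsModularUnit Γ W k o G) (ho : ∀ γ, o' γ = o γ) (hk : l = k)
    (hGH : ∀ τ, H τ = G τ) : IsModularUnit Γ W l o' H := by
  obtain rfl : o' = o := funext ho
  obtain rfl : H = G := funext hGH
  exact hk ▸ hG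

lemma inv (hG : IsModularUnit Γ W k o G) :
    IsModularUnit Γ W (-k) (fun γ ↦ -o γ) (fun τ ↦ (G τ)⁻¹) :=
  (hG.zpow (-1)).congr (by simp) (by simp) (by simp)

lemma div (hG : IsModularUnit Γ W k o G) (hH : IsModularUnit Γ W l o' H) :
    IsModularUnit Γ W (k - l) (fun γ ↦ o γ - o' γ) (fun τ ↦ G τ / H τ) :=
  (hG.mul hH.inv).congr (fun _ ↦ sub_eq_add_neg _ _) (sub_eq_add_neg _ _)
    (fun _ ↦ div_eq_mul_inv _ _)

/-- A holomorphic root of a modular unit is a modular unit. -/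
lemma root (hW : ∀ γ, 0 < W γ) {n : ℕ} (hn : n ≠ 0) (hG : MDiff G)
    (h : IsModularUnit Γ W (n * k) (fun γ ↦ n * o γ) (fun τ ↦ G τ ^ n)) :
    IsModularUnit Γ W k o G := by
  have key (γ : SL(2, ℤ)) (τ : ℍ) :
      ((fun τ ↦ G τ ^ n) ∣[(n : ℤ) * k] γ) τ = ((G ∣[k] γ) τ) ^ n := by
    rw [ModularForm.SL_slash_apply, ModularForm.SL_slash_apply, mul_pow, ← zpow_natCast (_ ^ (-k)),
      ← zpow_mul]
    congr 2; ring
  have hne (τ : ℍ) : G τ ≠ 0 := fun h0 ↦ h.ne_zero τ (by simp [h0, hn])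
  have hcont (γ : SL(2, ℤ)) : Continuous (G ∣[k] γ) := by
    have : G ∣[k] γ = fun τ ↦ G (γ • τ) * denom γ τ ^ (-k) := ModularForm.SL_slash_def _ _
    rw [this]
    refine (hG.continuous.comp ?_).mul ((mdifferentiable_denom_zpow _ _).continuous)
    exact (mdifferentiable_smul (g := (γ : GL (Fin 2) ℝ)) (by simp)).continuous
  refine ⟨hG, hne, ?_, fun γ ↦ ?_⟩
  · obtain ⟨m, hm, h'⟩ := h.char
    refine ⟨n * m, mul_ne_zero hn hm, fun γ hγ ↦ ?_⟩
    obtain ⟨ζ, h1, h2⟩ := h' γ hγ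
    obtain ⟨ξ, h3, h4⟩ := exists_const_of_pow_eq_univ (ρ := fun τ ↦ (G ∣[k] γ) τ / G τ)
      ((hcont γ).div hG.continuous hne) hn (c := ζ) fun τ ↦ by
        rw [div_pow, div_eq_iff (pow_ne_zero _ (hne τ)), ← h2, key]
    refine ⟨ξ, by rw [pow_mul, h3, h1], fun τ ↦ ?_⟩
    rw [← h4 τ, div_mul_cancel₀ _ (hne τ)]
  · obtain ⟨A, h1, h2⟩ := h.expansion γ
    exact HasExpansion.root (hW γ) hn (hcont γ)
      (h1.congr (Eventually.of_forall fun τ ↦ (key γ τ).symm)) h2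

end IsModularUnit

/-! ### Derivatives and the slash action -/

lemma mdifferentiable_deriv {G : ℍ → ℂ} (hG : MDiff G) : MDiff (D G) :=
  Derivative.normalizedDerivOfComplex_mdifferentiable hG

lemma mdifferentiable_slash {G : ℍ → ℂ} (hG : MDiff G) (k : ℤ) (γ : SL(2, ℤ)) :
    MDiff (G ∣[k] γ) :=
  hG.slash k _

lemma deriv_slash_zero {G : ℍ → ℂ} (hG : MDiff G) (γ : SL(2, ℤ)) :
    (D G) ∣[(2 : ℤ)] γ = D (G ∣[(0 : ℤ)] γ) := by
  rw [Derivative.normalizedDerivOfComplex_SL_slash (k := 0) hG]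
  ext τ
  simp

/-- Bol's identity in weight `-1`: the second derivative intertwines the actions of weights `-1`
and `3`. -/
lemma deriv_deriv_slash {F : ℍ → ℂ} (hF : MDiff F) (γ : SL(2, ℤ)) :
    (D (D F)) ∣[(3 : ℤ)] γ = D (D (F ∣[(-1 : ℤ)] γ)) := by
  have h1 := Derivative.normalizedDerivOfComplex_SL_slash (k := -1) (γ := γ) hF
  have h2 := Derivative.normalizedDerivOfComplex_SL_slash (k := 1) (γ := γ)
    (mdifferentiable_deriv hF)
  rw [show (-1 : ℤ) + 2 = 1 by norm_num] at h1
  rw [show (1 : ℤ) + 2 = 3 by norm_num] at h2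
  set g : GL (Fin 2) ℝ := (γ : GL (Fin 2) ℝ) with hg
  set j : ℍ → ℂ := fun τ ↦ denom g τ ^ (-1 : ℤ) with hj
  have hjm : MDiff j := mdifferentiable_denom_zpow g (-1)
  have hA : MDiff ((D F) ∣[(1 : ℤ)] γ) := mdifferentiable_slash (mdifferentiable_deriv hF) 1 γ
  have hB : MDiff (F ∣[(-1 : ℤ)] γ) := mdifferentiable_slash hF (-1) γ
  set e : ℂ := (2 * π * I)⁻¹ * (γ 1 0 : ℂ) with he
  have h1' : D (F ∣[(-1 : ℤ)] γ) = (D F) ∣[(1 : ℤ)] γ + e • (j * F ∣[(-1 : ℤ)] γ) := by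
    rw [h1]
    ext τ
    simp only [Pi.sub_apply, Pi.add_apply, Pi.smul_apply, Pi.mul_apply, smul_eq_mul, hj, he,
      zpow_neg_one]
    push_cast
    ring
  have hDj : D j = -e • (j * j) := by
    ext τ
    have h3 : j ∘ ofComplex =ᶠ[𝓝 (τ : ℂ)] fun z ↦ denom g z ^ (-1 : ℤ) := by
      filter_upwards [isOpen_upperHalfPlaneSet.mem_nhds τ.im_pos] with w hw
      simp [hj, ofComplex_apply_of_im_pos hw]
    rw [Derivative.normalizedDerivOfComplex, h3.deriv_eq, deriv_denom_zpow]
    have h4 : ((g 1 0 : ℝ) : ℂ) = (γ 1 0 : ℂ) := by simp [hg]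
    have h5 : denom g τ ^ (-1 - 1 : ℤ) = j τ * j τ := by
      rw [hj, ← zpow_add₀ (denom_ne_zero g τ)]; norm_num
    rw [h4, h5]
    simp [he]
    ring
  rw [h1', Derivative.normalizedDerivOfComplex_add _ _ hA ((hjm.mul hB).const_smul e),
    Derivative.normalizedDerivOfComplex_smul _ _ (hjm.mul hB),
    Derivative.normalizedDerivOfComplex_mul _ _ hjm hB, h1', h2, hDj]
  ext τ
  simp only [Pi.sub_apply, Pi.add_apply, Pi.smul_apply, Pi.mul_apply, smul_eq_mul, hj, he,
    zpow_neg_one]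
  push_cast
  ring

/-! ### Weakly modular forms with prescribed orders at the cusps -/

/-- A holomorphic function on the upper half-plane which is invariant in weight `k` under `Γ` up to
roots of unity of bounded order, and of order at least `o γ` in `exp (2 π i τ / W γ)` at the cusp
`γ ∞`, for all `γ`. -/
structure IsWeakForm (Γ : Subgroup SL(2, ℤ)) (W : SL(2, ℤ) → ℕ) (k : ℤ) (o : SL(2, ℤ) → ℤ)
    (G : ℍ → ℂ) : Prop where
  mdiff : MDiff G
  char : ∃ n : ℕ, n ≠ 0 ∧ ∀ γ ∈ Γ, ∃ ζ : ℂ, ζ ^ n = 1 ∧ ∀ τ, (G ∣[k] γ) τ = ζ * G τ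
  expansion : ∀ γ : SL(2, ℤ), ∃ A, HasExpansion (W γ) (o γ) A (G ∣[k] γ)

lemma IsModularUnit.isWeakForm {Γ : Subgroup SL(2, ℤ)} {W : SL(2, ℤ) → ℕ} {k : ℤ}
    {o : SL(2, ℤ) → ℤ} {G : ℍ → ℂ} (h : IsModularUnit Γ W k o G) : IsWeakForm Γ W k o G :=
  ⟨h.mdiff, h.char, fun γ ↦ (h.expansion γ).imp fun _ hA ↦ hA.1⟩

namespace IsWeakForm

variable {Γ : Subgroup SL(2, ℤ)} {W : SL(2, ℤ) → ℕ} {k l : ℤ} {o o' : SL(2, ℤ) → ℤ} {G H : ℍ → ℂ}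

lemma div (hG : IsWeakForm Γ W k o G) (hH : IsModularUnit Γ W l o' H) :
    IsWeakForm Γ W (k - l) (fun γ ↦ o γ - o' γ) (fun τ ↦ G τ / H τ) where
  mdiff := mdifferentiable_div hG.mdiff hH.mdiff hH.ne_zero
  char := by
    obtain ⟨n, hn, h⟩ := hG.char
    obtain ⟨n', hn', h'⟩ := hH.char
    refine ⟨n * n', mul_ne_zero hn hn', fun γ hγ ↦ ?_⟩
    obtain ⟨ζ, h1, h2⟩ := h γ hγ
    obtain ⟨ζ', h1', h2'⟩ := h' γ hγ
    refine ⟨ζ / ζ', ?_, fun τ ↦ ?_⟩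
    · rw [div_pow, pow_mul, h1, mul_comm n, pow_mul, h1']; simp
    · have := congrFun (ModularForm.div_slash_SL2 k l γ G H) τ
      refine this.trans ?_
      rw [Pi.div_apply, h2, h2', mul_div_mul_comm]
  expansion γ := by
    obtain ⟨A, h1⟩ := hG.expansion γ
    obtain ⟨B, h1', h2'⟩ := hH.expansion γ
    refine ⟨_, (h1.div h1' h2').congr (Eventually.of_forall fun τ ↦ ?_)⟩
    exact congrFun (ModularForm.div_slash_SL2 k l γ G H) τ

/-- Differentiation does not lower the order, and makes an order zero positive. -/
lemma exists_hasExpansion_deriv {V : ℕ} (hV : 0 < V) {n m : ℤ} {A : ℂ → ℂ}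
    (h : HasExpansion V n A G) (hnm : m ≤ n ∨ n = 0 ∧ m ≤ 1) : ∃ B, HasExpansion V m B (D G) := by
  rcases hnm with hnm | ⟨rfl, hnm⟩
  · exact ⟨_, (h.deriv hV).mono hnm⟩
  · exact ⟨_, (h.deriv_zero hV).mono hnm⟩

lemma deriv (hW : ∀ γ, 0 < W γ) (h : IsWeakForm Γ W 0 o G)
    (ho : ∀ γ, o' γ ≤ o γ ∨ o γ = 0 ∧ o' γ ≤ 1) : IsWeakForm Γ W 2 o' (D G) where
  mdiff := mdifferentiable_deriv h.mdiff
  char := by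
    obtain ⟨n, hn, h'⟩ := h.char
    refine ⟨n, hn, fun γ hγ ↦ ?_⟩
    obtain ⟨ζ, h1, h2⟩ := h' γ hγ
    refine ⟨ζ, h1, fun τ ↦ ?_⟩
    have h3 : G ∣[(0 : ℤ)] γ = ζ • G := by ext τ; exact h2 τ
    rw [deriv_slash_zero h.mdiff, h3, Derivative.normalizedDerivOfComplex_smul _ _ h.mdiff]
    rfl
  expansion γ := by
    obtain ⟨A, hA⟩ := h.expansion γ
    rw [deriv_slash_zero h.mdiff]
    exact exists_hasExpansion_deriv (hW γ) hA (ho γ)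

lemma deriv_deriv (hW : ∀ γ, 0 < W γ) (h : IsWeakForm Γ W (-1) o G)
    (ho : ∀ γ, o' γ ≤ o γ ∨ o γ = 0 ∧ o' γ ≤ 1) : IsWeakForm Γ W 3 o' (D (D G)) where
  mdiff := mdifferentiable_deriv (mdifferentiable_deriv h.mdiff)
  char := by
    obtain ⟨n, hn, h'⟩ := h.char
    refine ⟨n, hn, fun γ hγ ↦ ?_⟩
    obtain ⟨ζ, h1, h2⟩ := h' γ hγ
    refine ⟨ζ, h1, fun τ ↦ ?_⟩
    have h3 : G ∣[(-1 : ℤ)] γ = ζ • G := by ext τ; exact h2 τ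
    rw [deriv_deriv_slash h.mdiff, h3, Derivative.normalizedDerivOfComplex_smul _ _ h.mdiff,
      Derivative.normalizedDerivOfComplex_smul _ _ (mdifferentiable_deriv h.mdiff)]
    rfl
  expansion γ := by
    obtain ⟨A, hA⟩ := h.expansion γ
    rw [deriv_deriv_slash h.mdiff]
    obtain ⟨B, hB⟩ := exists_hasExpansion_deriv (hW γ) hA (ho γ)
    exact exists_hasExpansion_deriv (hW γ) hB (Or.inl le_rfl)

/-- A weak form of weight zero and of nonnegative order at all cusps is constant. -/
lemma exists_const [Γ.FiniteIndex] (hW : ∀ γ, 0 < W γ) (h : IsWeakForm Γ W 0 o G)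
    (ho : ∀ γ, 0 ≤ o γ) : ∃ c, ∀ τ, G τ = c := by
  have h0 (γ : SL(2, ℤ)) : G ∣[(0 : ℤ)] γ = fun τ ↦ G (γ • τ) := by
    ext τ; simp [ModularForm.SL_slash_apply]
  obtain ⟨n, hn, h'⟩ := h.char
  refine exists_const_of_bounded_at_cusps Γ h.mdiff hn (fun γ hγ ↦ ?_) fun γ ↦ ?_
  · obtain ⟨ζ, h1, h2⟩ := h' γ hγ
    exact ⟨ζ, h1, fun τ ↦ by rw [← h2, h0]⟩
  · obtain ⟨A, hA⟩ := h.expansion γ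
    rw [h0] at hA
    exact hA.bounded (hW γ) (ho γ)

lemma weight_eq (h : IsWeakForm Γ W k o G) (hkl : k = l) : IsWeakForm Γ W l o G := hkl ▸ h

end IsWeakForm

/-! ### Second order jets -/

/-- `A = 1 + l₁ q + (l₂ + l₁²) / 2 q² + O(q³)`, expressed by the first two coefficients of the
logarithmic derivative, so that multiplication of functions becomes addition of jets. -/
structure IsJet (A : ℂ → ℂ) (l₁ l₂ : ℂ) : Prop where
  analyticAt : AnalyticAt ℂ A 0
  apply_zero : A 0 = 1
  logDeriv_zero : logDeriv A 0 = l₁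
  deriv_logDeriv_zero : deriv (logDeriv A) 0 = l₂

namespace IsJet

variable {A B : ℂ → ℂ} {l₁ l₂ m₁ m₂ : ℂ}

lemma ne_zero (h : IsJet A l₁ l₂) : A 0 ≠ 0 := by simp [h.apply_zero]

lemma analyticAt_logDeriv (h : IsJet A l₁ l₂) : AnalyticAt ℂ (logDeriv A) 0 :=
  h.analyticAt.deriv.div h.analyticAt h.ne_zero

lemma hasDerivAt (h : IsJet A l₁ l₂) : HasDerivAt A l₁ 0 := by
  have h1 := h.logDeriv_zero
  rw [logDeriv_apply, h.apply_zero, div_one] at h1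
  exact h1 ▸ h.analyticAt.differentiableAt.hasDerivAt

lemma hasDerivAt_logDeriv (h : IsJet A l₁ l₂) : HasDerivAt (logDeriv A) l₂ 0 :=
  h.deriv_logDeriv_zero ▸ h.analyticAt_logDeriv.differentiableAt.hasDerivAt

lemma congr (h : IsJet A l₁ l₂) (hAB : B =ᶠ[𝓝 0] A) : IsJet B l₁ l₂ := by
  have h1 : logDeriv B =ᶠ[𝓝 0] logDeriv A := by
    filter_upwards [hAB.deriv, hAB] with q h1 h2
    rw [logDeriv_apply, logDeriv_apply, h1, h2]
  exact ⟨h.analyticAt.congr hAB.symm, by rw [hAB.self_of_nhds, h.apply_zero],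
    by rw [h1.self_of_nhds, h.logDeriv_zero], by rw [h1.deriv_eq, h.deriv_logDeriv_zero]⟩

lemma mul (h : IsJet A l₁ l₂) (h' : IsJet B m₁ m₂) :
    IsJet (fun q ↦ A q * B q) (l₁ + m₁) (l₂ + m₂) := by
  have h1 : logDeriv (fun q ↦ A q * B q) =ᶠ[𝓝 0] fun q ↦ logDeriv A q + logDeriv B q := by
    filter_upwards [h.analyticAt.eventually_analyticAt, h'.analyticAt.eventually_analyticAt,
      h.analyticAt.continuousAt.eventually_ne h.ne_zero,
      h'.analyticAt.continuousAt.eventually_ne h'.ne_zero] with q h1 h2 h3 h4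
    exact logDeriv_mul q h3 h4 h1.differentiableAt h2.differentiableAt
  refine ⟨h.analyticAt.mul h'.analyticAt, by rw [h.apply_zero, h'.apply_zero, mul_one], ?_, ?_⟩
  · rw [h1.self_of_nhds, ← h.logDeriv_zero, ← h'.logDeriv_zero]
  · rw [h1.deriv_eq]
    exact (h.hasDerivAt_logDeriv.add h'.hasDerivAt_logDeriv).deriv

lemma zpow (h : IsJet A l₁ l₂) (r : ℤ) : IsJet (fun q ↦ A q ^ r) (r * l₁) (r * l₂) := by
  have h1 : logDeriv (fun q ↦ A q ^ r) =ᶠ[𝓝 0] fun q ↦ r * logDeriv A q := by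
    filter_upwards [h.analyticAt.eventually_analyticAt,
      h.analyticAt.continuousAt.eventually_ne h.ne_zero] with q h1 h3
    exact logDeriv_fun_zpow h1.differentiableAt r
  refine ⟨h.analyticAt.fun_zpow h.ne_zero, by simp [h.apply_zero], ?_, ?_⟩
  · rw [h1.self_of_nhds, ← h.logDeriv_zero]
  · rw [h1.deriv_eq]
    exact (h.hasDerivAt_logDeriv.const_mul _).deriv

lemma inv (h : IsJet A l₁ l₂) : IsJet (fun q ↦ (A q)⁻¹) (-l₁) (-l₂) := by
  simpa using h.zpow (-1)

lemma div (h : IsJet A l₁ l₂) (h' : IsJet B m₁ m₂) :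
    IsJet (fun q ↦ A q / B q) (l₁ - m₁) (l₂ - m₂) := by
  simpa only [div_eq_mul_inv, sub_eq_add_neg] using h.mul h'.inv

lemma coeff_congr (h : IsJet A l₁ l₂) (h1 : m₁ = l₁) (h2 : m₂ = l₂) : IsJet A m₁ m₂ :=
  h1 ▸ h2 ▸ h

/-- The derivative is the logarithmic derivative times the function, near `0`. -/
lemma deriv_eventuallyEq (h : IsJet A l₁ l₂) : deriv A =ᶠ[𝓝 0] fun q ↦ logDeriv A q * A q := by
  filter_upwards [h.analyticAt.continuousAt.eventually_ne h.ne_zero] with q hq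
  rw [logDeriv_apply, div_mul_cancel₀ _ hq]

end IsJet

/-! ### The differential system -/

lemma hasDerivAt_comp_ofComplex {G : ℍ → ℂ} (hG : MDiff G) (τ : ℍ) :
    HasDerivAt (G ∘ ofComplex) (2 * π * I * D G τ) τ := by
  have h := (UpperHalfPlane.mdifferentiableAt_iff.mp (hG τ)).hasDerivAt
  have : deriv (G ∘ ofComplex) τ = 2 * π * I * D G τ := by
    rw [Derivative.normalizedDerivOfComplex, mul_inv_cancel_left₀ Complex.two_pi_I_ne_zero]
  rwa [this] at h

lemma eq_const_of_hasDerivAt_zero {G : ℍ → ℂ}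
    (h : ∀ τ : ℍ, HasDerivAt (G ∘ ofComplex) 0 τ) {c : ℂ}
    (hlim : Tendsto G atImInfty (𝓝 c)) (τ : ℍ) : G τ = c := by
  have hG : MDiff G := fun τ ↦ UpperHalfPlane.mdifferentiableAt_iff.mpr (h τ).differentiableAt
  have h0 (σ : ℍ) : G σ = G τ := eq_of_deriv_eq_zero hG (fun σ ↦ by
    rw [Derivative.normalizedDerivOfComplex, (h σ).deriv, mul_zero]) σ τ
  have h1 : Tendsto G atImInfty (𝓝 (G τ)) := by
    rw [funext h0]; exact tendsto_const_nhds
  exact tendsto_nhds_unique h1 hlim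

/-- If `D G = k t E = k D t` and `G → g` at infinity, where `t` vanishes, then `G = g + k t`. -/
lemma eq_add_of_deriv_eq {G t : ℍ → ℂ} (hG : MDiff G) (ht : MDiff t) {g k : ℂ}
    (h : ∀ τ, D G τ = k * D t τ) (hlim : Tendsto G atImInfty (𝓝 g))
    (hlim' : Tendsto t atImInfty (𝓝 0)) (τ : ℍ) : G τ = g + k * t τ := by
  have h1 : G τ - k * t τ = g := by
    refine eq_const_of_hasDerivAt_zero (G := fun τ ↦ G τ - k * t τ) (fun σ ↦ ?_) ?_ τ
    · refine ((hasDerivAt_comp_ofComplex hG σ).sub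
        ((hasDerivAt_comp_ofComplex ht σ).const_mul k)).congr_deriv ?_
      rw [h]; ring
    · simpa using hlim.sub (hlim'.const_mul k)
  rw [← h1]; ring

lemma HasExpansion.tendsto_zero {W : ℕ} (hW : 0 < W) {A : ℂ → ℂ} {G : ℍ → ℂ}
    (h : HasExpansion W 1 A G) : Tendsto G atImInfty (𝓝 0) := by
  simpa using (h.mono zero_le_one).tendsto hW

/-- A function that is constant has the value of its expansion at infinity. -/
lemma HasExpansion.const_eq {A : ℂ → ℂ} {G : ℍ → ℂ} (h : HasExpansion 1 0 A G) {c : ℂ}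
    (hc : ∀ τ, G τ = c) : c = A 0 := by
  have h1 := h.tendsto one_pos
  rw [funext hc] at h1
  exact tendsto_nhds_unique tendsto_const_nhds h1

section System

variable {Γ : Subgroup SL(2, ℤ)} [Γ.FiniteIndex] {W : SL(2, ℤ) → ℕ} {t E f : ℍ → ℂ}
  {ot oE oF : SL(2, ℤ) → ℤ}

/-- The three kinds of cusps: those where `t` vanishes, those where `E` vanishes and `t` has a
finite nonzero value, and those where `t` has a pole and `f` vanishes. -/
def CuspCondition (ot oE oF : SL(2, ℤ) → ℤ) : Prop :=
  ∀ γ, (ot γ = 1 ∧ oE γ = 0 ∧ oF γ = 0) ∨ (ot γ = 0 ∧ oE γ = 1 ∧ oF γ = 0) ∨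
    (ot γ = -1 ∧ oE γ = 0 ∧ oF γ = 1)

/-- The quotient `D t / (t E)` has weight zero and nonnegative order at all cusps, so it is
constant; its value at infinity is `1`. -/
lemma deriv_eq_mul (hW : ∀ γ, 0 < W γ) (ht : IsModularUnit Γ W 0 ot t)
    (hE : IsModularUnit Γ W 2 oE E) (hc : CuspCondition ot oE oF)
    {At AE : ℂ → ℂ} {t₁ t₂ e₁ e₂ : ℂ} (hAt : HasExpansion 1 1 At t) (jt : IsJet At t₁ t₂)
    (hAE : HasExpansion 1 0 AE E) (jE : IsJet AE e₁ e₂) (τ : ℍ) : D t τ = t τ * E τ := by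
  have h1 : IsWeakForm Γ W 2 (fun γ ↦ ot γ + oE γ) (D t) := by
    refine ht.isWeakForm.deriv hW fun γ ↦ ?_
    rcases hc γ with h | h | h <;> simp [h]
  obtain ⟨κ, hκ⟩ := ((h1.div (ht.mul hE)).weight_eq (by norm_num)).exists_const hW
    (fun γ ↦ by simp)
  have h2 := (hAt.deriv one_pos).div (hAt.mul hAE)
    (by simp [jt.apply_zero, jE.apply_zero])
  have h3 : κ = 1 := by
    rw [HasExpansion.const_eq (by simpa using h2) hκ]
    simp [jt.apply_zero, jE.apply_zero]
  have h4 := hκ τ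
  rw [h3, div_eq_one_iff_eq (mul_ne_zero (ht.ne_zero τ) (hE.ne_zero τ))] at h4
  exact h4

/-- `E / f²` is a quadratic polynomial in `t`: its second derivative with respect to `t` has
nonnegative order at all cusps and is thus a constant. The hypotheses on the jets determine the
coefficients. -/
lemma eq_sq_mul_quadratic (hW : ∀ γ, 0 < W γ) (ht : IsModularUnit Γ W 0 ot t)
    (hE : IsModularUnit Γ W 2 oE E) (hf : IsModularUnit Γ W 1 oF f)
    (hc : CuspCondition ot oE oF)
    {At AE Af : ℂ → ℂ} {t₁ t₂ e₁ e₂ f₁ f₂ : ℂ} (hAt : HasExpansion 1 1 At t) (jt : IsJet At t₁ t₂)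
    (hAE : HasExpansion 1 0 AE E) (jE : IsJet AE e₁ e₂)
    (hAf : HasExpansion 1 0 Af f) (jf : IsJet Af f₁ f₂) {a c : ℂ} (h1 : e₁ - 2 * f₁ = -a)
    (h2 : e₂ - 2 * f₂ + a * (t₁ + 2 * f₁) = 2 * c) (τ : ℍ) :
    E τ = f τ ^ 2 * (1 - a * t τ + c * t τ ^ 2) := by
  have hDt := deriv_eq_mul hW ht hE hc hAt jt hAE jE
  have htE := ht.mul hE
  -- `p = E / f²` and `r = dp/dt`
  set p : ℍ → ℂ := fun τ ↦ E τ / (f τ * f τ) with hp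
  set r : ℍ → ℂ := fun τ ↦ D p τ / (t τ * E τ) with hr
  have up := hE.div (hf.mul hf)
  have ur : IsWeakForm Γ W 0 (fun γ ↦ min 0 (ot γ)) r := by
    have := (up.isWeakForm.weight_eq (l := 0) (by norm_num)).deriv (o' := fun γ ↦
      min 0 (ot γ) + (ot γ + oE γ)) hW fun γ ↦ by rcases hc γ with h | h | h <;> simp [h]
    simpa using this.div htE
  have uk := (ur.deriv (o' := fun γ ↦ ot γ + oE γ) hW fun γ ↦ by
    rcases hc γ with h | h | h <;> simp [h]).div htE
  obtain ⟨κ, hκ⟩ := (uk.weight_eq (by norm_num)).exists_const hW (fun γ ↦ by simp)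
  -- expansions at infinity
  have jp := jE.div (jf.mul jf)
  have hAp : HasExpansion 1 0 (fun q ↦ AE q / (Af q * Af q)) p := by
    simpa using hAE.div (hAf.mul hAf) (by simp [jf.apply_zero])
  have hAtE : HasExpansion 1 1 (fun q ↦ At q * AE q) (fun τ ↦ t τ * E τ) := by
    simpa using hAt.mul hAE
  have jtE := jt.mul jE
  have hAr : HasExpansion 1 0 (fun q ↦ logDeriv (fun q ↦ AE q / (Af q * Af q)) q *
      ((AE q / (Af q * Af q)) / (At q * AE q))) r := by
    have h3 := (hAp.deriv_zero one_pos).div hAtE jtE.ne_zero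
    rw [sub_self] at h3
    refine h3.congr_coeff one_pos ?_
    filter_upwards [jp.deriv_eventuallyEq] with q hq
    rw [hq]; simp [mul_div_assoc]
  have dr : HasDerivAt (fun q ↦ logDeriv (fun q ↦ AE q / (Af q * Af q)) q *
      ((AE q / (Af q * Af q)) / (At q * AE q))) _ 0 :=
    jp.hasDerivAt_logDeriv.mul (jp.div jtE).hasDerivAt
  have hκ' : κ = 2 * c := by
    have h3 := (hAr.deriv_zero one_pos).div hAtE jtE.ne_zero
    rw [sub_self] at h3
    rw [h3.const_eq hκ, dr.deriv, (jp.div jtE).apply_zero, jtE.apply_zero, jp.logDeriv_zero, ← h2]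
    simp only [Nat.cast_one, div_one, mul_one]
    linear_combination (2 * f₁ + t₁) * (-h1)
  have hr0 := hAr.tendsto one_pos
  rw [(jp.div jtE).apply_zero, jp.logDeriv_zero, mul_one, show e₁ - (f₁ + f₁) = -a by
    rw [← h1]; ring] at hr0
  have ht0 := hAt.tendsto_zero one_pos
  have hrt (σ : ℍ) : r σ = -a + 2 * c * t σ := by
    refine eq_add_of_deriv_eq ur.mdiff ht.mdiff (fun σ ↦ ?_) hr0 ht0 σ
    have h3 := hκ σ
    rw [div_eq_iff (htE.ne_zero σ), hκ'] at h3
    rw [h3, hDt]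
  have hpt : p τ - (-a * t τ + c * t τ ^ 2) = 1 := by
    refine eq_const_of_hasDerivAt_zero (G := fun τ ↦ p τ - (-a * t τ + c * t τ ^ 2))
      (fun σ ↦ ?_) ?_ τ
    · have ht' := hasDerivAt_comp_ofComplex ht.mdiff σ
      have h4 : D p σ = t σ * E σ * (-a + 2 * c * t σ) := by
        rw [← hrt, hr, mul_div_cancel₀ _ (htE.ne_zero σ)]
      refine ((hasDerivAt_comp_ofComplex (G := p) up.mdiff σ).sub ((ht'.const_mul (-a)).add
        ((ht'.pow 2).const_mul c))).congr_deriv ?_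
      rw [h4, hDt]
      simp [ofComplex_apply]
      ring
    · have h3 := hAp.tendsto one_pos
      rw [jp.apply_zero] at h3
      simpa using h3.sub ((ht0.const_mul (-a)).add ((ht0.pow 2).const_mul c))
  have hpe : E τ = f τ ^ 2 * p τ := by
    rw [hp]; have := hf.ne_zero τ; field_simp
  rw [hpe]
  linear_combination f τ ^ 2 * hpt

/-- `-D² (1 / f) / (E f t)` has weight zero by Bol's identity, and it is a linear polynomial in `t`:
its derivative with respect to `t` has nonnegative order at all cusps and is thus a constant. -/
lemma deriv_deriv_inv_eq (hW : ∀ γ, 0 < W γ) (ht : IsModularUnit Γ W 0 ot t)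
    (hE : IsModularUnit Γ W 2 oE E) (hf : IsModularUnit Γ W 1 oF f)
    (hc : CuspCondition ot oE oF)
    {At AE Af : ℂ → ℂ} {t₁ t₂ e₁ e₂ f₁ f₂ : ℂ} (hAt : HasExpansion 1 1 At t) (jt : IsJet At t₁ t₂)
    (hAE : HasExpansion 1 0 AE E) (jE : IsJet AE e₁ e₂)
    (hAf : HasExpansion 1 0 Af f) (jf : IsJet Af f₁ f₂) {b c : ℂ} (h1 : f₁ = b)
    (h2 : 2 * f₂ - f₁ ^ 2 - f₁ * (e₁ + 2 * f₁ + t₁) = -c) (τ : ℍ) :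
    D (D fun τ ↦ (f τ)⁻¹) τ = -(E τ * f τ * t τ * (b - c * t τ)) := by
  have hDt := deriv_eq_mul hW ht hE hc hAt jt hAE jE
  have htE := ht.mul hE
  have hEft := (hE.mul hf).mul ht
  set u : ℍ → ℂ := fun τ ↦ D (D fun τ ↦ (f τ)⁻¹) τ / (E τ * f τ * t τ) with hu
  have uu : IsWeakForm Γ W 0 (fun γ ↦ min 0 (ot γ)) u := by
    have := (hf.inv.isWeakForm).deriv_deriv (o' := fun γ ↦ min 0 (ot γ) +
      (oE γ + oF γ + ot γ)) hW fun γ ↦ by rcases hc γ with h | h | h <;> simp [h]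
    simpa using this.div hEft
  have uk := (uu.deriv (o' := fun γ ↦ ot γ + oE γ) hW fun γ ↦ by
    rcases hc γ with h | h | h <;> simp [h]).div htE
  obtain ⟨κ, hκ⟩ := (uk.weight_eq (by norm_num)).exists_const hW (fun γ ↦ by simp)
  -- expansions at infinity
  have hAtE : HasExpansion 1 1 (fun q ↦ At q * AE q) (fun τ ↦ t τ * E τ) := by
    simpa using hAt.mul hAE
  have jtE := jt.mul jE
  have hAEft : HasExpansion 1 1 (fun q ↦ AE q * Af q * At q) (fun τ ↦ E τ * f τ * t τ) := by
    simpa using (hAE.mul hAf).mul hAt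
  have jEft := (jE.mul jf).mul jt
  have hAF : HasExpansion 1 0 (fun q ↦ (Af q)⁻¹) (fun τ ↦ (f τ)⁻¹) := by
    simpa using hAf.inv jf.ne_zero
  have jF := jf.inv
  have jC := jF.div jEft
  have hAu : HasExpansion 1 0 (fun q ↦ -(logDeriv Af q +
      q * (deriv (logDeriv Af) q - logDeriv Af q ^ 2)) *
      ((Af q)⁻¹ / (AE q * Af q * At q))) u := by
    have h3 := ((hAF.deriv_zero one_pos).deriv one_pos).div hAEft jEft.ne_zero
    rw [sub_self] at h3
    refine h3.congr_coeff one_pos ?_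
    have h4 : deriv (fun q ↦ (Af q)⁻¹) =ᶠ[𝓝 0] fun q ↦ -logDeriv Af q * (Af q)⁻¹ := by
      filter_upwards [jf.analyticAt.eventually_analyticAt,
        jf.analyticAt.continuousAt.eventually_ne jf.ne_zero] with q h4 h5
      rw [deriv_fun_inv'' h4.differentiableAt h5, logDeriv_apply]
      field_simp
    have h5 : deriv (deriv fun q ↦ (Af q)⁻¹) =ᶠ[𝓝 0] fun q ↦
        (-deriv (logDeriv Af) q + logDeriv Af q ^ 2) * (Af q)⁻¹ := by
      filter_upwards [h4.deriv, jf.analyticAt_logDeriv.eventually_analyticAt, h4,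
        jF.analyticAt.eventually_analyticAt] with q h6 h7 h8 h9
      have h10 : HasDerivAt (fun q ↦ -logDeriv Af q * (Af q)⁻¹)
          (-deriv (logDeriv Af) q * (Af q)⁻¹ + -logDeriv Af q * deriv (fun q ↦ (Af q)⁻¹) q) q :=
        h7.differentiableAt.hasDerivAt.neg.mul h9.differentiableAt.hasDerivAt
      rw [h6, h10.deriv, h8]; ring
    filter_upwards [h4, h5] with q h6 h7
    simp only [Nat.cast_one, div_one, Int.cast_one]
    rw [h6, h7]; ring
  have dA : HasDerivAt (fun q ↦ logDeriv Af q +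
      q * (deriv (logDeriv Af) q - logDeriv Af q ^ 2)) (f₂ + (f₂ - f₁ ^ 2)) 0 := by
    have h3 : HasDerivAt (fun q : ℂ ↦ q * (deriv (logDeriv Af) q - logDeriv Af q ^ 2))
        (1 * (deriv (logDeriv Af) 0 - logDeriv Af 0 ^ 2) + 0 * _) 0 :=
      (hasDerivAt_id (0 : ℂ)).mul ((jf.analyticAt_logDeriv.deriv.sub
        (jf.analyticAt_logDeriv.pow 2)).differentiableAt.hasDerivAt)
    refine (jf.hasDerivAt_logDeriv.add h3).congr_deriv ?_
    rw [jf.deriv_logDeriv_zero, jf.logDeriv_zero]; ring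
  have hκ' : κ = c := by
    have h3 := (hAu.deriv_zero one_pos).div hAtE jtE.ne_zero
    rw [sub_self] at h3
    have h4 : HasDerivAt (fun q ↦ -(logDeriv Af q +
      q * (deriv (logDeriv Af) q - logDeriv Af q ^ 2)) *
      ((Af q)⁻¹ / (AE q * Af q * At q))) _ 0 := dA.neg.mul jC.hasDerivAt
    rw [h3.const_eq hκ, h4.deriv, jC.apply_zero, jtE.apply_zero]
    simp only [Nat.cast_one, div_one, mul_one, Pi.neg_apply, jf.logDeriv_zero, zero_mul, add_zero]
    linear_combination -h2
  have hu0 := hAu.tendsto one_pos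
  rw [jC.apply_zero, jf.logDeriv_zero, mul_one, zero_mul, add_zero, h1] at hu0
  have h3 := eq_add_of_deriv_eq uu.mdiff ht.mdiff (k := c) (fun σ ↦ by
    have h3 := hκ σ
    rw [div_eq_iff (htE.ne_zero σ), hκ'] at h3
    rw [h3, hDt]) hu0 (hAt.tendsto_zero one_pos) τ
  rw [hu, div_eq_iff (hEft.ne_zero τ)] at h3
  rw [h3]; ring

end System

/-! ### Infinite products -/

/-- The infinite `q`-Pochhammer symbol `∏ (1 - x Q ^ n)`, the product being over `n ≥ 0`. -/
noncomputable def poch (x Q : ℂ) : ℂ := ∏' n : ℕ, (1 - x * Q ^ n)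

lemma summable_norm_mul_pow (x : ℂ) {Q : ℂ} (hQ : ‖Q‖ < 1) :
    Summable fun n : ℕ ↦ ‖-(x * Q ^ n)‖ := by
  simpa using (summable_geometric_of_lt_one (norm_nonneg _) hQ).mul_left ‖x‖

lemma multipliable_poch (x : ℂ) {Q : ℂ} (hQ : ‖Q‖ < 1) :
    Multipliable fun n : ℕ ↦ 1 - x * Q ^ n := by
  simpa [sub_eq_add_neg] using multipliable_one_add_of_summable (summable_norm_mul_pow x hQ)

lemma poch_eq_mul (x : ℂ) {Q : ℂ} (hQ : ‖Q‖ < 1) : poch x Q = (1 - x) * poch (x * Q) Q := by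
  have h (n : ℕ) : 1 - x * Q ^ (n + 1) = 1 - x * Q * Q ^ n := by ring
  have h1 : Multipliable fun n : ℕ ↦ 1 - x * Q ^ (n + 1) :=
    (multipliable_poch (x * Q) hQ).congr fun n ↦ (h n).symm
  have h2 := tprod_eq_zero_mul' (f := fun n : ℕ ↦ 1 - x * Q ^ n) h1
  simp only [pow_zero, mul_one] at h2
  rw [poch, h2, tprod_congr h, poch]

lemma poch_ne_zero {x Q : ℂ} (hQ : ‖Q‖ < 1) (h : ∀ n : ℕ, x * Q ^ n ≠ 1) : poch x Q ≠ 0 := by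
  have := tprod_one_add_ne_zero_of_summable (f := fun n : ℕ ↦ -(x * Q ^ n))
    (fun n h0 ↦ h n (by linear_combination -h0)) (summable_norm_mul_pow x hQ)
  simpa [poch, sub_eq_add_neg] using this

lemma poch_ne_zero_of_norm_lt {x Q : ℂ} (hQ : ‖Q‖ < 1) (hx : ‖x‖ < 1) : poch x Q ≠ 0 := by
  refine poch_ne_zero hQ fun n h ↦ ?_
  have h1 : ‖x * Q ^ n‖ < 1 := by
    rw [norm_mul, norm_pow]
    exact (mul_le_of_le_one_right (norm_nonneg _) (pow_le_one₀ (norm_nonneg _) hQ.le)).trans_lt hx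
  rw [h, norm_one] at h1
  exact lt_irrefl _ h1

lemma norm_poch_sub_one_le {x Q : ℂ} (hQ : ‖Q‖ ≤ 1 / 2) :
    ‖poch x Q - 1‖ ≤ Real.exp (2 * ‖x‖) - 1 := by
  have hQ1 : ‖Q‖ < 1 := hQ.trans_lt (by norm_num)
  have h := (multipliable_poch x hQ1).hasProd
  refine le_of_tendsto ((h.sub_const 1).norm) (Eventually.of_forall fun s ↦ ?_)
  have h1 := s.norm_prod_one_add_sub_one_le (fun n ↦ -(x * Q ^ n))
  simp only [← sub_eq_add_neg] at h1
  refine h1.trans (sub_le_sub_right (Real.exp_le_exp.2 ?_) _)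
  refine ((summable_norm_mul_pow x hQ1).sum_le_tsum s fun _ _ ↦ norm_nonneg _).trans ?_
  simp only [norm_neg, norm_mul, norm_pow]
  rw [tsum_mul_left, tsum_geometric_of_lt_one (norm_nonneg _) hQ1, mul_comm]
  refine mul_le_mul_of_nonneg_right ?_ (norm_nonneg _)
  rw [inv_le_comm₀ (by linarith) (by norm_num)]
  linarith

lemma differentiableOn_poch {U : Set ℂ} (hU : IsOpen U) {x Q : ℂ → ℂ}
    (hx : DifferentiableOn ℂ x U) (hQ : DifferentiableOn ℂ Q U) (hQ1 : ∀ z ∈ U, ‖Q z‖ < 1) :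
    DifferentiableOn ℂ (fun z ↦ poch (x z) (Q z)) U := by
  have h : HasProdLocallyUniformlyOn (fun (n : ℕ) z ↦ 1 + -(x z * Q z ^ n))
      (fun z ↦ ∏' n : ℕ, (1 + -(x z * Q z ^ n))) U := by
    refine hasProdLocallyUniformlyOn_of_forall_compact hU fun K hK hcK ↦ ?_
    rcases K.eq_empty_or_nonempty with rfl | hN
    · simpa [hasProdUniformlyOn_iff_tendstoUniformlyOn] using tendstoUniformlyOn_empty
    obtain ⟨z₀, hz₀, h0⟩ := hcK.exists_isMaxOn hN (hQ.continuousOn.mono hK).norm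
    obtain ⟨z₁, hz₁, h1⟩ := hcK.exists_isMaxOn hN (hx.continuousOn.mono hK).norm
    refine ((summable_geometric_of_lt_one (norm_nonneg _) (hQ1 z₀ (hK hz₀))).mul_left
      ‖x z₁‖).hasProdUniformlyOn_nat_one_add hcK (.of_forall fun n z hz ↦ ?_) fun n ↦
        ((hx.continuousOn.mono hK).mul ((hQ.continuousOn.mono hK).pow n)).neg
    rw [norm_neg, norm_mul, norm_pow]
    exact mul_le_mul (h1 hz) (pow_le_pow_left₀ (norm_nonneg _) (h0 hz) n) (by positivity)
      (norm_nonneg _)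
  have h2 := h.differentiableOn (.of_forall fun s ↦ by
    simpa [Finset.prod_fn] using DifferentiableOn.finsetProd fun n _ ↦
      (hx.mul (hQ.pow n)).neg.const_add 1) hU
  simpa [poch, sub_eq_add_neg] using h2

lemma differentiableOn_poch_pow (a b : ℕ) (hb : b ≠ 0) :
    DifferentiableOn ℂ (fun q : ℂ ↦ poch (q ^ a) (q ^ b)) (Metric.ball 0 1) :=
  differentiableOn_poch Metric.isOpen_ball (by fun_prop) (by fun_prop) fun z hz ↦ by
    rw [norm_pow]
    exact pow_lt_one₀ (norm_nonneg _) (by simpa using hz) hb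

lemma analyticAt_poch_pow (a b : ℕ) (hb : b ≠ 0) :
    AnalyticAt ℂ (fun q : ℂ ↦ poch (q ^ a) (q ^ b)) 0 :=
  (differentiableOn_poch_pow a b hb).analyticAt (Metric.ball_mem_nhds _ one_pos)

lemma IsJet.of_eq {B : ℂ → ℂ} (hB : AnalyticAt ℂ B 0) {d₁ d₂ : ℂ} :
    IsJet (fun q ↦ 1 + d₁ * q + d₂ * q ^ 2 + q ^ 3 * B q) d₁ (2 * d₂ - d₁ ^ 2) := by
  have hA : AnalyticAt ℂ (fun q ↦ 1 + d₁ * q + d₂ * q ^ 2 + q ^ 3 * B q) 0 := by fun_prop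
  have h1 : deriv (fun q ↦ 1 + d₁ * q + d₂ * q ^ 2 + q ^ 3 * B q) =ᶠ[𝓝 0]
      fun q ↦ d₁ + 2 * d₂ * q + 3 * q ^ 2 * B q + q ^ 3 * deriv B q := by
    filter_upwards [hB.eventually_analyticAt] with q hq
    have h2 : HasDerivAt (fun q ↦ 1 + d₁ * q + d₂ * q ^ 2 + q ^ 3 * B q)
        (0 + d₁ * 1 + d₂ * ((2 : ℕ) * q ^ 1) + (((3 : ℕ) * q ^ 2) * B q + q ^ 3 * deriv B q)) q :=
      (((hasDerivAt_const q (1 : ℂ)).add ((hasDerivAt_id q).const_mul d₁)).add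
        ((hasDerivAt_pow 2 q).const_mul d₂)).add
        ((hasDerivAt_pow 3 q).mul hq.differentiableAt.hasDerivAt)
    rw [h2.deriv]; push_cast; ring
  have h3 : HasDerivAt (fun q ↦ d₁ + 2 * d₂ * q + 3 * q ^ 2 * B q + q ^ 3 * deriv B q)
      (2 * d₂) 0 := by
    have e1 : HasDerivAt (fun q ↦ d₁ + 2 * d₂ * q) (0 + 2 * d₂ * 1) (0 : ℂ) :=
      (hasDerivAt_const _ d₁).add ((hasDerivAt_id (0 : ℂ)).const_mul (2 * d₂))
    have e2 : HasDerivAt (fun q ↦ q ^ 2 * (3 * B q + q * deriv B q))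
        ((2 : ℕ) * 0 ^ 1 * (3 * B 0 + 0 * deriv B 0) + 0 ^ 2 * _) (0 : ℂ) :=
      (hasDerivAt_pow 2 (0 : ℂ)).mul
        (show AnalyticAt ℂ (fun q ↦ 3 * B q + q * deriv B q) 0 from
          (analyticAt_const.mul hB).add (analyticAt_id.mul hB.deriv)).differentiableAt.hasDerivAt
    refine ((e1.add e2).congr_deriv (by simp)).congr_of_eventuallyEq
      (Eventually.of_forall fun q ↦ ?_)
    simp only [Pi.add_apply]; ring
  refine ⟨hA, by simp, by rw [logDeriv_apply, h1.self_of_nhds]; simp, ?_⟩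
  have h4 : logDeriv (fun q ↦ 1 + d₁ * q + d₂ * q ^ 2 + q ^ 3 * B q) =ᶠ[𝓝 0]
      fun q ↦ (d₁ + 2 * d₂ * q + 3 * q ^ 2 * B q + q ^ 3 * deriv B q) /
        (1 + d₁ * q + d₂ * q ^ 2 + q ^ 3 * B q) := by
    filter_upwards [h1] with q hq
    rw [logDeriv_apply, hq]
  rw [h4.deriv_eq, (h3.fun_div hA.differentiableAt.hasDerivAt (by simp)).deriv, h1.self_of_nhds]
  simp; ring

lemma isJet_poch_pow_of_three_le {a : ℕ} (ha : 3 ≤ a) {b : ℕ} (hb : b ≠ 0) :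
    IsJet (fun q ↦ poch (q ^ a) (q ^ b)) 0 0 := by
  have hA := analyticAt_poch_pow a b hb
  have hbound : ∀ᶠ q in 𝓝 (0 : ℂ), ‖poch (q ^ a) (q ^ b) - 1‖ ≤ 4 * ‖q‖ ^ 3 := by
    filter_upwards [Metric.ball_mem_nhds (0 : ℂ) (by norm_num : (0 : ℝ) < 1 / 2)] with q hq
    have hq' : ‖q‖ < 1 / 2 := by simpa using hq
    have h1 : ‖q ^ b‖ ≤ 1 / 2 := by
      rw [norm_pow]
      exact (pow_le_of_le_one (norm_nonneg _) (by linarith) hb).trans hq'.le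
    have h2 : ‖q ^ a‖ ≤ ‖q‖ ^ 3 := by
      rw [norm_pow]; exact pow_le_pow_of_le_one (norm_nonneg _) (by linarith) ha
    have h3 : ‖q‖ ^ 3 ≤ 1 / 2 ^ 3 := by
      rw [← one_div_pow]; exact pow_le_pow_left₀ (norm_nonneg _) hq'.le 3
    have h4 := norm_poch_sub_one_le (x := q ^ a) h1
    have h5 : |2 * ‖q ^ a‖| ≤ 1 := by rw [abs_of_nonneg (by positivity)]; linarith
    have h6 := Real.abs_exp_sub_one_le h5
    rw [abs_of_nonneg (a := 2 * ‖q ^ a‖) (by positivity)] at h6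
    linarith [le_abs_self (Real.exp (2 * ‖q ^ a‖) - 1)]
  -- the order of vanishing of `poch - 1` is at least `3`
  obtain ⟨B, hB, hB'⟩ : ∃ B, AnalyticAt ℂ B 0 ∧
      ∀ᶠ q in 𝓝 (0 : ℂ), poch (q ^ a) (q ^ b) - 1 = (q - 0) ^ 3 • B q := by
    refine (natCast_le_analyticOrderAt (f := fun q ↦ poch (q ^ a) (q ^ b) - 1) (n := 3)
      (hA.sub analyticAt_const)).1 ?_
    by_contra! hlt
    obtain ⟨n, hn⟩ := ENat.ne_top_iff_exists.1 (ne_top_of_lt hlt)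
    have hn3 : n < 3 := by rw [← hn] at hlt; exact_mod_cast hlt
    obtain ⟨g, hg, hg0, hg'⟩ := ((hA.sub analyticAt_const).analyticOrderAt_eq_natCast).1 hn.symm
    have h1 : ∀ᶠ q in 𝓝[≠] (0 : ℂ), ‖g q‖ ≤ 4 * ‖q‖ := by
      have h2 := (hbound.and hg').filter_mono (nhdsWithin_le_nhds (s := {0}ᶜ))
      filter_upwards [h2, self_mem_nhdsWithin, nhdsWithin_le_nhds
        (Metric.ball_mem_nhds (0 : ℂ) one_pos)] with q h3 hq hq1
      have hq0 : 0 < ‖q‖ := norm_pos_iff.2 hq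
      have hq1 : ‖q‖ < 1 := by simpa using hq1
      have h4 := h3.1
      have h5 : poch (q ^ a) (q ^ b) - 1 = (q - 0) ^ n • g q := h3.2
      rw [h5, sub_zero, norm_smul, norm_pow] at h4
      have h6 : ‖q‖ ^ 3 ≤ ‖q‖ ^ n * ‖q‖ := by
        rw [← pow_succ]; exact pow_le_pow_of_le_one hq0.le hq1.le (by lia)
      have h7 : ‖q‖ ^ n * ‖g q‖ ≤ ‖q‖ ^ n * (4 * ‖q‖) := by linarith
      exact le_of_mul_le_mul_left h7 (by positivity)
    have h2 : Tendsto (fun q ↦ ‖g q‖) (𝓝[≠] 0) (𝓝 ‖g 0‖) :=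
      hg.continuousAt.norm.tendsto.mono_left nhdsWithin_le_nhds
    have h3 : Tendsto (fun q : ℂ ↦ 4 * ‖q‖) (𝓝[≠] 0) (𝓝 (4 * ‖(0 : ℂ)‖)) :=
      (Continuous.tendsto (by fun_prop) _).mono_left nhdsWithin_le_nhds
    have h4 := le_of_tendsto_of_tendsto h2 h3 h1
    simp at h4
    exact hg0 h4
  refine ((IsJet.of_eq hB (d₁ := 0) (d₂ := 0)).coeff_congr rfl (by simp)).congr ?_
  filter_upwards [hB'] with q hq
  linear_combination (exp := 1) hq + (by simp : (q - 0) ^ 3 • B q = q ^ 3 * B q)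

/-- The jet of the first factor of `poch`. -/
lemma IsJet.poch_of_succ {a b : ℕ} (hb : b ≠ 0) {d₁ d₂ l₁ l₂ : ℂ}
    (h : IsJet (fun q ↦ poch (q ^ (a + b)) (q ^ b)) l₁ l₂)
    (h' : IsJet (fun q : ℂ ↦ 1 - q ^ a) d₁ d₂) :
    IsJet (fun q ↦ poch (q ^ a) (q ^ b)) (d₁ + l₁) (d₂ + l₂) := by
  refine (h'.mul h).congr ?_
  filter_upwards [Metric.ball_mem_nhds (0 : ℂ) one_pos] with q hq
  have hq' : ‖q ^ b‖ < 1 := by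
    rw [norm_pow]; exact pow_lt_one₀ (norm_nonneg _) (by simpa using hq) hb
  rw [poch_eq_mul _ hq', pow_add]

lemma isJet_one_sub_pow_one : IsJet (fun q : ℂ ↦ 1 - q ^ 1) (-1) (-1) :=
  ((IsJet.of_eq (B := 0) analyticAt_const (d₁ := -1) (d₂ := 0)).coeff_congr rfl (by simp)).congr
    (Eventually.of_forall fun q ↦ by simp; ring)

lemma isJet_one_sub_pow_two : IsJet (fun q : ℂ ↦ 1 - q ^ 2) 0 (-2) :=
  ((IsJet.of_eq (B := 0) analyticAt_const (d₁ := 0) (d₂ := -1)).coeff_congr rfl (by simp)).congr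
    (Eventually.of_forall fun q ↦ by simp; ring)

lemma isJet_poch_two {b : ℕ} (hb : b ≠ 0) : IsJet (fun q ↦ poch (q ^ 2) (q ^ b)) 0 (-2) :=
  ((isJet_poch_pow_of_three_le (by lia) hb).poch_of_succ hb isJet_one_sub_pow_two).coeff_congr
    (by simp) (by simp)

lemma isJet_poch_one_one : IsJet (fun q ↦ poch (q ^ 1) (q ^ 1)) (-1) (-3) :=
  ((isJet_poch_two one_ne_zero).poch_of_succ one_ne_zero isJet_one_sub_pow_one).coeff_congr
    (by norm_num) (by norm_num)

lemma isJet_poch_one_of_two_le {b : ℕ} (hb : 2 ≤ b) :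
    IsJet (fun q ↦ poch (q ^ 1) (q ^ b)) (-1) (-1) :=
  ((isJet_poch_pow_of_three_le (by lia) (by lia)).poch_of_succ (by lia)
    isJet_one_sub_pow_one).coeff_congr (by norm_num) (by norm_num)

/-- The jet of `∏ (1 - q ^ (m n))`, the product being over `n ≥ 1`. -/
lemma isJet_poch_self {m : ℕ} (hm : m ≠ 0) :
    IsJet (fun q ↦ poch (q ^ m) (q ^ m)) (if m = 1 then -1 else 0)
      (if m = 1 then -3 else if m = 2 then -2 else 0) := by
  obtain rfl | rfl | h : m = 1 ∨ m = 2 ∨ 3 ≤ m := by lia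
  · simpa using isJet_poch_one_one
  · simpa using isJet_poch_two two_ne_zero
  · simpa [show m ≠ 1 by lia, show m ≠ 2 by lia] using isJet_poch_pow_of_three_le h hm

/-! ### Scaling the argument of a modular form -/

/-- The point `(g τ + b) / d` of the upper half-plane. -/
noncomputable def affineMap {g d : ℕ} (hg : 0 < g) (hd : 0 < d) (b : ℤ) (τ : ℍ) : ℍ :=
  ⟨(g * τ + b) / d, by
    have h : ((g * τ + b) / d : ℂ).im = g * τ.im / d := by simp
    rw [h]
    have := τ.im_pos
    positivity⟩

@[simp]
lemma coe_affineMap {g d : ℕ} (hg : 0 < g) (hd : 0 < d) (b : ℤ) (τ : ℍ) :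
    (affineMap hg hd b τ : ℂ) = (g * τ + b) / d := rfl

/-- The matrix identity `diag(m, 1) γ = γ' (g, b; 0, d)`, entry by entry. -/
structure IsFactorization (m : ℕ) (γ γ' : SL(2, ℤ)) (g d : ℕ) (b : ℤ) : Prop where
  apply_zero_zero : m * γ 0 0 = γ' 0 0 * g
  apply_one_zero : γ 1 0 = γ' 1 0 * g
  apply_zero_one : m * γ 0 1 = γ' 0 0 * b + γ' 0 1 * d
  apply_one_one : γ 1 1 = γ' 1 0 * b + γ' 1 1 * d

/-- Every matrix `diag(m, 1) γ` is the product of an element of `SL(2, ℤ)` and an upper triangular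
matrix with first entry `gcd(C, m)`, where `C` is the lower left entry of `γ`. -/
lemma exists_isFactorization (γ : SL(2, ℤ)) {m g d : ℕ} (hm : 0 < m)
    (hg : g = Int.gcd (γ 1 0) m) (hgd : g * d = m) :
    ∃ γ' b, IsFactorization m γ γ' g d b := by
  have hg0 : 0 < g := hg ▸ Int.gcd_pos_of_ne_zero_right _ (by exact_mod_cast hm.ne')
  obtain ⟨z, hz⟩ : (g : ℤ) ∣ γ 1 0 := hg ▸ Int.gcd_dvd_left _ _
  have hdet := γ.det_coe
  rw [Matrix.det_fin_two] at hdet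
  have hgd' : (g : ℤ) * d = m := by exact_mod_cast hgd
  have h1 : IsCoprime (γ 0 0) z := ⟨γ 1 1, -γ 0 1 * g, by linear_combination hdet + γ 0 1 * hz⟩
  have h2 : IsCoprime (d : ℤ) z := by
    rw [Int.isCoprime_iff_gcd_eq_one]
    have h3 : Int.gcd (g * z) (g * d) = g * Int.gcd z d := by
      rw [Int.gcd_mul_left]; simp
    rw [← hz, hgd', ← hg] at h3
    rw [Int.gcd_comm]
    exact Nat.eq_of_mul_eq_mul_left hg0 (by rw [← h3, mul_one])
  obtain ⟨u, v, huv⟩ := h1.mul_left h2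
  refine ⟨⟨!![γ 0 0 * d, -v; z, u], ?_⟩, u * (m * γ 0 1) + v * γ 1 1, ?_, ?_, ?_, ?_⟩
  · rw [Matrix.det_fin_two_of]; linear_combination huv
  · simp only [Matrix.of_apply, Matrix.cons_val',
      Matrix.cons_val_zero, Matrix.cons_val_fin_one]
    rw [← hgd']; ring
  · simp only [Matrix.of_apply, Matrix.cons_val',
      Matrix.cons_val_zero, Matrix.cons_val_fin_one, Matrix.cons_val_one]
    rw [hz]; ring
  · simp only [Matrix.of_apply, Matrix.cons_val',
      Matrix.cons_val_zero, Matrix.cons_val_fin_one, Matrix.cons_val_one]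
    linear_combination (-m * γ 0 1) * huv - v * d * hdet - v * γ 0 1 * d * hz -
      v * γ 0 1 * z * hgd'
  · simp only [Matrix.of_apply, Matrix.cons_val',
      Matrix.cons_val_zero, Matrix.cons_val_fin_one, Matrix.cons_val_one]
    linear_combination (-γ 1 1) * huv + u * d * (hdet + γ 0 1 * hz) + u * z * γ 0 1 * hgd'

namespace IsFactorization

variable {m : ℕ} {γ γ' : SL(2, ℤ)} {g d : ℕ} {b : ℤ} (h : IsFactorization m γ γ' g d b)
  (hg : 0 < g) (hd : 0 < d)
include h

lemma denom_eq (τ : ℍ) : denom γ τ = d * denom γ' (affineMap hg hd b τ) := by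
  have hd' : (d : ℂ) ≠ 0 := by exact_mod_cast hd.ne'
  rw [ModularGroup.denom_apply, ModularGroup.denom_apply, h.apply_one_zero, h.apply_one_one]
  simp
  field_simp
  ring

lemma smul_eq (τ : ℍ) : (m : ℂ) * (γ • τ : ℍ) = (γ' • affineMap hg hd b τ : ℍ) := by
  have hd' : (d : ℂ) ≠ 0 := by exact_mod_cast hd.ne'
  have h1 : denom γ τ ≠ 0 := UpperHalfPlane.denom_ne_zero _ _
  have h2 : denom γ' (affineMap hg hd b τ) ≠ 0 := UpperHalfPlane.denom_ne_zero _ _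
  have h3 := h.denom_eq hg hd τ
  have h4 : (m : ℂ) * γ 0 0 = γ' 0 0 * g := by exact_mod_cast h.apply_zero_zero
  have h5 : (m : ℂ) * γ 0 1 = γ' 0 0 * b + γ' 0 1 * d := by exact_mod_cast h.apply_zero_one
  rw [ModularGroup.denom_apply] at h1 h2 h3
  rw [ModularGroup.denom_apply] at h3
  rw [UpperHalfPlane.coe_specialLinearGroup_apply, UpperHalfPlane.coe_specialLinearGroup_apply]
  simp only [algebraMap_int_eq, eq_intCast, Complex.ofReal_intCast]
  rw [h3]
  rw [mul_div_assoc', div_eq_div_iff (mul_ne_zero hd' h2) h2]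
  simp only [coe_affineMap]
  field_simp
  linear_combination (γ' 1 0 * (g * τ + b) + d * γ' 1 1) * (τ * h4 + h5)

end IsFactorization

lemma discriminant_smul (γ : SL(2, ℤ)) (τ : ℍ) :
    ModularForm.discriminant (γ • τ) = denom γ τ ^ 12 * ModularForm.discriminant τ := by
  have h := congrFun (SlashInvariantForm.slash_action_generators_SL2Z
    ModularForm.discriminant_S_invariant ModularForm.discriminant_T_invariant γ) τ
  rw [ModularForm.SL_slash_apply] at h
  have h1 : denom γ τ ≠ 0 := UpperHalfPlane.denom_ne_zero _ _
  rw [← h, mul_comm, mul_assoc, zpow_neg, ← zpow_natCast]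
  simp [h1]

lemma eta_eq_mul_poch (z : ℂ) : ModularForm.eta z = 𝕢 24 z * poch (𝕢 1 z) (𝕢 1 z) := by
  simp only [ModularForm.eta, ModularForm.eta_q, poch, pow_succ']

lemma discriminant_eq_mul_poch (τ : ℍ) :
    ModularForm.discriminant τ = 𝕢 1 τ * poch (𝕢 1 τ) (𝕢 1 τ) ^ 24 := by
  rw [ModularForm.discriminant, eta_eq_mul_poch, mul_pow]
  congr 1
  rw [Function.Periodic.qParam, Function.Periodic.qParam, ← Complex.exp_nat_mul]
  congr 1
  push_cast
  ring

/-! ### Eta quotients -/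

lemma mdifferentiable_one : MDiff fun _ : ℍ ↦ (1 : ℂ) := by
  rw [UpperHalfPlane.mdifferentiable_iff]
  exact differentiableOn_const _

lemma IsModularUnit.one (Γ : Subgroup SL(2, ℤ)) (W : SL(2, ℤ) → ℕ) :
    IsModularUnit Γ W 0 (fun _ ↦ 0) fun _ ↦ 1 where
  mdiff := mdifferentiable_one
  ne_zero _ := one_ne_zero
  char := ⟨1, one_ne_zero, fun γ _ ↦ ⟨1, one_pow _, fun τ ↦ by
    simp [ModularForm.SL_slash_apply]⟩⟩
  expansion γ := ⟨fun _ ↦ 1, ⟨analyticAt_const, Eventually.of_forall fun τ ↦ by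
    simp [ModularForm.SL_slash_apply]⟩, one_ne_zero⟩

lemma IsModularUnit.prod {Γ : Subgroup SL(2, ℤ)} {W : SL(2, ℤ) → ℕ} {k : ℕ → ℤ}
    {o : ℕ → SL(2, ℤ) → ℤ} {G : ℕ → ℍ → ℂ} (S : Finset ℕ)
    (h : ∀ m ∈ S, IsModularUnit Γ W (k m) (o m) (G m)) :
    IsModularUnit Γ W (∑ m ∈ S, k m) (fun γ ↦ ∑ m ∈ S, o m γ) fun τ ↦ ∏ m ∈ S, G m τ := by
  induction S using Finset.induction_on with
  | empty => simpa using IsModularUnit.one Γ W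
  | insert m S hm ih =>
    simp only [Finset.sum_insert hm, Finset.prod_insert hm]
    exact (h m (by simp)).mul (ih fun i hi ↦ h i (by simp [hi]))

lemma IsJet.one : IsJet (fun _ ↦ 1) 0 0 :=
  ((IsJet.of_eq (B := 0) analyticAt_const (d₁ := 0) (d₂ := 0)).coeff_congr rfl (by simp)).congr
    (Eventually.of_forall fun q ↦ by simp)

lemma IsJet.prod {A : ℕ → ℂ → ℂ} {l₁ l₂ : ℕ → ℂ} (S : Finset ℕ)
    (h : ∀ m ∈ S, IsJet (A m) (l₁ m) (l₂ m)) :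
    IsJet (fun q ↦ ∏ m ∈ S, A m q) (∑ m ∈ S, l₁ m) (∑ m ∈ S, l₂ m) := by
  induction S using Finset.induction_on with
  | empty => simpa using IsJet.one
  | insert m S hm ih =>
    simp only [Finset.sum_insert hm, Finset.prod_insert hm]
    exact (h m (by simp)).mul (ih fun i hi ↦ h i (by simp [hi]))

/-- The width of a cusp `γ ∞` of `Γ₀(N)`, where `e = gcd(C, N)` with `C` the lower left entry
of `γ`. -/
def cuspWidth (N e : ℕ) : ℕ := N / Nat.gcd (e ^ 2) N

/-- The order of vanishing of `Δ(m τ)` at a cusp `γ ∞` of `Γ₀(N)`, where `e = gcd(C, N)` with `C`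
the lower left entry of `γ`. -/
def discriminantOrder (N m e : ℕ) : ℕ := cuspWidth N e * Nat.gcd e m / (m / Nat.gcd e m)

/-- The order of vanishing of `∏ η(m τ) ^ r(m)` at a cusp `γ ∞` of `Γ₀(N)`, where `e = gcd(C, N)`
with `C` the lower left entry of `γ`. -/
def etaOrder (N : ℕ) (r : ℕ → ℤ) (e : ℕ) : ℤ :=
  (∑ m ∈ N.divisors, r m * discriminantOrder N m e) / 24

/-- The width of the cusp `γ ∞` of `Γ₀(N)`. -/
def width (N : ℕ) (γ : SL(2, ℤ)) : ℕ := cuspWidth N (Int.gcd (γ 1 0) N)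

lemma width_pos {N : ℕ} (hN : 0 < N) (γ : SL(2, ℤ)) : 0 < width N γ :=
  Nat.div_pos (Nat.gcd_le_right _ hN) (Nat.gcd_pos_of_pos_right _ hN)

lemma etaMul_eq (m : ℕ) (z : ℂ) :
    SporadicCase.etaMul m z = 𝕢 24 z ^ m * poch (𝕢 1 z ^ m) (𝕢 1 z ^ m) := by
  have h (h : ℝ) : 𝕢 h (m * z) = 𝕢 h z ^ m := by
    rw [Function.Periodic.qParam, Function.Periodic.qParam, ← Complex.exp_nat_mul]
    congr 1; ring
  rw [SporadicCase.etaMul, eta_eq_mul_poch, h, h]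

lemma mul_mem_upperHalfPlane {m : ℕ} (hm : 0 < m) {z : ℂ} (hz : 0 < z.im) :
    0 < ((m : ℂ) * z).im := by
  have : ((m : ℂ) * z).im = m * z.im := by simp
  rw [this]; positivity

lemma etaMul_ne_zero {m : ℕ} (hm : 0 < m) (τ : ℍ) : SporadicCase.etaMul m τ ≠ 0 :=
  ModularForm.eta_ne_zero (mul_mem_upperHalfPlane hm τ.im_pos)

lemma mdifferentiable_etaMul {m : ℕ} (hm : 0 < m) :
    MDiff fun τ : ℍ ↦ SporadicCase.etaMul m τ := by
  rw [UpperHalfPlane.mdifferentiable_iff]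
  intro z hz
  have h1 : DifferentiableAt ℂ (SporadicCase.etaMul m) z :=
    (ModularForm.differentiableAt_eta_of_mem_upperHalfPlaneSet
      (mul_mem_upperHalfPlane hm hz)).comp z (by fun_prop)
  refine h1.differentiableWithinAt.congr (fun y hy ↦ ?_) ?_
  · simp [ofComplex_apply_of_im_pos hy]
  · simp [ofComplex_apply_of_im_pos hz]

lemma norm_qParam_lt_one (τ : ℍ) : ‖𝕢 1 τ‖ < 1 := by
  simpa using UpperHalfPlane.norm_qParam_lt_one 1 τ

lemma qParam_affineMap {g d : ℕ} (hg : 0 < g) (hd : 0 < d) (b : ℤ) {W n : ℕ} (hW : 0 < W)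
    (hn : W * g = n * d) (τ : ℍ) :
    𝕢 1 (affineMap hg hd b τ) = Complex.exp (2 * π * I * b / d) * 𝕢 W τ ^ n := by
  have hW' : (W : ℂ) ≠ 0 := by exact_mod_cast hW.ne'
  have hd' : (d : ℂ) ≠ 0 := by exact_mod_cast hd.ne'
  have hn' : (W : ℂ) * g = n * d := by exact_mod_cast hn
  rw [Function.Periodic.qParam, Function.Periodic.qParam, ← Complex.exp_nat_mul,
    ← Complex.exp_add]
  congr 1
  simp only [coe_affineMap, Complex.ofReal_one, div_one, Complex.ofReal_natCast]
  field_simp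
  linear_combination τ * hn'

/-- `Δ(m τ)` is a modular unit on `Γ₀(N)` for `m ∣ N`. The divisibility says that its order at all
cusps is an integer. -/
lemma isModularUnit_discriminant {N m : ℕ} (hN : 0 < N) (hm : m ∣ N)
    (h : ∀ e ∈ N.divisors, m / Nat.gcd e m ∣ cuspWidth N e * Nat.gcd e m) :
    IsModularUnit (CongruenceSubgroup.Gamma0 N) (width N) 12
      (fun γ ↦ discriminantOrder N m (Int.gcd (γ 1 0) N))
      (fun τ ↦ SporadicCase.etaMul m τ ^ 24) := by
  have hm0 : 0 < m := Nat.pos_of_dvd_of_pos hm hN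
  have key (γ : SL(2, ℤ)) {γ' : SL(2, ℤ)} {g d : ℕ} {b : ℤ} (hg : 0 < g) (hd : 0 < d)
      (hγ : IsFactorization m γ γ' g d b) (τ : ℍ) :
      ((fun τ : ℍ ↦ SporadicCase.etaMul m τ ^ 24) ∣[(12 : ℤ)] γ) τ =
        (d : ℂ)⁻¹ ^ 12 * ModularForm.discriminant (affineMap hg hd b τ) := by
    have hd' : (d : ℂ) ≠ 0 := by exact_mod_cast hd.ne'
    have h1 : SporadicCase.etaMul m (γ • τ : ℍ) ^ 24 =
        ModularForm.discriminant (γ' • affineMap hg hd b τ) := by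
      rw [SporadicCase.etaMul, hγ.smul_eq hg hd, ModularForm.discriminant]
    have h2 : denom γ' (affineMap hg hd b τ) ≠ 0 := UpperHalfPlane.denom_ne_zero _ _
    rw [ModularForm.SL_slash_apply]
    simp only [h1, discriminant_smul, hγ.denom_eq hg hd]
    rw [zpow_neg, show (12 : ℤ) = (12 : ℕ) from rfl, zpow_natCast]
    field_simp
  refine ⟨mdifferentiable_zpow (mdifferentiable_etaMul hm0) (etaMul_ne_zero hm0) 24,
    fun τ ↦ pow_ne_zero _ (etaMul_ne_zero hm0 τ), ⟨1, one_ne_zero, fun γ hγ ↦ ?_⟩, fun γ ↦ ?_⟩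
  · refine ⟨1, one_pow _, fun τ ↦ ?_⟩
    have hg : m = Int.gcd (γ 1 0) m := by
      rw [CongruenceSubgroup.Gamma0_mem, ZMod.intCast_zmod_eq_zero_iff_dvd] at hγ
      have : (m : ℤ) ∣ γ 1 0 := (Int.natCast_dvd_natCast.2 hm).trans hγ
      exact (Nat.gcd_eq_right (Int.natCast_dvd.1 this)).symm
    obtain ⟨γ', b, hb⟩ := exists_isFactorization γ hm0 hg (mul_one m)
    rw [key γ hm0 one_pos hb, one_mul]
    have h1 : 𝕢 1 (affineMap hm0 one_pos b τ) = 𝕢 1 τ ^ m := by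
      rw [qParam_affineMap hm0 one_pos b (W := 1) (n := m) one_pos (by ring)]
      simp [mul_comm _ (b : ℂ), Complex.exp_int_mul_two_pi_mul_I]
    rw [discriminant_eq_mul_poch, h1, etaMul_eq]
    have h2 : 𝕢 24 τ ^ 24 = 𝕢 1 τ := by
      rw [Function.Periodic.qParam, Function.Periodic.qParam, ← Complex.exp_nat_mul]
      congr 1; push_cast; ring
    rw [mul_pow, ← h2]
    simp only [Nat.cast_one, inv_one, one_pow, one_mul]
    ring
  · set e := Int.gcd (γ 1 0) N with he
    have hgcd : Int.gcd (γ 1 0) m = Nat.gcd e m := by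
      rw [he, Int.gcd, Int.gcd, Nat.gcd_assoc]
      simp [Nat.gcd_eq_right hm]
    set g := Nat.gcd e m with hg
    have hg0 : 0 < g := Nat.gcd_pos_of_pos_right _ hm0
    have hgm : g ∣ m := Nat.gcd_dvd_right _ _
    have hd0 : 0 < m / g := Nat.div_pos (Nat.le_of_dvd hm0 hgm) hg0
    obtain ⟨γ', b, hb⟩ := exists_isFactorization γ hm0 hgcd.symm (Nat.mul_div_cancel' hgm)
    have hW := width_pos hN γ
    have heN : e ∈ N.divisors := by
      simpa [hN.ne'] using (Int.natCast_dvd_natCast.1 (Int.gcd_dvd_right (γ 1 0) N))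
    have hdvd := h e heN
    have hn : width N γ * g = discriminantOrder N m e * (m / g) :=
      (Nat.div_mul_cancel hdvd).symm
    have hn0 : discriminantOrder N m e ≠ 0 := by
      intro h0
      rw [h0, zero_mul] at hn
      exact (Nat.mul_pos hW hg0).ne' hn
    set n := discriminantOrder N m e with hnd
    set ζ := Complex.exp (2 * π * I * b / (m / g : ℕ)) with hζ
    have hpoch : AnalyticAt ℂ (fun w ↦ poch (ζ * w ^ n) (ζ * w ^ n)) 0 := by
      have h1 : AnalyticAt ℂ (fun q : ℂ ↦ poch (q ^ 1) (q ^ 1)) (ζ * 0 ^ n) := by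
        rw [zero_pow hn0, mul_zero]; exact analyticAt_poch_pow 1 1 one_ne_zero
      simpa [Function.comp_def] using h1.comp (g := fun q : ℂ ↦ poch (q ^ 1) (q ^ 1))
        (f := fun w ↦ ζ * w ^ n) (by fun_prop)
    refine ⟨fun w ↦ ((m / g : ℕ) : ℂ)⁻¹ ^ 12 * ζ * poch (ζ * w ^ n) (ζ * w ^ n) ^ 24,
      ⟨analyticAt_const.mul (hpoch.pow 24), Eventually.of_forall fun τ ↦ ?_⟩, ?_⟩
    · rw [key γ hg0 hd0 hb, discriminant_eq_mul_poch,
        qParam_affineMap hg0 hd0 b hW hn, zpow_natCast]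
      ring
    · have h1 : poch 0 0 = 1 := by
        simpa using (isJet_poch_self one_ne_zero).apply_zero
      have h2 : ((m / g : ℕ) : ℂ) ≠ 0 := by exact_mod_cast hd0.ne'
      simp only [zero_pow hn0, mul_zero, h1, one_pow, mul_one]
      exact mul_ne_zero (pow_ne_zero _ (inv_ne_zero h2)) (Complex.exp_ne_zero _)

/-- The eta quotient `∏ η(m τ) ^ r(m)`, the product being over the divisors of `N`. -/
noncomputable def etaQuotient (N : ℕ) (r : ℕ → ℤ) (τ : ℍ) : ℂ :=
  ∏ m ∈ N.divisors, SporadicCase.etaMul m τ ^ r m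

/-- Integrality conditions, on the orders at the cusps and on the weight, under which an eta
quotient is a modular unit of weight `k` on `Γ₀(N)`. -/
structure IsEtaData (N : ℕ) (r : ℕ → ℤ) (k : ℤ) : Prop where
  dvd : ∀ m ∈ N.divisors, ∀ e ∈ N.divisors, m / Nat.gcd e m ∣ cuspWidth N e * Nat.gcd e m
  dvd_sum : ∀ e ∈ N.divisors, 24 ∣ ∑ m ∈ N.divisors, r m * discriminantOrder N m e
  sum_eq : ∑ m ∈ N.divisors, r m = 2 * k

lemma mdifferentiable_prod {G : ℕ → ℍ → ℂ} (S : Finset ℕ) (h : ∀ m ∈ S, MDiff (G m)) :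
    MDiff fun τ ↦ ∏ m ∈ S, G m τ := by
  induction S using Finset.induction_on with
  | empty => simpa using mdifferentiable_one
  | insert m S hm ih =>
    simp only [Finset.prod_insert hm]
    exact mdifferentiable_mul (h m (by simp)) (ih fun i hi ↦ h i (by simp [hi]))

lemma IsEtaData.isModularUnit {N : ℕ} (hN : 0 < N) {r : ℕ → ℤ} {k : ℤ} (h : IsEtaData N r k) :
    IsModularUnit (CongruenceSubgroup.Gamma0 N) (width N) k
      (fun γ ↦ etaOrder N r (Int.gcd (γ 1 0) N)) (etaQuotient N r) := by
  have hpos {m : ℕ} (hm : m ∈ N.divisors) : 0 < m := Nat.pos_of_mem_divisors hm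
  refine IsModularUnit.root (width_pos hN) (n := 24) (by norm_num) (mdifferentiable_prod _
    fun m hm ↦ mdifferentiable_zpow (mdifferentiable_etaMul (hpos hm))
      (etaMul_ne_zero (hpos hm)) _) ?_
  have h1 := IsModularUnit.prod N.divisors fun m hm ↦ (isModularUnit_discriminant hN
    (Nat.dvd_of_mem_divisors hm) (h.dvd m hm)).zpow (r m)
  refine h1.congr (fun γ ↦ ?_) ?_ fun τ ↦ ?_
  · have heN : Int.gcd (γ 1 0) N ∈ N.divisors := by
      simpa [hN.ne'] using (Int.natCast_dvd_natCast.1 (Int.gcd_dvd_right (γ 1 0) N))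
    exact Int.mul_ediv_cancel' (h.dvd_sum _ heN)
  · rw [← Finset.sum_mul, h.sum_eq]; push_cast; ring
  · rw [etaQuotient, ← Finset.prod_pow]
    refine Finset.prod_congr rfl fun m _ ↦ ?_
    rw [← zpow_natCast, ← zpow_natCast, zpow_comm]

/-- The unit part of the `q`-expansion of an eta quotient. -/
noncomputable def etaCoeff (N : ℕ) (r : ℕ → ℤ) (q : ℂ) : ℂ :=
  ∏ m ∈ N.divisors, poch (q ^ m) (q ^ m) ^ r m

lemma hasExpansion_etaQuotient {N : ℕ} {r : ℕ → ℤ} {n : ℤ}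
    (h : ∑ m ∈ N.divisors, (m : ℤ) * r m = 24 * n) :
    HasExpansion 1 n (etaCoeff N r) (etaQuotient N r) := by
  refine ⟨(IsJet.prod N.divisors fun m hm ↦
    (isJet_poch_self (Nat.pos_of_mem_divisors hm).ne').zpow (r m)).analyticAt,
    Eventually.of_forall fun τ ↦ ?_⟩
  have h0 := Function.Periodic.qParam_ne_zero (h := 24) (τ : ℂ)
  have h2 : 𝕢 1 τ = 𝕢 24 τ ^ (24 : ℤ) := by
    rw [show (24 : ℤ) = (24 : ℕ) from rfl, zpow_natCast]
    rw [Function.Periodic.qParam, Function.Periodic.qParam, ← Complex.exp_nat_mul]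
    congr 1; push_cast; ring
  have h3 : 𝕢 1 τ ^ n = ∏ m ∈ N.divisors, (𝕢 24 τ ^ m) ^ r m := by
    rw [h2, ← zpow_mul, ← h]
    induction N.divisors using Finset.induction_on with
    | empty => simp
    | insert m S hm ih =>
      rw [Finset.sum_insert hm, Finset.prod_insert hm, zpow_add₀ h0, ih, zpow_mul, zpow_natCast]
  rw [Nat.cast_one, etaCoeff, h3, ← Finset.prod_mul_distrib, etaQuotient]
  exact Finset.prod_congr rfl fun m _ ↦ by rw [etaMul_eq, mul_zpow]

lemma isJet_etaCoeff (N : ℕ) (r : ℕ → ℤ) {l₁ l₂ : ℂ}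
    (h₁ : l₁ = ∑ m ∈ N.divisors, (r m : ℂ) * (if m = 1 then -1 else 0))
    (h₂ : l₂ = ∑ m ∈ N.divisors, (r m : ℂ) * (if m = 1 then -3 else if m = 2 then -2 else 0)) :
    IsJet (etaCoeff N r) l₁ l₂ :=
  (IsJet.prod N.divisors fun m hm ↦
    (isJet_poch_self (Nat.pos_of_mem_divisors hm).ne').zpow (r m)).coeff_congr h₁ h₂

/-! ### The differential system of a sporadic case -/

/-- The differential equations satisfied by `t` and `f`. The second one says that `f`, as a
function of `t`, is a solution of the Apéry-like differential equation with parameters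
`(a, b, c)`. -/
structure IsModularSystem (a b c : ℂ) (t f : ℍ → ℂ) : Prop where
  mdiff_t : MDiff t
  mdiff_f : MDiff f
  t_ne_zero : ∀ τ, t τ ≠ 0
  f_ne_zero : ∀ τ, f τ ≠ 0
  quadratic_ne_zero : ∀ τ, 1 - a * t τ + c * t τ ^ 2 ≠ 0
  deriv_t : ∀ τ, D t τ = t τ * (f τ ^ 2 * (1 - a * t τ + c * t τ ^ 2))
  deriv_deriv_inv_f : ∀ τ, D (D fun τ ↦ (f τ)⁻¹) τ =
    -(f τ ^ 3 * (1 - a * t τ + c * t τ ^ 2) * t τ * (b - c * t τ))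

/-- The criterion for the differential system: the orders at the cusps and the expansions at
infinity to second order determine everything. -/
lemma IsModularSystem.of_isModularUnit {Γ : Subgroup SL(2, ℤ)} [Γ.FiniteIndex] {W : SL(2, ℤ) → ℕ}
    {t E f : ℍ → ℂ} {ot oE oF : SL(2, ℤ) → ℤ}
    (hW : ∀ γ, 0 < W γ) (ht : IsModularUnit Γ W 0 ot t)
    (hE : IsModularUnit Γ W 2 oE E) (hf : IsModularUnit Γ W 1 oF f)
    (hc : CuspCondition ot oE oF)
    {At AE Af : ℂ → ℂ} {t₁ t₂ e₁ e₂ f₁ f₂ : ℂ} (hAt : HasExpansion 1 1 At t) (jt : IsJet At t₁ t₂)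
    (hAE : HasExpansion 1 0 AE E) (jE : IsJet AE e₁ e₂)
    (hAf : HasExpansion 1 0 Af f) (jf : IsJet Af f₁ f₂) {a b c : ℂ}
    (h1 : e₁ - 2 * f₁ = -a) (h2 : e₂ - 2 * f₂ + a * (t₁ + 2 * f₁) = 2 * c)
    (h3 : f₁ = b) (h4 : 2 * f₂ - f₁ ^ 2 - f₁ * (e₁ + 2 * f₁ + t₁) = -c) :
    IsModularSystem a b c t f := by
  have hR := eq_sq_mul_quadratic hW ht hE hf hc hAt jt hAE jE hAf jf h1 h2
  refine ⟨ht.mdiff, hf.mdiff, ht.ne_zero, hf.ne_zero, fun τ h0 ↦ hE.ne_zero τ ?_, fun τ ↦ ?_,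
    fun τ ↦ ?_⟩
  · rw [hR, h0, mul_zero]
  · rw [deriv_eq_mul hW ht hE hc hAt jt hAE jE, hR]
  · rw [deriv_deriv_inv_eq hW ht hE hf hc hAt jt hAE jE hAf jf h3 h4, hR]
    ring

/-- The first coefficient of the jet of an eta quotient. -/
def jetOne (N : ℕ) (r : ℕ → ℤ) : ℤ := ∑ m ∈ N.divisors, r m * (if m = 1 then -1 else 0)

/-- The second coefficient of the jet of an eta quotient. -/
def jetTwo (N : ℕ) (r : ℕ → ℤ) : ℤ :=
  ∑ m ∈ N.divisors, r m * (if m = 1 then -3 else if m = 2 then -2 else 0)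

instance (N : ℕ) [NeZero N] : (CongruenceSubgroup.Gamma0 N).FiniteIndex :=
  (CongruenceSubgroup.Gamma0_is_congruence N).finiteIndex

lemma isJet_etaCoeff' (N : ℕ) (r : ℕ → ℤ) : IsJet (etaCoeff N r) (jetOne N r) (jetTwo N r) :=
  isJet_etaCoeff N r (by simp [jetOne]) (by simp [jetTwo])

/-- The criterion for eta quotients, where every hypothesis is decidable. The exponents `rE` belong
to the eta quotient `E = D t / t`. -/
lemma IsModularSystem.of_etaQuotient {N : ℕ} [NeZero N] {rt rE rf : ℕ → ℤ}
    (ht : IsEtaData N rt 0) (hE : IsEtaData N rE 2) (hf : IsEtaData N rf 1)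
    (hc : ∀ e ∈ N.divisors,
      (etaOrder N rt e = 1 ∧ etaOrder N rE e = 0 ∧ etaOrder N rf e = 0) ∨
      (etaOrder N rt e = 0 ∧ etaOrder N rE e = 1 ∧ etaOrder N rf e = 0) ∨
      (etaOrder N rt e = -1 ∧ etaOrder N rE e = 0 ∧ etaOrder N rf e = 1))
    (st : ∑ m ∈ N.divisors, (m : ℤ) * rt m = 24 * 1)
    (sE : ∑ m ∈ N.divisors, (m : ℤ) * rE m = 24 * 0)
    (sf : ∑ m ∈ N.divisors, (m : ℤ) * rf m = 24 * 0) {a b c : ℤ}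
    (h1 : jetOne N rE - 2 * jetOne N rf = -a)
    (h2 : jetTwo N rE - 2 * jetTwo N rf + a * (jetOne N rt + 2 * jetOne N rf) = 2 * c)
    (h3 : jetOne N rf = b)
    (h4 : 2 * jetTwo N rf - jetOne N rf ^ 2 -
      jetOne N rf * (jetOne N rE + 2 * jetOne N rf + jetOne N rt) = -c) :
    IsModularSystem a b c (etaQuotient N rt) (etaQuotient N rf) := by
  have hN : 0 < N := Nat.pos_of_ne_zero (NeZero.ne N)
  refine .of_isModularUnit (width_pos hN) (ht.isModularUnit hN) (hE.isModularUnit hN)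
    (hf.isModularUnit hN) (fun γ ↦ hc _ ?_) (hasExpansion_etaQuotient st) (isJet_etaCoeff' N rt)
    (hasExpansion_etaQuotient sE) (isJet_etaCoeff' N rE) (hasExpansion_etaQuotient sf)
    (isJet_etaCoeff' N rf) (by exact_mod_cast h1) (by exact_mod_cast h2) (by exact_mod_cast h3)
    (by exact_mod_cast h4)
  simpa [hN.ne'] using (Int.natCast_dvd_natCast.1 (Int.gcd_dvd_right (γ 1 0) N))

lemma divisors_six : Nat.divisors 6 = {1, 2, 3, 6} := by decide
lemma divisors_eight : Nat.divisors 8 = {1, 2, 4, 8} := by decide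
lemma divisors_nine : Nat.divisors 9 = {1, 3, 9} := by decide

lemma IsModularSystem.congr {a b c : ℂ} {t f t' f' : ℍ → ℂ} (h : IsModularSystem a b c t f)
    (ht : ∀ τ, t' τ = t τ) (hf : ∀ τ, f' τ = f τ) : IsModularSystem a b c t' f' := by
  obtain rfl : t' = t := funext ht
  obtain rfl : f' = f := funext hf
  exact h

open SporadicCase in
lemma isModularSystem_case7 : IsModularSystem case7.a case7.b case7.c
    (fun τ ↦ case7.t τ) (fun τ ↦ case7.f τ) := by
  have h := IsModularSystem.of_etaQuotient (N := 6) (a := 7) (b := 2) (c := -8)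
    (rt := fun | 1 => 3 | 2 => -3 | 3 => -9 | 6 => 9 | _ => 0)
    (rE := fun | 1 => 3 | 2 => 3 | 3 => -1 | 6 => -1 | _ => 0)
    (rf := fun | 1 => -2 | 2 => 1 | 3 => 6 | 6 => -3 | _ => 0)
    ⟨by decide, by decide, by decide⟩ ⟨by decide, by decide, by decide⟩
    ⟨by decide, by decide, by decide⟩ (by decide) (by decide) (by decide) (by decide)
    (by decide) (by decide) (by decide) (by decide)
  simp only [Int.cast_ofNat, Int.cast_neg] at h
  refine h.congr (fun τ ↦ ?_) (fun τ ↦ ?_) <;>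
  simp [etaQuotient, divisors_six, SporadicCase.t, SporadicCase.f, zpow_neg, zpow_ofNat] <;> ring

open SporadicCase in
lemma isModularSystem_case10 : IsModularSystem case10.a case10.b case10.c
    (fun τ ↦ case10.t τ) (fun τ ↦ case10.f τ) := by
  have h := IsModularSystem.of_etaQuotient (N := 6) (a := 10) (b := 3) (c := 9)
    (rt := fun | 1 => 4 | 2 => -8 | 3 => -4 | 6 => 8 | _ => 0)
    (rE := fun | 1 => 4 | 2 => -2 | 3 => 4 | 6 => -2 | _ => 0)
    (rf := fun | 1 => -3 | 2 => 6 | 3 => 1 | 6 => -2 | _ => 0)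
    ⟨by decide, by decide, by decide⟩ ⟨by decide, by decide, by decide⟩
    ⟨by decide, by decide, by decide⟩ (by decide) (by decide) (by decide) (by decide)
    (by decide) (by decide) (by decide) (by decide)
  simp only [Int.cast_ofNat] at h
  refine h.congr (fun τ ↦ ?_) (fun τ ↦ ?_) <;>
  simp [etaQuotient, divisors_six, SporadicCase.t, SporadicCase.f, zpow_neg, zpow_ofNat] <;> ring

open SporadicCase in
lemma isModularSystem_case17 : IsModularSystem case17.a case17.b case17.c
    (fun τ ↦ case17.t τ) (fun τ ↦ case17.f τ) := by
  have h := IsModularSystem.of_etaQuotient (N := 6) (a := -17) (b := -6) (c := 72)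
    (rt := fun | 1 => -5 | 2 => 1 | 3 => -1 | 6 => 5 | _ => 0)
    (rE := fun | 1 => -5 | 2 => 7 | 3 => 7 | 6 => -5 | _ => 0)
    (rf := fun | 1 => 6 | 2 => -3 | 3 => -2 | 6 => 1 | _ => 0)
    ⟨by decide, by decide, by decide⟩ ⟨by decide, by decide, by decide⟩
    ⟨by decide, by decide, by decide⟩ (by decide) (by decide) (by decide) (by decide)
    (by decide) (by decide) (by decide) (by decide)
  simp only [Int.cast_ofNat, Int.cast_neg] at h
  refine h.congr (fun τ ↦ ?_) (fun τ ↦ ?_) <;>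
  simp [etaQuotient, divisors_six, SporadicCase.t, SporadicCase.f, zpow_neg, zpow_ofNat] <;> ring

open SporadicCase in
lemma isModularSystem_case12 : IsModularSystem case12.a case12.b case12.c
    (fun τ ↦ case12.t τ) (fun τ ↦ case12.f τ) := by
  have h := IsModularSystem.of_etaQuotient (N := 8) (a := 12) (b := 4) (c := 32)
    (rt := fun | 1 => 4 | 2 => -10 | 4 => 2 | 8 => 4 | _ => 0)
    (rE := fun | 1 => 4 | 2 => -6 | 4 => 10 | 8 => -4 | _ => 0)
    (rf := fun | 1 => -4 | 2 => 10 | 4 => -4 | _ => 0)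
    ⟨by decide, by decide, by decide⟩ ⟨by decide, by decide, by decide⟩
    ⟨by decide, by decide, by decide⟩ (by decide) (by decide) (by decide) (by decide)
    (by decide) (by decide) (by decide) (by decide)
  simp only [Int.cast_ofNat] at h
  refine h.congr (fun τ ↦ ?_) (fun τ ↦ ?_) <;>
  simp [etaQuotient, divisors_eight, SporadicCase.t, SporadicCase.f, zpow_neg, zpow_ofNat] <;> ring

open SporadicCase in
lemma isModularSystem_case9 : IsModularSystem case9.a case9.b case9.c
    (fun τ ↦ case9.t τ) (fun τ ↦ case9.f τ) := by
  have h := IsModularSystem.of_etaQuotient (N := 9) (a := -9) (b := -3) (c := 27)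
    (rt := fun | 1 => -3 | 9 => 3 | _ => 0)
    (rE := fun | 1 => -3 | 3 => 10 | 9 => -3 | _ => 0)
    (rf := fun | 1 => 3 | 3 => -1 | _ => 0)
    ⟨by decide, by decide, by decide⟩ ⟨by decide, by decide, by decide⟩
    ⟨by decide, by decide, by decide⟩ (by decide) (by decide) (by decide) (by decide)
    (by decide) (by decide) (by decide) (by decide)
  simp only [Int.cast_ofNat, Int.cast_neg] at h
  refine h.congr (fun τ ↦ ?_) (fun τ ↦ ?_) <;>
  simp [etaQuotient, divisors_nine, SporadicCase.t, SporadicCase.f, zpow_neg, zpow_ofNat] <;> ring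

/-! ### Products over residue classes modulo five -/

lemma hasProd_inv₀ {g : ℕ → ℂ} {A : ℂ} (h : HasProd g A) (hA : A ≠ 0) :
    HasProd (fun n ↦ (g n)⁻¹) A⁻¹ := by
  have := Filter.Tendsto.inv₀ h hA
  refine this.congr fun s ↦ ?_
  simp

/-- The factor `1 - q ^ (n + 1)` if `n + 1` is congruent to `r` modulo `5`, and `1` otherwise. -/
noncomputable def residueFactor (r : ℕ) (q : ℂ) (n : ℕ) : ℂ :=
  if (n + 1) % 5 = r % 5 then 1 - q ^ (n + 1) else 1

lemma norm_pow_five_lt_one {q : ℂ} (hq : ‖q‖ < 1) : ‖q ^ 5‖ < 1 := by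
  rw [norm_pow]; exact pow_lt_one₀ (norm_nonneg _) hq (by norm_num)

lemma norm_pow_succ_lt_one {q : ℂ} (hq : ‖q‖ < 1) {r : ℕ} (hr : r ≠ 0) : ‖q ^ r‖ < 1 := by
  rw [norm_pow]; exact pow_lt_one₀ (norm_nonneg _) hq hr

lemma hasProd_residueFactor {r : ℕ} (h1 : 1 ≤ r) (h5 : r ≤ 5) {q : ℂ} (hq : ‖q‖ < 1) :
    HasProd (residueFactor r q) (poch (q ^ r) (q ^ 5)) := by
  have hinj : Function.Injective fun k : ℕ ↦ 5 * k + (r - 1) := fun k l h ↦ by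
    have : 5 * k + (r - 1) = 5 * l + (r - 1) := h
    lia
  refine (hinj.hasProd_iff fun n hn ↦ ?_).1 ?_
  · rw [residueFactor, if_neg]
    intro h
    exact hn ⟨(n + 1 - r) / 5, by simp only; lia⟩
  · have h := (multipliable_poch (q ^ r) (norm_pow_five_lt_one hq)).hasProd
    refine h.congr_fun fun k ↦ ?_
    rw [Function.comp_apply, residueFactor, if_pos (by lia), ← pow_mul, ← pow_add]
    congr 2
    lia

lemma poch_residue_ne_zero {q : ℂ} (hq : ‖q‖ < 1) {r : ℕ} (hr : r ≠ 0) :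
    poch (q ^ r) (q ^ 5) ≠ 0 :=
  poch_ne_zero_of_norm_lt (norm_pow_five_lt_one hq) (norm_pow_succ_lt_one hq hr)

lemma poch_self_eq_prod {q : ℂ} (hq : ‖q‖ < 1) :
    poch q q = poch (q ^ 1) (q ^ 5) * poch (q ^ 2) (q ^ 5) * poch (q ^ 3) (q ^ 5) *
      poch (q ^ 4) (q ^ 5) * poch (q ^ 5) (q ^ 5) := by
  have h := ((((hasProd_residueFactor (r := 1) (by lia) (by lia) hq).mul
    (hasProd_residueFactor (r := 2) (by lia) (by lia) hq)).mul
    (hasProd_residueFactor (r := 3) (by lia) (by lia) hq)).mul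
    (hasProd_residueFactor (r := 4) (by lia) (by lia) hq)).mul
    (hasProd_residueFactor (r := 5) (by lia) (by lia) hq)
  refine (multipliable_poch q hq).hasProd.unique (h.congr_fun fun n ↦ ?_)
  have hn : (n + 1) % 5 < 5 := Nat.mod_lt _ (by norm_num)
  simp only [residueFactor]
  rw [← pow_succ']
  interval_cases h : (n + 1) % 5 <;> simp

lemma nome_eq (z : ℂ) : SporadicCase.nome z = 𝕢 1 z := by
  rw [SporadicCase.nome, Function.Periodic.qParam]; simp

/-- The unit part of the `q`-expansion of `t` in level five. -/
noncomputable def tFiveCoeff (q : ℂ) : ℂ :=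
  (poch (q ^ 1) (q ^ 5) * poch (q ^ 4) (q ^ 5) /
    (poch (q ^ 2) (q ^ 5) * poch (q ^ 3) (q ^ 5))) ^ 5

/-- The `q`-expansion of `f` in level five. -/
noncomputable def fFiveCoeff (q : ℂ) : ℂ :=
  poch (q ^ 5) (q ^ 5) ^ 2 * (poch (q ^ 1) (q ^ 5) * poch (q ^ 4) (q ^ 5)) ^ (-3 : ℤ) *
    (poch (q ^ 2) (q ^ 5) * poch (q ^ 3) (q ^ 5)) ^ 2

lemma tFive_eq (τ : ℍ) : SporadicCase.tFive τ = 𝕢 1 τ * tFiveCoeff (𝕢 1 τ) := by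
  rw [SporadicCase.tFive, nome_eq, tFiveCoeff]
  have hq := norm_qParam_lt_one τ
  generalize 𝕢 1 τ = q at hq ⊢
  congr 1
  have h := ((((hasProd_residueFactor (r := 1) (by lia) (by lia) hq).mul
    (hasProd_residueFactor (r := 4) (by lia) (by lia) hq)).mul
    (hasProd_inv₀ ((hasProd_residueFactor (r := 2) (by lia) (by lia) hq).mul
      (hasProd_residueFactor (r := 3) (by lia) (by lia) hq))
      (mul_ne_zero (poch_residue_ne_zero hq (by lia)) (poch_residue_ne_zero hq (by lia))))).pow 5)
  rw [← div_eq_mul_inv] at h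
  refine (h.congr_fun fun n ↦ ?_).tprod_eq
  have hn : (n + 1) % 5 < 5 := Nat.mod_lt _ (by norm_num)
  have hJ : jacobiSym ((n : ℤ) + 1) 5 = jacobiSym (((n + 1) % 5 : ℕ) : ℤ) 5 := by
    rw [jacobiSym.mod_left]; push_cast; rfl
  rw [hJ]
  simp only [residueFactor]
  have j0 : jacobiSym 0 5 = 0 := by norm_num
  have j1 : jacobiSym 1 5 = 1 := by norm_num
  have j2 : jacobiSym 2 5 = -1 := by norm_num
  have j3 : jacobiSym 3 5 = -1 := by norm_num
  have j4 : jacobiSym 4 5 = 1 := by norm_num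
  interval_cases h : (n + 1) % 5 <;> simp [j0, j1, j2, j3, j4, zpow_neg, zpow_ofNat]

lemma fFive_eq (τ : ℍ) : SporadicCase.fFive τ = fFiveCoeff (𝕢 1 τ) := by
  rw [SporadicCase.fFive, nome_eq, fFiveCoeff]
  have hq := norm_qParam_lt_one τ
  generalize 𝕢 1 τ = q at hq ⊢
  congr 1
  · congr 1
    · have h := (multipliable_poch (q ^ 5) (norm_pow_five_lt_one hq)).hasProd.pow 2
      refine (h.congr_fun fun n ↦ ?_).tprod_eq
      rw [pow_mul, pow_succ' (q ^ 5)]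
    · have h := (hasProd_inv₀ ((hasProd_residueFactor (r := 1) (by lia) (by lia) hq).mul
        (hasProd_residueFactor (r := 4) (by lia) (by lia) hq)) (mul_ne_zero
          (poch_residue_ne_zero hq (by lia)) (poch_residue_ne_zero hq (by lia)))).pow 3
      rw [inv_pow] at h
      refine Eq.trans (h.congr_fun fun n ↦ ?_).tprod_eq (by rw [zpow_neg]; rfl)
      have hn : (n + 1) % 5 < 5 := Nat.mod_lt _ (by norm_num)
      simp only [residueFactor]
      interval_cases h : (n + 1) % 5 <;> simp [zpow_neg, zpow_ofNat]
  · have h := ((hasProd_residueFactor (r := 2) (by lia) (by lia) hq).mul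
        (hasProd_residueFactor (r := 3) (by lia) (by lia) hq)).pow 2
    refine (h.congr_fun fun n ↦ ?_).tprod_eq
    have hn : (n + 1) % 5 < 5 := Nat.mod_lt _ (by norm_num)
    simp only [residueFactor]
    interval_cases h : (n + 1) % 5 <;> simp

/-! ### Entire functions with given multipliers -/

/-- The lattice `ℤ + ℤ τ`. -/
noncomputable def periodPair (τ : ℍ) : PeriodPair where
  ω₁ := 1
  ω₂ := τ
  indep := by
    refine LinearIndependent.pair_iff.2 fun s t h ↦ ?_
    have h1 := congrArg Complex.im h
    have h2 := congrArg Complex.re h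
    have h1 : t * τ.im = 0 := by simpa using h1
    have h2 : s + t * τ.re = 0 := by simpa using h2
    have ht : t = 0 := (mul_eq_zero.1 h1).resolve_right τ.im_pos.ne'
    rw [ht] at h2
    exact ⟨by simpa using h2, ht⟩

lemma mem_periodPair {τ : ℍ} {z : ℂ} :
    z ∈ (periodPair τ).lattice ↔ ∃ m n : ℤ, (m : ℂ) + n * τ = z := by
  rw [PeriodPair.mem_lattice]; simp [periodPair]

lemma periodic_of_mem_lattice {X : Type*} {f : ℂ → X} {τ : ℍ} (h1 : Function.Periodic f 1)
    (h2 : Function.Periodic f τ) {w : ℂ} (hw : w ∈ (periodPair τ).lattice) :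
    Function.Periodic f w := by
  obtain ⟨m, n, rfl⟩ := mem_periodPair.1 hw
  have := (h1.int_mul m).add_period (h2.int_mul n)
  simpa using this

/-- Two entire functions with the same multipliers under translation by `1` and `τ` are
proportional if the zeros of the second are all in `ℤ + ℤ τ` and simple, and the first vanishes
there as well: their quotient is a bounded entire function. -/
lemma exists_eq_mul_of_multipliers {τ : ℍ} {A B m₁ m₂ : ℂ → ℂ} (hA : Differentiable ℂ A)
    (hB : Differentiable ℂ B) (hm₁ : ∀ z, m₁ z ≠ 0) (hm₂ : ∀ z, m₂ z ≠ 0)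
    (hA₁ : ∀ z, A (z + 1) = m₁ z * A z) (hA₂ : ∀ z, A (z + τ) = m₂ z * A z)
    (hB₁ : ∀ z, B (z + 1) = m₁ z * B z) (hB₂ : ∀ z, B (z + τ) = m₂ z * B z)
    (hz : ∀ z, B z = 0 → z ∈ (periodPair τ).lattice) (hA0 : A 0 = 0) (hB0 : B 0 = 0)
    (hB' : deriv B 0 ≠ 0) : ∃ c, ∀ z, A z = c * B z := by
  classical
  set L := (periodPair τ).lattice with hL
  have h1L : (1 : ℂ) ∈ L := mem_periodPair.2 ⟨1, 0, by simp⟩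
  have hτL : (τ : ℂ) ∈ L := mem_periodPair.2 ⟨0, 1, by simp⟩
  have hAL (w) (hw : w ∈ L) : A w = 0 := by
    have := periodic_of_mem_lattice (f := fun z ↦ A z = 0) (fun z ↦ by simp [hA₁, hm₁])
      (fun z ↦ by simp [hA₂, hm₂]) hw 0
    simpa [hA0] using this
  have hBL (w) (hw : w ∈ L) : B w = 0 := by
    have := periodic_of_mem_lattice (f := fun z ↦ B z = 0) (fun z ↦ by simp [hB₁, hm₁])
      (fun z ↦ by simp [hB₂, hm₂]) hw 0
    simpa [hB0] using this
  let G : ℂ → ℂ := fun z ↦ if z ∈ L then deriv A 0 / deriv B 0 else A z / B z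
  have hG (w) (hw : w ∈ L) : Function.Periodic G w := by
    refine periodic_of_mem_lattice (fun z ↦ ?_) (fun z ↦ ?_) hw
    · simp only [G, L.add_mem_iff_left h1L, hA₁, hB₁, mul_div_mul_left _ _ (hm₁ z)]
    · simp only [G, L.add_mem_iff_left hτL, hA₂, hB₂, mul_div_mul_left _ _ (hm₂ z)]
  have hG0 : DifferentiableAt ℂ G 0 := by
    have hdA : DifferentiableAt ℂ (dslope A 0) 0 :=
      ((Complex.differentiableOn_dslope univ_mem).2 hA.differentiableOn).differentiableAt univ_mem
    have hdB : DifferentiableAt ℂ (dslope B 0) 0 :=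
      ((Complex.differentiableOn_dslope univ_mem).2 hB.differentiableOn).differentiableAt univ_mem
    refine (hdA.div hdB (by rwa [dslope_same])).congr_of_eventuallyEq ?_
    have h1 : ∀ᶠ z in 𝓝[≠] (0 : ℂ), B z ≠ 0 := by
      have := (hB 0).hasDerivAt.eventually_ne (c := 0) hB'
      simpa [hB0] using this
    rw [eventually_nhdsWithin_iff] at h1
    filter_upwards [h1] with z hz1
    by_cases h0 : z = 0
    · subst h0; simp [G, L.zero_mem]
    · have h2 : z ∉ L := fun h ↦ hz1 h0 (hBL z h)
      have h3 : z ≠ 0 := h0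
      simp only [G, if_neg h2, Pi.div_apply, dslope_of_ne _ h0, slope_def_field, hA0, hB0, sub_zero]
      field_simp
  have hGd : Differentiable ℂ G := by
    intro z
    by_cases hzL : z ∈ L
    · have h1 : G = fun u ↦ G (u - z) := by
        funext u
        have := hG z hzL (u - z)
        rwa [sub_add_cancel] at this
      rw [h1]
      have h2 : DifferentiableAt ℂ G (z - z) := by rwa [sub_self]
      exact DifferentiableAt.comp (f := fun u ↦ u - z) z h2 (by fun_prop)
    · refine ((hA z).div (hB z) fun h ↦ hzL (hz z h)).congr_of_eventuallyEq ?_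
      filter_upwards [(periodPair τ).isClosed_lattice.isOpen_compl.mem_nhds hzL] with u hu
      exact if_neg hu
  have hconst (z) : G z = G 0 := hGd.apply_eq_apply_of_bounded
    (IsZLattice.isCompact_range_of_periodic L G hGd.continuous
      fun z w hw ↦ hG w hw z).isBounded z 0
  refine ⟨G 0, fun z ↦ ?_⟩
  by_cases hzL : z ∈ L
  · rw [hAL z hzL, hBL z hzL, mul_zero]
  · rw [← hconst z]
    simp only [G, if_neg hzL]
    exact (div_mul_cancel₀ _ fun h ↦ hzL (hz z h)).symm

/-! ### The odd theta function -/

open SporadicCase (nome tFive fFive)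

lemma nome_add (z w : ℂ) : nome (z + w) = nome z * nome w := by
  rw [nome, nome, nome, ← Complex.exp_add]; ring_nf

lemma nome_zero : nome 0 = 1 := by simp [nome]

lemma nome_ne_zero (z : ℂ) : nome z ≠ 0 := Complex.exp_ne_zero _

lemma nome_neg (z : ℂ) : nome (-z) = (nome z)⁻¹ := by
  rw [nome, nome, ← Complex.exp_neg]; ring_nf

lemma nome_intCast (n : ℤ) : nome n = 1 := by
  rw [nome, mul_comm]; exact Complex.exp_int_mul_two_pi_mul_I n

lemma nome_nat_mul (n : ℕ) (z : ℂ) : nome (n * z) = nome z ^ n := by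
  rw [nome, nome, ← Complex.exp_nat_mul]; ring_nf

lemma nome_half : nome (1 / 2) = -1 := by
  rw [nome, ← Complex.exp_pi_mul_I]; ring_nf

lemma nome_eq_one_iff {z : ℂ} : nome z = 1 ↔ ∃ n : ℤ, z = n := by
  rw [nome, Complex.exp_eq_one_iff]
  refine exists_congr fun n ↦ ⟨fun h ↦ ?_, fun h ↦ by rw [h]; ring⟩
  exact mul_left_cancel₀ Complex.two_pi_I_ne_zero (h.trans (mul_comm _ _))

lemma norm_nome_lt_one (τ : ℍ) : ‖nome τ‖ < 1 := by
  rw [nome_eq]; exact norm_qParam_lt_one τ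

@[fun_prop]
lemma differentiable_nome : Differentiable ℂ nome := by
  unfold SporadicCase.nome; fun_prop

/-- The product for the odd Jacobi theta function, without its factors independent of `z`. It is
an entire function of `z` whose zeros are simple and form the lattice `ℤ + ℤ τ`. -/
noncomputable def thetaProd (z τ : ℂ) : ℂ :=
  (nome (z / 2) - nome (-z / 2)) * poch (nome z * nome τ) (nome τ) *
    poch (nome (-z) * nome τ) (nome τ)

lemma nome_half_sq (z : ℂ) : nome z = nome (z / 2) ^ 2 := by
  rw [← nome_nat_mul]; congr 1; push_cast; ring

lemma nome_eq_one_of_sub_eq_zero {z : ℂ} (h : nome (z / 2) - nome (-z / 2) = 0) :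
    nome z = 1 := by
  rw [neg_div, nome_neg, sub_eq_zero] at h
  rw [nome_half_sq, sq]
  nth_rewrite 1 [h]
  exact inv_mul_cancel₀ (nome_ne_zero _)

lemma thetaProd_neg (z τ : ℂ) : thetaProd (-z) τ = -thetaProd z τ := by
  simp only [thetaProd, neg_neg]; ring

lemma thetaProd_add_one (z τ : ℂ) : thetaProd (z + 1) τ = -thetaProd z τ := by
  have h1 : nome (z + 1) = nome z := by
    rw [nome_add, show (1 : ℂ) = (1 : ℤ) by simp, nome_intCast, mul_one]
  have h2 : nome (-(z + 1)) = nome (-z) := by rw [nome_neg, h1, nome_neg]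
  have h3 : nome ((z + 1) / 2) = -nome (z / 2) := by
    rw [add_div, nome_add, nome_half]; ring
  have h4 : nome (-(z + 1) / 2) = -nome (-z / 2) := by
    rw [neg_div, nome_neg, h3, neg_div, nome_neg, inv_neg]
  rw [thetaProd, thetaProd, h1, h2, h3, h4]; ring

lemma thetaProd_add_right (z τ : ℂ) : thetaProd z (τ + 1) = thetaProd z τ := by
  have h1 : nome (τ + 1) = nome τ := by
    rw [nome_add, show (1 : ℂ) = (1 : ℤ) by simp, nome_intCast, mul_one]
  rw [thetaProd, thetaProd, h1]

lemma thetaProd_add_tau (z : ℂ) (τ : ℍ) :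
    thetaProd (z + τ) τ = -nome (-z - τ / 2) * thetaProd z τ := by
  have hq := norm_nome_lt_one τ
  have h1 := poch_eq_mul (nome z * nome τ) hq
  have h2 := poch_eq_mul (nome (-z)) hq
  have hx := nome_ne_zero (z / 2)
  have hy := nome_ne_zero ((τ : ℂ) / 2)
  have h3 : nome (-(z + τ)) * nome τ = nome (-z) := by rw [← nome_add]; ring_nf
  rw [thetaProd, thetaProd, h1, h3, h2, nome_add]
  simp only [neg_div, add_div, nome_neg, nome_add, sub_eq_add_neg]
  rw [nome_half_sq z, nome_half_sq τ]
  field_simp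
  ring

lemma differentiable_poch_mul_nome (τ : ℍ) {x : ℂ → ℂ} (hx : Differentiable ℂ x) :
    Differentiable ℂ fun z ↦ poch (x z * nome τ) (nome τ) :=
  differentiableOn_univ.1 (differentiableOn_poch isOpen_univ (by fun_prop) (by fun_prop)
    fun _ _ ↦ norm_nome_lt_one τ)

lemma differentiable_thetaProd (τ : ℍ) : Differentiable ℂ fun z ↦ thetaProd z τ := by
  have h1 := differentiable_poch_mul_nome τ (x := nome) (by fun_prop)
  have h2 := differentiable_poch_mul_nome τ (x := fun z ↦ nome (-z)) (by fun_prop)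
  unfold thetaProd
  exact ((by fun_prop : Differentiable ℂ fun z : ℂ ↦ nome (z / 2) - nome (-z / 2)).mul h1).mul h2

lemma mem_lattice_of_thetaProd_eq_zero {z : ℂ} {τ : ℍ} (h : thetaProd z τ = 0) :
    z ∈ (periodPair τ).lattice := by
  have key (w : ℂ) (h : poch (nome w * nome τ) (nome τ) = 0) : w ∈ (periodPair τ).lattice := by
    by_contra hw
    refine poch_ne_zero (norm_nome_lt_one τ) (fun n hn ↦ hw ?_) h
    rw [← nome_nat_mul, ← nome_add, ← nome_add, nome_eq_one_iff] at hn
    obtain ⟨m, hm⟩ := hn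
    exact mem_periodPair.2 ⟨m, -(n + 1), by push_cast; linear_combination -hm⟩
  rcases mul_eq_zero.1 h with h | h
  · rcases mul_eq_zero.1 h with h | h
    · obtain ⟨m, rfl⟩ := nome_eq_one_iff.1 (nome_eq_one_of_sub_eq_zero h)
      exact mem_periodPair.2 ⟨m, 0, by simp⟩
    · exact key z h
  · simpa using neg_mem (key (-z) h)

lemma thetaProd_zero (τ : ℂ) : thetaProd 0 τ = 0 := by simp [thetaProd]

lemma deriv_thetaProd_ne_zero (τ : ℍ) : deriv (fun z ↦ thetaProd z τ) 0 ≠ 0 := by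
  have h1 := (differentiable_poch_mul_nome τ (x := nome) (by fun_prop)).mul
    (differentiable_poch_mul_nome τ (x := fun z ↦ nome (-z)) (by fun_prop))
  have h2 : HasDerivAt (fun z : ℂ ↦ nome (z / 2) - nome (-z / 2)) (2 * π * I) 0 := by
    have h3 (c : ℂ) : HasDerivAt (fun z : ℂ ↦ nome (z * c)) (2 * π * I * c) 0 := by
      have := (((hasDerivAt_id (0 : ℂ)).mul_const c).const_mul (2 * π * I)).cexp
      simpa [nome] using this
    refine ((h3 (1 / 2)).sub (h3 (-1 / 2))).congr_deriv (by ring) |>.congr_of_eventuallyEq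
      (Eventually.of_forall fun z ↦ ?_)
    simp only [Pi.sub_apply]
    ring_nf
  have h3 := h2.mul (h1 0).hasDerivAt
  have h4 : (fun z ↦ thetaProd z τ) = (fun z : ℂ ↦ nome (z / 2) - nome (-z / 2)) *
      ((fun z ↦ poch (nome z * nome τ) (nome τ)) * fun z ↦ poch (nome (-z) * nome τ) (nome τ)) := by
    funext z; simp only [thetaProd, Pi.mul_apply]; ring
  have h5 : poch (nome τ) (nome τ) ≠ 0 :=
    poch_ne_zero_of_norm_lt (norm_nome_lt_one τ) (norm_nome_lt_one τ)
  rw [h4, h3.deriv]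
  simpa [nome_zero] using h5

/-- The inversion formula of the theta function, up to a factor independent of `z`. -/
lemma exists_thetaProd_inversion {τ σ : ℍ} (h : (σ : ℂ) * τ = -1) : ∃ c : ℂ, c ≠ 0 ∧
    ∀ z, thetaProd (z / τ) σ = c * nome (z ^ 2 / (2 * τ)) * thetaProd z τ := by
  have hτ : (τ : ℂ) ≠ 0 := τ.ne_zero
  have hσ : (σ : ℂ) = -1 / τ := by field_simp; exact h
  have hd := (differentiable_thetaProd σ).fun_comp
    (by fun_prop : Differentiable ℂ fun z : ℂ ↦ z / τ)
  have hA₁ (z : ℂ) : nome (-(z + 1) ^ 2 / (2 * τ)) * thetaProd ((z + 1) / τ) σ =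
      -1 * (nome (-z ^ 2 / (2 * τ)) * thetaProd (z / τ) σ) := by
    have h1 : thetaProd (z / τ) σ = -nome (-(z + 1) / τ - σ / 2) * thetaProd ((z + 1) / τ) σ := by
      have := thetaProd_add_tau ((z + 1) / τ) σ
      rw [neg_div]
      rwa [show (z + 1) / τ + (σ : ℂ) = z / τ by rw [hσ]; ring] at this
    have h2 : nome (-(z + 1) ^ 2 / (2 * τ)) =
        nome (-z ^ 2 / (2 * τ)) * nome (-(z + 1) / τ - σ / 2) := by
      rw [← nome_add, hσ]; congr 1; field_simp; ring
    rw [h1, h2]; ring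
  have hA₂ (z : ℂ) : nome (-(z + τ) ^ 2 / (2 * τ)) * thetaProd ((z + τ) / τ) σ =
      -nome (-z - τ / 2) * (nome (-z ^ 2 / (2 * τ)) * thetaProd (z / τ) σ) := by
    have h1 : (z + τ) / τ = z / τ + 1 := by field_simp
    have h2 : nome (-(z + τ) ^ 2 / (2 * τ)) = nome (-z - τ / 2) * nome (-z ^ 2 / (2 * τ)) := by
      rw [← nome_add]; congr 1; field_simp; ring
    rw [h1, thetaProd_add_one, h2]; ring
  obtain ⟨c, hc⟩ := exists_eq_mul_of_multipliers (τ := τ)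
    (A := fun z ↦ nome (-z ^ 2 / (2 * τ)) * thetaProd (z / τ) σ) (B := fun z ↦ thetaProd z τ)
    (m₁ := fun _ ↦ -1) (m₂ := fun z ↦ -nome (-z - τ / 2))
    ((by fun_prop : Differentiable ℂ fun z : ℂ ↦ nome (-z ^ 2 / (2 * τ))).mul hd)
    (differentiable_thetaProd τ) (by simp) (fun z ↦ neg_ne_zero.2 (nome_ne_zero _))
    hA₁ hA₂ (fun z ↦ by rw [thetaProd_add_one]; ring)
    (fun z ↦ thetaProd_add_tau z τ) (fun z ↦ mem_lattice_of_thetaProd_eq_zero)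
    (by simp [thetaProd_zero]) (thetaProd_zero _) (deriv_thetaProd_ne_zero τ)
  have hc' (z : ℂ) : thetaProd (z / τ) σ = c * nome (z ^ 2 / (2 * τ)) * thetaProd z τ := by
    have h1 := hc z
    simp only [neg_div, nome_neg] at h1
    rw [inv_mul_eq_iff_eq_mul₀ (nome_ne_zero _)] at h1
    rw [h1]; ring
  refine ⟨c, ?_, hc'⟩
  rintro rfl
  refine deriv_thetaProd_ne_zero σ ?_
  have h0 : (fun z ↦ thetaProd z σ) = fun _ ↦ 0 := by
    funext z
    have := hc' (z * τ)
    rwa [mul_div_cancel_right₀ _ hτ, zero_mul, zero_mul] at this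
  rw [h0, deriv_const]

/-! ### Division values of the theta function -/

/-- The theta function at the division point `(a τ + b) / N`, normalized by an exponential factor.
It then depends only on the classes of `a` and `b` modulo `N`, and transforms under `SL(2, ℤ)` with
a factor independent of `a` and `b`, up to roots of unity, which the power `2 N ^ 2` removes. -/
noncomputable def thetaPow (N : ℕ) (a b : ℤ) (τ : ℂ) : ℂ :=
  (nome ((a / N) ^ 2 * τ / 2) * thetaProd (a / N * τ + b / N) τ) ^ (2 * N ^ 2)

lemma even_pow_two_mul (x : ℂ) (n : ℕ) : (-x) ^ (2 * n) = x ^ (2 * n) :=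
  (even_two_mul n).neg_pow x

lemma thetaPow_neg (N : ℕ) (a b : ℤ) (τ : ℂ) : thetaPow N (-a) (-b) τ = thetaPow N a b τ := by
  have h1 : ((-a : ℤ) : ℂ) / N * τ + (-b : ℤ) / N = -(a / N * τ + b / N) := by push_cast; ring
  have h2 : (((-a : ℤ) : ℂ) / N) ^ 2 = (a / N) ^ 2 := by push_cast; ring
  rw [thetaPow, thetaPow, h1, h2, thetaProd_neg, mul_neg, even_pow_two_mul]

lemma nome_pow_eq_one {N : ℕ} {z : ℂ} {n : ℤ} (h : (2 * N ^ 2 : ℂ) * z = n) :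
    nome z ^ (2 * N ^ 2) = 1 := by
  rw [← nome_nat_mul]; push_cast; rw [h, nome_intCast]

lemma thetaPow_add_right_self {N : ℕ} (hN : N ≠ 0) (a b : ℤ) (τ : ℂ) :
    thetaPow N a (b + N) τ = thetaPow N a b τ := by
  have hN' : (N : ℂ) ≠ 0 := by exact_mod_cast hN
  have h1 : (a : ℂ) / N * τ + ((b + N : ℤ) : ℂ) / N = a / N * τ + b / N + 1 := by
    push_cast; field_simp; ring
  rw [thetaPow, h1, thetaProd_add_one, mul_neg, even_pow_two_mul, thetaPow]

lemma thetaPow_add_left_self {N : ℕ} (hN : N ≠ 0) (a b : ℤ) (τ : ℍ) :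
    thetaPow N (a + N) b τ = thetaPow N a b τ := by
  have hN' : (N : ℂ) ≠ 0 := by exact_mod_cast hN
  have h1 : ((a + N : ℤ) : ℂ) / N * τ + (b : ℂ) / N = a / N * τ + b / N + τ := by
    push_cast; field_simp; ring
  have h2 : nome ((((a + N : ℤ) : ℂ) / N) ^ 2 * τ / 2) * nome (-(a / N * τ + b / N) - τ / 2) =
      nome ((a / N) ^ 2 * τ / 2) * nome (-(b / N)) := by
    rw [← nome_add, ← nome_add]; congr 1; push_cast; field_simp; ring
  have h3 : nome (-(b / N) : ℂ) ^ (2 * N ^ 2) = 1 :=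
    nome_pow_eq_one (n := -(2 * N * b)) (by push_cast; field_simp)
  rw [thetaPow, h1, thetaProd_add_tau, neg_mul, mul_neg, even_pow_two_mul, ← mul_assoc, h2,
    mul_right_comm, mul_pow, h3, mul_one, thetaPow]

lemma thetaPow_congr {N : ℕ} (hN : N ≠ 0) {a b a' b' : ℤ} (ha : (N : ℤ) ∣ a' - a)
    (hb : (N : ℤ) ∣ b' - b) (τ : ℍ) : thetaPow N a' b' τ = thetaPow N a b τ := by
  obtain ⟨m, hm⟩ := ha
  obtain ⟨n, hn⟩ := hb
  have h1 : Function.Periodic (fun x : ℤ ↦ thetaPow N x b' τ) N := fun x ↦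
    thetaPow_add_left_self hN x b' τ
  have h2 : Function.Periodic (fun x : ℤ ↦ thetaPow N a x τ) N := fun x ↦
    thetaPow_add_right_self hN a x τ
  have h3 : thetaPow N (a + m * N) b' τ = thetaPow N a b' τ := h1.int_mul m a
  have h4 : thetaPow N a (b + n * N) τ = thetaPow N a b τ := h2.int_mul n b
  rw [← h4, show b + n * N = b' by linarith, ← h3, show a + m * N = a' by linarith]

lemma thetaPow_add_one {N : ℕ} (hN : N ≠ 0) (a b : ℤ) (τ : ℂ) :
    thetaPow N a b (τ + 1) = thetaPow N a (a + b) τ := by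
  have hN' : (N : ℂ) ≠ 0 := by exact_mod_cast hN
  have h1 : (a : ℂ) / N * (τ + 1) + b / N = a / N * τ + ((a + b : ℤ) : ℂ) / N := by
    push_cast; ring
  have h2 : nome ((a / N : ℂ) ^ 2 * (τ + 1) / 2) =
      nome ((a / N) ^ 2 / 2) * nome ((a / N) ^ 2 * τ / 2) := by
    rw [← nome_add]; congr 1; ring
  have h3 : nome ((a / N : ℂ) ^ 2 / 2) ^ (2 * N ^ 2) = 1 :=
    nome_pow_eq_one (n := a ^ 2) (by push_cast; field_simp)
  rw [thetaPow, h1, h2, thetaProd_add_right, mul_assoc, mul_pow, h3, one_mul, thetaPow]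

lemma exists_thetaPow_inversion {N : ℕ} (hN : N ≠ 0) {τ σ : ℍ} (h : (σ : ℂ) * τ = -1) :
    ∃ c : ℂ, c ≠ 0 ∧ ∀ a b, thetaPow N a b σ = c * thetaPow N b (-a) τ := by
  have hN' : (N : ℂ) ≠ 0 := by exact_mod_cast hN
  have hτ : (τ : ℂ) ≠ 0 := τ.ne_zero
  have hσ : (σ : ℂ) = -1 / τ := by field_simp; exact h
  obtain ⟨c, hc, h1⟩ := exists_thetaProd_inversion h
  refine ⟨c ^ (2 * N ^ 2), pow_ne_zero _ hc, fun a b ↦ ?_⟩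
  have h2 : (a : ℂ) / N * σ + b / N = (b / N * τ + ((-a : ℤ) : ℂ) / N) / τ := by
    rw [hσ]; push_cast; field_simp; ring
  have h3 : nome ((a / N : ℂ) ^ 2 * σ / 2) *
      nome ((b / N * τ + ((-a : ℤ) : ℂ) / N) ^ 2 / (2 * τ)) =
      nome (-(a * b) / N ^ 2) * nome ((b / N) ^ 2 * τ / 2) := by
    rw [← nome_add, ← nome_add, hσ]; congr 1; push_cast; field_simp; ring
  have h4 : nome (-(a * b) / N ^ 2 : ℂ) ^ (2 * N ^ 2) = 1 :=
    nome_pow_eq_one (n := -(2 * a * b)) (by push_cast; field_simp)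
  rw [thetaPow, h2, h1, mul_assoc c, mul_left_comm, ← mul_assoc (nome _) (nome _), h3, mul_pow,
    mul_assoc (nome _), mul_pow (nome _), h4, one_mul, thetaPow]

/-- The group `SL(2, ℤ)` permutes the division values, up to a common factor, as it permutes the
row vectors `(a, b)`. -/
lemma exists_thetaPow_smul {N : ℕ} (hN : N ≠ 0) (γ : SL(2, ℤ)) (τ : ℍ) :
    ∃ c : ℂ, c ≠ 0 ∧ ∀ a b : ℤ, thetaPow N a b (γ • τ : ℍ) =
      c * thetaPow N (a * γ 0 0 + b * γ 1 0) (a * γ 0 1 + b * γ 1 1) τ := by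
  have hγ : γ ∈ Subgroup.closure {ModularGroup.S, ModularGroup.T} := by
    rw [SpecialLinearGroup.SL2Z_generators]; trivial
  induction hγ using Subgroup.closure_induction generalizing τ with
  | mem γ hγ =>
    rcases hγ with rfl | rfl
    · obtain ⟨c, hc, h⟩ := exists_thetaPow_inversion hN (τ := τ) (σ := ModularGroup.S • τ) (by
        rw [UpperHalfPlane.modular_S_smul]
        have := τ.ne_zero
        simp [this])
      exact ⟨c, hc, fun a b ↦ by simpa [ModularGroup.S] using h a b⟩
    · refine ⟨1, one_ne_zero, fun a b ↦ ?_⟩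
      have h : ((ModularGroup.T • τ : ℍ) : ℂ) = τ + 1 := by
        rw [UpperHalfPlane.modular_T_smul]; simp [add_comm]
      rw [h, thetaPow_add_one hN]
      simp [ModularGroup.T]
  | one => exact ⟨1, one_ne_zero, fun a b ↦ by simp⟩
  | mul γ δ _ _ h h' =>
    obtain ⟨c, hc, h1⟩ := h (δ • τ)
    obtain ⟨c', hc', h2⟩ := h' τ
    refine ⟨c * c', mul_ne_zero hc hc', fun a b ↦ ?_⟩
    rw [mul_smul, h1, h2, mul_assoc]
    congr 3 <;>
    simp only [Matrix.SpecialLinearGroup.coe_mul, Matrix.mul_apply, Fin.sum_univ_two] <;> ring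
  | inv γ _ h =>
    obtain ⟨c, hc, h1⟩ := h (γ⁻¹ • τ)
    refine ⟨c⁻¹, inv_ne_zero hc, fun a b ↦ ?_⟩
    have hdet := γ.det_coe
    rw [Matrix.det_fin_two] at hdet
    have h2 := h1 (a * γ⁻¹ 0 0 + b * γ⁻¹ 1 0) (a * γ⁻¹ 0 1 + b * γ⁻¹ 1 1)
    rw [smul_inv_smul] at h2
    rw [h2, inv_mul_cancel_left₀ hc]
    congr 1 <;>
    simp [Matrix.SpecialLinearGroup.SL2_inv_expl]
    · linear_combination (-a) * hdet
    · linear_combination (-b) * hdet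

/-- The theta product as a power series in `Q = exp (2 π i τ)`. -/
noncomputable def thetaCoeff (z Q : ℂ) : ℂ :=
  (nome (z / 2) - nome (-z / 2)) * poch (nome z * Q) Q * poch (nome (-z) * Q) Q

lemma thetaProd_eq_thetaCoeff (z τ : ℂ) : thetaProd z τ = thetaCoeff z (nome τ) := rfl

lemma analyticAt_thetaCoeff (z : ℂ) : AnalyticAt ℂ (thetaCoeff z) 0 := by
  have h (x : ℂ) : AnalyticAt ℂ (fun Q ↦ poch (x * Q) Q) 0 :=
    (differentiableOn_poch Metric.isOpen_ball (by fun_prop) (by fun_prop) fun Q hQ ↦ by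
      simpa using hQ).analyticAt (Metric.ball_mem_nhds (0 : ℂ) one_pos)
  exact (analyticAt_const.mul (h _)).mul (h _)

lemma poch_zero_zero : poch 0 0 = 1 := by
  simpa using (isJet_poch_self one_ne_zero).apply_zero

lemma thetaCoeff_zero_ne_zero {z : ℂ} (hz : ∀ n : ℤ, z ≠ n) : thetaCoeff z 0 ≠ 0 := by
  simp only [thetaCoeff, mul_zero, poch_zero_zero, mul_one]
  intro h
  obtain ⟨n, hn⟩ := nome_eq_one_iff.1 (nome_eq_one_of_sub_eq_zero h)
  exact hz n hn

/-! ### Modular units of level five -/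

/-- At the division points `r τ` of the lattice `ℤ + ℤ N τ`, the theta product collects the factors
`1 - q ^ n` with `n` congruent to `r` or `-r` modulo `N`. -/
lemma thetaProd_nat_mul {N r : ℕ} (hr : r ≤ N) (hN : 0 < N) (τ : ℍ) :
    thetaProd (r * τ) (N * τ) = -nome (-(r * τ / 2)) *
      (poch (nome τ ^ r) (nome τ ^ N) * poch (nome τ ^ (N - r)) (nome τ ^ N)) := by
  have hq : ‖nome τ ^ N‖ < 1 := norm_pow_succ_lt_one (norm_nome_lt_one τ) hN.ne'
  have h1 := poch_eq_mul (nome τ ^ r) hq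
  have h2 : nome (-(r * τ)) * nome τ ^ N = nome τ ^ (N - r) := by
    rw [nome_neg, nome_nat_mul, inv_mul_eq_iff_eq_mul₀ (pow_ne_zero _ (nome_ne_zero _)), ← pow_add,
      Nat.add_sub_cancel' hr]
  have h3 : nome τ ^ r = nome (r * τ / 2) ^ 2 := by rw [← nome_nat_mul, ← nome_half_sq]
  have h4 := nome_ne_zero (r * τ / 2)
  rw [thetaProd, nome_nat_mul N, h2, nome_nat_mul r, h1, neg_div, nome_neg, h3]
  field_simp
  ring

lemma thetaPow_nat_mul {N r : ℕ} (hr : r ≤ N) (hN : 0 < N) (τ : ℍ) :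
    thetaPow N r 0 (N * τ) = (nome ((r * (r - N) / (2 * N)) * τ) *
      (poch (nome τ ^ r) (nome τ ^ N) * poch (nome τ ^ (N - r)) (nome τ ^ N))) ^ (2 * N ^ 2) := by
  have hN' : (N : ℂ) ≠ 0 := by exact_mod_cast hN.ne'
  have h1 : ((r : ℤ) : ℂ) / N * (N * τ) + ((0 : ℤ) : ℂ) / N = r * τ := by
    push_cast; field_simp; ring
  have h2 : nome ((((r : ℤ) : ℂ) / N) ^ 2 * (N * τ) / 2) * nome (-(r * τ / 2)) =
      nome ((r * (r - N) / (2 * N)) * τ) := by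
    rw [← nome_add]; congr 1; push_cast; field_simp; ring
  rw [thetaPow, h1, thetaProd_nat_mul hr hN, neg_mul, mul_neg, even_pow_two_mul, ← mul_assoc, h2]

/-- In level five, `t` is a quotient of division values of the theta function for `ℤ + ℤ 5 τ`. -/
lemma thetaPow_div_pow_five (τ : ℍ) :
    (thetaPow 5 1 0 ((5 : ℕ) * τ) / thetaPow 5 2 0 ((5 : ℕ) * τ)) ^ 5 = tFive τ ^ 50 := by
  have h1 := thetaPow_nat_mul (N := 5) (r := 1) (by norm_num) (by norm_num) τ
  have h2 := thetaPow_nat_mul (N := 5) (r := 2) (by norm_num) (by norm_num) τ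
  have h3 : nome (((1 : ℕ) * ((1 : ℕ) - (5 : ℕ)) / (2 * (5 : ℕ))) * τ) =
      nome (((2 : ℕ) * ((2 : ℕ) - (5 : ℕ)) / (2 * (5 : ℕ))) * τ) * nome (τ / 5) := by
    rw [← nome_add]; congr 1; push_cast; ring
  have h4 : nome τ = nome (τ / 5) ^ 5 := by
    rw [← nome_nat_mul]; congr 1; push_cast; ring
  have h5 := nome_ne_zero (((2 : ℕ) * ((2 : ℕ) - (5 : ℕ)) / (2 * (5 : ℕ))) * τ)
  norm_num only [Nat.cast_ofNat, Nat.cast_one] at h1 h2 h3 h5 ⊢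
  rw [h1, h2, h3, ← div_pow, mul_assoc, mul_div_mul_left _ _ h5, tFive_eq, tFiveCoeff, ← nome_eq,
    mul_pow (nome τ)]
  have h6 : nome τ ^ 50 = nome (τ / 5) ^ 250 := by rw [h4]; ring
  rw [h6]
  ring

lemma tFive_pow_smul {γ γ' : SL(2, ℤ)} {g d : ℕ} {b : ℤ} (h : IsFactorization 5 γ γ' g d b)
    (hg : 0 < g) (hd : 0 < d) (τ : ℍ) : tFive (γ • τ : ℍ) ^ 50 =
      (thetaPow 5 (γ' 0 0) (γ' 0 1) (affineMap hg hd b τ) /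
        thetaPow 5 (2 * γ' 0 0) (2 * γ' 0 1) (affineMap hg hd b τ)) ^ 5 := by
  obtain ⟨c, hc, h1⟩ := exists_thetaPow_smul (N := 5) (by norm_num) γ' (affineMap hg hd b τ)
  rw [← thetaPow_div_pow_five, h.smul_eq hg hd, h1, h1, mul_div_mul_left _ _ hc]
  simp

/-- For `5 ∣ C` one has `diag(5, 1) γ = γ' diag(5, 1)`. -/
lemma exists_isFactorization_five {γ : SL(2, ℤ)} (h : 5 ∣ γ 1 0) :
    ∃ γ' : SL(2, ℤ), IsFactorization 5 γ γ' 5 1 0 ∧ γ' 0 0 = γ 0 0 ∧ 5 ∣ γ' 0 1 := by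
  obtain ⟨z, hz⟩ := h
  have hdet := γ.det_coe
  rw [Matrix.det_fin_two] at hdet
  refine ⟨⟨!![γ 0 0, 5 * γ 0 1; z, γ 1 1], ?_⟩, ⟨?_, ?_, ?_, ?_⟩, rfl, ⟨γ 0 1, rfl⟩⟩
  · rw [Matrix.det_fin_two_of]; linear_combination hdet + γ 0 1 * hz
  all_goals simp [hz, mul_comm]

lemma thetaPow_five_congr {a a' b' : ℤ} (ha : 5 ∣ a' - a ∨ 5 ∣ a' + a) (hb : 5 ∣ b') (τ : ℍ) :
    thetaPow 5 a' b' τ = thetaPow 5 a 0 τ := by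
  rcases ha with ha | ha
  · exact thetaPow_congr (by norm_num) (by exact_mod_cast ha) (by simpa using hb) τ
  · rw [← thetaPow_neg]
    exact thetaPow_congr (by norm_num) (by push_cast; rw [← dvd_neg]; simpa [add_comm] using ha)
      (by simpa using hb) τ

lemma tFive_pow_smul_of_dvd {γ : SL(2, ℤ)} (h : 5 ∣ γ 1 0) (h0 : 5 ∣ γ 0 0 - 1 ∨ 5 ∣ γ 0 0 + 1)
    (τ : ℍ) : tFive (γ • τ : ℍ) ^ 50 = tFive τ ^ 50 := by
  obtain ⟨γ', h1, h2, h3⟩ := exists_isFactorization_five h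
  have h4 : (affineMap (by norm_num : 0 < 5) one_pos 0 τ : ℂ) = (5 : ℕ) * τ := by simp
  rw [tFive_pow_smul h1 (by norm_num) one_pos, h2,
    thetaPow_five_congr (a := 1) h0 h3, thetaPow_five_congr (a := 2) (by lia) (h3.mul_left 2),
    h4, thetaPow_div_pow_five]

/-- The elements of `Γ₀(5)` with upper left entry `±2` modulo `5` exchange the two division values,
and so invert `t`. -/
lemma tFive_pow_smul_of_dvd' {γ : SL(2, ℤ)} (h : 5 ∣ γ 1 0) (h0 : 5 ∣ γ 0 0 - 2 ∨ 5 ∣ γ 0 0 + 2)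
    (τ : ℍ) : tFive (γ • τ : ℍ) ^ 50 = (tFive τ ^ 50)⁻¹ := by
  obtain ⟨γ', h1, h2, h3⟩ := exists_isFactorization_five h
  have h4 : (affineMap (by norm_num : 0 < 5) one_pos 0 τ : ℂ) = (5 : ℕ) * τ := by simp
  rw [tFive_pow_smul h1 (by norm_num) one_pos, h2,
    thetaPow_five_congr (a := 2) h0 h3, thetaPow_five_congr (a := 1) (by lia) (h3.mul_left 2),
    h4, ← thetaPow_div_pow_five, ← inv_pow, inv_div]

/-- At the cusps `γ ∞` with `5 ∤ C` the function `t` takes a finite nonzero value. -/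
lemma exists_hasExpansion_tFive_pow_smul {γ : SL(2, ℤ)} (h : ¬ 5 ∣ γ 1 0) :
    ∃ A, HasExpansion 5 0 A (fun τ ↦ tFive (γ • τ : ℍ) ^ 50) ∧ A 0 ≠ 0 := by
  have hg : 1 = Int.gcd (γ 1 0) (5 : ℕ) := by
    have h1 : IsCoprime (5 : ℤ) (γ 1 0) :=
      (Int.prime_iff_natAbs_prime.2 (by norm_num)).coprime_iff_not_dvd.2 h
    exact (Int.isCoprime_iff_gcd_eq_one.1 h1.symm).symm
  obtain ⟨γ', b, h1⟩ := exists_isFactorization γ (m := 5) (g := 1) (d := 5) (by norm_num) hg rfl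
  set r := γ' 0 1 with hr
  have h5 : 5 ∣ γ' 0 0 := ⟨γ 0 0, by have := h1.apply_zero_zero; push_cast at this; linarith⟩
  have hr5 : ¬ 5 ∣ r := by
    intro h2
    have hdet := γ'.det_coe
    rw [Matrix.det_fin_two] at hdet
    have h3 : (5 : ℤ) ∣ 1 := by
      rw [← hdet]; exact dvd_sub (h5.mul_right _) (h2.mul_right _)
    norm_num at h3
  set ζ := Complex.exp (2 * π * I * b / (5 : ℕ)) with hζ
  have hcoeff (s : ℤ) (hs : ¬ 5 ∣ s) : thetaCoeff (s / 5) 0 ≠ 0 := by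
    refine thetaCoeff_zero_ne_zero fun n hn ↦ hs ⟨n, ?_⟩
    rw [div_eq_iff (by norm_num)] at hn
    have : s = n * 5 := by exact_mod_cast hn
    linarith
  have hana (z : ℂ) : AnalyticAt ℂ (fun w ↦ thetaCoeff z (ζ * w)) 0 := by
    have h2 : AnalyticAt ℂ (thetaCoeff z) (ζ * 0) := by
      rw [mul_zero]; exact analyticAt_thetaCoeff z
    exact h2.comp (f := fun w ↦ ζ * w) (by fun_prop)
  have h2r : ¬ 5 ∣ 2 * r := by lia
  have hval (s s' : ℤ) (hs : 5 ∣ s') (τ : ℍ) :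
      thetaPow 5 s' s (affineMap one_pos (by norm_num : 0 < 5) b τ) =
        thetaCoeff (s / 5) (ζ * 𝕢 (5 : ℕ) τ) ^ 50 := by
    have h2 := qParam_affineMap one_pos (by norm_num : 0 < 5) b (W := 5) (n := 1) (by norm_num)
      rfl τ
    rw [← nome_eq] at h2
    rw [thetaPow_congr (a := 0) (b := s) (by norm_num) (by simpa using hs) (by simp), thetaPow,
      thetaProd_eq_thetaCoeff, h2]
    simp [nome_zero, hζ]
  refine ⟨fun w ↦ (thetaCoeff (r / 5) (ζ * w) ^ 50 / thetaCoeff ((2 * r : ℤ) / 5) (ζ * w) ^ 50) ^ 5,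
    ⟨(((hana _).pow 50).div ((hana _).pow 50) ?_).pow 5, Eventually.of_forall fun τ ↦ ?_⟩, ?_⟩
  · change thetaCoeff _ (ζ * 0) ^ 50 ≠ 0
    rw [mul_zero]; exact pow_ne_zero _ (hcoeff _ h2r)
  · simp only
    rw [tFive_pow_smul h1 one_pos (by norm_num), hval _ _ h5, hval _ _ (h5.mul_left 2)]
    simp [hr]
  · simp only [mul_zero]
    exact pow_ne_zero _ (div_ne_zero (pow_ne_zero _ (hcoeff _ hr5)) (pow_ne_zero _ (hcoeff _ h2r)))

lemma mdifferentiable_comp_qParam {A : ℂ → ℂ} (hA : DifferentiableOn ℂ A (Metric.ball 0 1)) :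
    MDiff fun τ : ℍ ↦ A (𝕢 1 τ) := by
  rw [UpperHalfPlane.mdifferentiable_iff]
  have h1 : DifferentiableOn ℂ (fun z : ℂ ↦ A (nome z)) {z : ℂ | 0 < z.im} :=
    hA.comp differentiable_nome.differentiableOn fun z hz ↦ by
      simpa using norm_nome_lt_one ⟨z, hz⟩
  refine h1.congr fun z hz ↦ ?_
  simp [ofComplex_apply_of_im_pos hz, nome_eq]

lemma differentiableOn_tFiveCoeff : DifferentiableOn ℂ tFiveCoeff (Metric.ball 0 1) := by
  have h (r : ℕ) := differentiableOn_poch_pow r 5 (by norm_num)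
  exact (((h 1).mul (h 4)).div ((h 2).mul (h 3)) fun q hq ↦ by
    have hq : ‖q‖ < 1 := by simpa using hq
    exact mul_ne_zero (poch_residue_ne_zero hq (by norm_num))
      (poch_residue_ne_zero hq (by norm_num))).pow 5

lemma differentiableOn_fFiveCoeff : DifferentiableOn ℂ fFiveCoeff (Metric.ball 0 1) := by
  have h (r : ℕ) := differentiableOn_poch_pow r 5 (by norm_num)
  exact (((h 5).pow 2).mul (((h 1).mul (h 4)).zpow (Or.inl fun q hq ↦ by
    have hq : ‖q‖ < 1 := by simpa using hq
    exact mul_ne_zero (poch_residue_ne_zero hq (by norm_num))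
      (poch_residue_ne_zero hq (by norm_num))))).mul (((h 2).mul (h 3)).pow 2)

lemma tFiveCoeff_ne_zero {q : ℂ} (hq : ‖q‖ < 1) : tFiveCoeff q ≠ 0 := by
  have h {r : ℕ} (hr : r ≠ 0) := poch_residue_ne_zero hq hr
  exact pow_ne_zero _ (div_ne_zero (mul_ne_zero (h (by norm_num)) (h (by norm_num)))
    (mul_ne_zero (h (by norm_num)) (h (by norm_num))))

lemma tFive_ne_zero (τ : ℍ) : tFive τ ≠ 0 := by
  rw [tFive_eq]
  exact mul_ne_zero (Function.Periodic.qParam_ne_zero _) (tFiveCoeff_ne_zero (norm_qParam_lt_one τ))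

lemma mdifferentiable_tFive : MDiff fun τ : ℍ ↦ tFive τ := by
  simp only [tFive_eq]
  exact mdifferentiable_comp_qParam (A := fun q ↦ q * tFiveCoeff q)
    (differentiableOn_id.mul differentiableOn_tFiveCoeff)

lemma mdifferentiable_fFive : MDiff fun τ : ℍ ↦ fFive τ := by
  simp only [fFive_eq]
  exact mdifferentiable_comp_qParam differentiableOn_fFiveCoeff

lemma isJet_tFiveCoeff : IsJet tFiveCoeff (-5) 5 := by
  have h5 : (5 : ℕ) ≠ 0 := by norm_num
  have h := (((isJet_poch_one_of_two_le (b := 5) (by norm_num)).mul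
    (isJet_poch_pow_of_three_le (a := 4) (by norm_num) h5)).div
    ((isJet_poch_two h5).mul (isJet_poch_pow_of_three_le (a := 3) (by norm_num) h5))).zpow 5
  exact (h.coeff_congr (by norm_num) (by norm_num)).congr
    (Eventually.of_forall fun q ↦ by simp only [tFiveCoeff, zpow_ofNat])

lemma isJet_fFiveCoeff : IsJet fFiveCoeff 3 (-1) := by
  have h5 : (5 : ℕ) ≠ 0 := by norm_num
  have h := (((isJet_poch_pow_of_three_le (a := 5) (by norm_num) h5).zpow 2).mul
    (((isJet_poch_one_of_two_le (b := 5) (by norm_num)).mul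
    (isJet_poch_pow_of_three_le (a := 4) (by norm_num) h5)).zpow (-3))).mul
    (((isJet_poch_two h5).mul (isJet_poch_pow_of_three_le (a := 3) (by norm_num) h5)).zpow 2)
  exact (h.coeff_congr (by norm_num) (by norm_num)).congr
    (Eventually.of_forall fun q ↦ by simp only [fFiveCoeff, zpow_ofNat])

lemma hasExpansion_tFive : HasExpansion 1 1 tFiveCoeff (fun τ ↦ tFive τ) :=
  ⟨isJet_tFiveCoeff.analyticAt, Eventually.of_forall fun τ ↦ by simp [tFive_eq]⟩

lemma hasExpansion_fFive : HasExpansion 1 0 fFiveCoeff (fun τ ↦ fFive τ) :=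
  ⟨isJet_fFiveCoeff.analyticAt, Eventually.of_forall fun τ ↦ by simp [fFive_eq]⟩

/-- The order of `t` at the cusp `γ ∞` in level five: there is one cusp of `Γ₁(5)` where `t` has a
zero, one where it has a pole, and at the remaining two it is finite and nonzero. -/
def orderFive (γ : SL(2, ℤ)) : ℤ :=
  if 5 ∣ γ 1 0 then if 5 ∣ γ 0 0 - 1 ∨ 5 ∣ γ 0 0 + 1 then 1 else -1 else 0

lemma width_five_of_dvd {γ : SL(2, ℤ)} (h : 5 ∣ γ 1 0) :
    Int.gcd (γ 1 0) (5 : ℕ) = 5 ∧ width 5 γ = 1 := by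
  have h1 : Int.gcd (γ 1 0) (5 : ℕ) = 5 := by
    simpa using Int.gcd_eq_natAbs_right (a := γ 1 0) (b := 5) h
  exact ⟨h1, by rw [width, h1]; rfl⟩

lemma width_five_of_not_dvd {γ : SL(2, ℤ)} (h : ¬ 5 ∣ γ 1 0) :
    Int.gcd (γ 1 0) (5 : ℕ) = 1 ∧ width 5 γ = 5 := by
  have h1 : Int.gcd (γ 1 0) (5 : ℕ) = 1 := by
    have h1 : IsCoprime (5 : ℤ) (γ 1 0) :=
      (Int.prime_iff_natAbs_prime.2 (by norm_num)).coprime_iff_not_dvd.2 h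
    exact Int.isCoprime_iff_gcd_eq_one.1 h1.symm
  exact ⟨h1, by rw [width, h1]; rfl⟩

lemma not_dvd_of_dvd {γ : SL(2, ℤ)} (h : 5 ∣ γ 1 0) : ¬ 5 ∣ γ 0 0 := by
  intro h2
  have hdet := γ.det_coe
  rw [Matrix.det_fin_two] at hdet
  have h3 : (5 : ℤ) ∣ 1 := by
    rw [← hdet]; exact dvd_sub (h2.mul_right _) (h.mul_left _)
  norm_num at h3

/-- The power `t ^ 50` is computed from the division values of the theta function, and `t` inherits
the property as a holomorphic root. -/
lemma isModularUnit_tFive :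
    IsModularUnit (CongruenceSubgroup.Gamma1 5) (width 5) 0 orderFive (fun τ ↦ tFive τ) := by
  have hslash (γ : SL(2, ℤ)) (τ : ℍ) : ((fun τ : ℍ ↦ tFive τ ^ 50) ∣[((50 : ℕ) : ℤ) * 0] γ) τ =
      tFive (γ • τ : ℍ) ^ 50 := by
    rw [ModularForm.SL_slash_apply]; simp
  refine .root (width_pos (by norm_num)) (n := 50) (by norm_num) mdifferentiable_tFive
    ⟨mdifferentiable_zpow mdifferentiable_tFive tFive_ne_zero 50,
      fun τ ↦ pow_ne_zero _ (tFive_ne_zero τ), ⟨1, one_ne_zero, fun γ hγ ↦ ⟨1, one_pow _,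
        fun τ ↦ ?_⟩⟩, fun γ ↦ ?_⟩
  · rw [CongruenceSubgroup.Gamma1_mem] at hγ
    have h1 : 5 ∣ γ 1 0 := (ZMod.intCast_zmod_eq_zero_iff_dvd _ 5).1 hγ.2.2
    have h2 : 5 ∣ γ 0 0 - 1 := (ZMod.intCast_zmod_eq_zero_iff_dvd _ 5).1 (by simp [hγ.1])
    rw [hslash, tFive_pow_smul_of_dvd h1 (Or.inl h2), one_mul]
  · have h50 : HasExpansion 1 50 (fun q ↦ tFiveCoeff q ^ 50) (fun τ ↦ tFive τ ^ 50) :=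
      ⟨isJet_tFiveCoeff.analyticAt.pow 50, Eventually.of_forall fun τ ↦ by
        simp only [tFive_eq, mul_pow, Nat.cast_one]; rfl⟩
    have h50' : tFiveCoeff 0 ^ 50 ≠ 0 := pow_ne_zero _ (tFiveCoeff_ne_zero (by simp))
    by_cases h : 5 ∣ γ 1 0
    · rw [(width_five_of_dvd h).2, orderFive, if_pos h]
      by_cases h0 : 5 ∣ γ 0 0 - 1 ∨ 5 ∣ γ 0 0 + 1
      · rw [if_pos h0]
        exact ⟨_, h50.congr (Eventually.of_forall fun τ ↦ by
          rw [hslash, tFive_pow_smul_of_dvd h h0]), h50'⟩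
      · rw [if_neg h0]
        have h1 := not_dvd_of_dvd h
        exact ⟨_, (h50.inv h50').congr (Eventually.of_forall fun τ ↦ by
          rw [hslash, tFive_pow_smul_of_dvd' h (by lia)]), inv_ne_zero h50'⟩
    · rw [(width_five_of_not_dvd h).2, orderFive, if_neg h]
      obtain ⟨A, hA, hA0⟩ := exists_hasExpansion_tFive_pow_smul h
      exact ⟨A, hA.congr (Eventually.of_forall fun τ ↦ by rw [hslash]), hA0⟩

lemma IsModularUnit.of_le {Γ Γ' : Subgroup SL(2, ℤ)} {W : SL(2, ℤ) → ℕ} {k : ℤ}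
    {o : SL(2, ℤ) → ℤ} {G : ℍ → ℂ} (h : IsModularUnit Γ W k o G) (hΓ : Γ' ≤ Γ) :
    IsModularUnit Γ' W k o G := by
  obtain ⟨h1, h2, ⟨n, hn, h3⟩, h4⟩ := h
  exact ⟨h1, h2, ⟨n, hn, fun γ hγ ↦ h3 γ (hΓ hγ)⟩, h4⟩

lemma divisors_five : Nat.divisors 5 = {1, 5} := by decide

/-- The square of `f` is the quotient of `η(5 τ) ^ 5 / η(τ)` by `t`. -/
lemma fFive_sq (τ : ℍ) : fFive τ ^ 2 =
    etaQuotient 5 (fun | 1 => -1 | 5 => 5 | _ => 0) τ / tFive τ := by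
  have hq := norm_qParam_lt_one τ
  have h24 : 𝕢 24 τ ^ 24 = 𝕢 1 τ := by
    rw [Function.Periodic.qParam, Function.Periodic.qParam, ← Complex.exp_nat_mul]
    congr 1; push_cast; ring
  have h0 := Function.Periodic.qParam_ne_zero (h := 24) (τ : ℂ)
  have h {r : ℕ} (hr : r ≠ 0) := poch_residue_ne_zero hq hr
  rw [eq_div_iff (tFive_ne_zero τ), etaQuotient, divisors_five,
    Finset.prod_pair (by norm_num), etaMul_eq, etaMul_eq, fFive_eq, tFive_eq]
  simp only [pow_one]
  rw [poch_self_eq_prod hq, fFiveCoeff, tFiveCoeff]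
  have h1 := h (r := 1) (by norm_num)
  have h2 := h (r := 2) (by norm_num)
  have h3 := h (r := 3) (by norm_num)
  have h4 := h (r := 4) (by norm_num)
  have h5 := h (r := 5) (by norm_num)
  generalize poch (𝕢 1 τ ^ 1) (𝕢 1 τ ^ 5) = A₁ at *
  generalize poch (𝕢 1 τ ^ 2) (𝕢 1 τ ^ 5) = A₂ at *
  generalize poch (𝕢 1 τ ^ 3) (𝕢 1 τ ^ 5) = A₃ at *
  generalize poch (𝕢 1 τ ^ 4) (𝕢 1 τ ^ 5) = A₄ at *
  generalize poch (𝕢 1 τ ^ 5) (𝕢 1 τ ^ 5) = A₅ at *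
  rw [← h24]
  simp only [zpow_neg, zpow_ofNat]
  field_simp

lemma isModularUnit_fFive : IsModularUnit (CongruenceSubgroup.Gamma1 5) (width 5) 1
    (fun γ ↦ if orderFive γ = -1 then 1 else 0) (fun τ ↦ fFive τ) := by
  have h1 : IsEtaData 5 (fun | 1 => -1 | 5 => 5 | _ => 0) 2 := ⟨by decide, by decide, by decide⟩
  have h2 := ((h1.isModularUnit (by norm_num)).of_le
    (CongruenceSubgroup.Gamma1_in_Gamma0 5)).div isModularUnit_tFive
  refine .root (width_pos (by norm_num)) (n := 2) (by norm_num) mdifferentiable_fFive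
    (h2.congr (fun γ ↦ ?_) (by norm_num) fFive_sq)
  by_cases h : 5 ∣ γ 1 0
  · rw [(width_five_of_dvd h).1, orderFive, if_pos h]
    split_ifs <;> first | rfl | simp_all
  · rw [(width_five_of_not_dvd h).1, orderFive, if_neg h]
    rfl

instance : (CongruenceSubgroup.Gamma1 5).FiniteIndex :=
  (CongruenceSubgroup.Gamma1_is_congruence 5).finiteIndex

open SporadicCase in
lemma isModularSystem_case11 : IsModularSystem case11.a case11.b case11.c
    (fun τ ↦ case11.t τ) (fun τ ↦ case11.f τ) := by
  have h1 : IsEtaData 5 (fun | 1 => 5 | 5 => -1 | _ => 0) 2 := ⟨by decide, by decide, by decide⟩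
  have h2 := (h1.isModularUnit (by norm_num)).of_le (CongruenceSubgroup.Gamma1_in_Gamma0 5)
  have jE := isJet_etaCoeff' 5 (fun | 1 => 5 | 5 => -1 | _ => 0)
  have e1 : jetOne 5 (fun | 1 => 5 | 5 => -1 | _ => 0) = -5 := by decide
  have e2 : jetTwo 5 (fun | 1 => 5 | 5 => -1 | _ => 0) = -15 := by decide
  rw [e1, e2] at jE
  refine .of_isModularUnit (width_pos (by norm_num)) isModularUnit_tFive h2 isModularUnit_fFive
    (fun γ ↦ ?_) hasExpansion_tFive isJet_tFiveCoeff
    (hasExpansion_etaQuotient (n := 0) (by decide)) jE hasExpansion_fFive isJet_fFiveCoeff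
    ?_ ?_ ?_ ?_
  · beta_reduce
    by_cases h : 5 ∣ γ 1 0
    · rw [(width_five_of_dvd h).1, orderFive, if_pos h]
      have h5 : etaOrder 5 (fun | 1 => 5 | 5 => -1 | _ => 0) 5 = 0 := by decide
      rw [h5]
      split_ifs <;> simp_all
    · rw [(width_five_of_not_dvd h).1, orderFive, if_neg h]
      have h5 : etaOrder 5 (fun | 1 => 5 | 5 => -1 | _ => 0) 1 = 1 := by decide
      rw [h5]
      simp
  all_goals norm_num [SporadicCase.a, SporadicCase.b, SporadicCase.c]

/-! ### The operators `θ_x` and `θ_y` -/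

section Theta

variable {Φ Ψ : ℂ × ℂ → ℂ} {p : ℂ × ℂ}

lemma hasDerivAt_fst (hΦ : AnalyticAt ℂ Φ p) :
    HasDerivAt (fun z ↦ Φ (z, p.2)) (fderiv ℂ Φ p (1, 0)) p.1 :=
  hΦ.differentiableAt.hasFDerivAt.comp_hasDerivAt (f := fun z ↦ (z, p.2)) p.1
    ((hasDerivAt_id p.1).prodMk (hasDerivAt_const p.1 p.2))

lemma hasDerivAt_snd (hΦ : AnalyticAt ℂ Φ p) :
    HasDerivAt (fun z ↦ Φ (p.1, z)) (fderiv ℂ Φ p (0, 1)) p.2 :=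
  hΦ.differentiableAt.hasFDerivAt.comp_hasDerivAt (f := fun z ↦ (p.1, z)) p.2
    ((hasDerivAt_const p.2 p.1).prodMk (hasDerivAt_id p.2))

lemma thetaX_eq (hΦ : AnalyticAt ℂ Φ p) : thetaX Φ p = p.1 * fderiv ℂ Φ p (1, 0) := by
  rw [thetaX, (hasDerivAt_fst hΦ).deriv]

lemma thetaY_eq (hΦ : AnalyticAt ℂ Φ p) : thetaY Φ p = p.2 * fderiv ℂ Φ p (0, 1) := by
  rw [thetaY, (hasDerivAt_snd hΦ).deriv]

lemma thetaX_eventuallyEq (hΦ : AnalyticAt ℂ Φ p) :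
    thetaX Φ =ᶠ[𝓝 p] fun r ↦ r.1 * fderiv ℂ Φ r (1, 0) :=
  hΦ.eventually_analyticAt.mono fun _ h ↦ thetaX_eq h

lemma thetaY_eventuallyEq (hΦ : AnalyticAt ℂ Φ p) :
    thetaY Φ =ᶠ[𝓝 p] fun r ↦ r.2 * fderiv ℂ Φ r (0, 1) :=
  hΦ.eventually_analyticAt.mono fun _ h ↦ thetaY_eq h

lemma analyticAt_fderiv_apply (hΦ : AnalyticAt ℂ Φ p) (v : ℂ × ℂ) :
    AnalyticAt ℂ (fun r ↦ fderiv ℂ Φ r v) p :=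
  ((ContinuousLinearMap.apply ℂ ℂ v).analyticAt _).comp hΦ.fderiv

lemma analyticAt_thetaX (hΦ : AnalyticAt ℂ Φ p) : AnalyticAt ℂ (thetaX Φ) p :=
  (analyticAt_fst.mul (analyticAt_fderiv_apply hΦ _)).congr (thetaX_eventuallyEq hΦ).symm

lemma analyticAt_thetaY (hΦ : AnalyticAt ℂ Φ p) : AnalyticAt ℂ (thetaY Φ) p :=
  (analyticAt_snd.mul (analyticAt_fderiv_apply hΦ _)).congr (thetaY_eventuallyEq hΦ).symm

lemma fderiv_fderiv_apply (hΦ : AnalyticAt ℂ Φ p) (v w : ℂ × ℂ) :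
    fderiv ℂ (fun r ↦ fderiv ℂ Φ r v) p w = fderiv ℂ (fderiv ℂ Φ) p w v := by
  have := ((ContinuousLinearMap.apply ℂ ℂ v).hasFDerivAt.comp p
    hΦ.fderiv.differentiableAt.hasFDerivAt).fderiv
  exact DFunLike.congr_fun this w

/-- The operators `θ_x` and `θ_y` commute. -/
lemma thetaX_thetaY (hΦ : AnalyticAt ℂ Φ p) : thetaX (thetaY Φ) p = thetaY (thetaX Φ) p := by
  have hsymm : IsSymmSndFDerivAt ℂ Φ p :=
    (hΦ.contDiffAt (n := 2)).isSymmSndFDerivAt (by simp)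
  have h1 : fderiv ℂ (thetaY Φ) p (1, 0) = p.2 * fderiv ℂ (fderiv ℂ Φ) p (1, 0) (0, 1) := by
    rw [(thetaY_eventuallyEq hΦ).fderiv_eq, fderiv_fun_mul differentiableAt_snd
      (analyticAt_fderiv_apply hΦ _).differentiableAt, ← fderiv_fderiv_apply hΦ]
    simp [fderiv_snd]
  have h2 : fderiv ℂ (thetaX Φ) p (0, 1) = p.1 * fderiv ℂ (fderiv ℂ Φ) p (0, 1) (1, 0) := by
    rw [(thetaX_eventuallyEq hΦ).fderiv_eq, fderiv_fun_mul differentiableAt_fst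
      (analyticAt_fderiv_apply hΦ _).differentiableAt, ← fderiv_fderiv_apply hΦ]
    simp [fderiv_fst]
  rw [thetaX_eq (analyticAt_thetaY hΦ), thetaY_eq (analyticAt_thetaX hΦ), h1, h2,
    hsymm (1, 0) (0, 1)]
  ring

lemma thetaX_add (hΦ : AnalyticAt ℂ Φ p) (hΨ : AnalyticAt ℂ Ψ p) :
    thetaX (fun r ↦ Φ r + Ψ r) p = thetaX Φ p + thetaX Ψ p := by
  rw [thetaX, ((hasDerivAt_fst hΦ).fun_add (hasDerivAt_fst hΨ)).deriv, thetaX_eq hΦ, thetaX_eq hΨ]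
  ring

lemma thetaX_mul (hΦ : AnalyticAt ℂ Φ p) (hΨ : AnalyticAt ℂ Ψ p) :
    thetaX (fun r ↦ Φ r * Ψ r) p = thetaX Φ p * Ψ p + Φ p * thetaX Ψ p := by
  rw [thetaX, ((hasDerivAt_fst hΦ).fun_mul (hasDerivAt_fst hΨ)).deriv, thetaX_eq hΦ, thetaX_eq hΨ]
  ring

lemma thetaY_add (hΦ : AnalyticAt ℂ Φ p) (hΨ : AnalyticAt ℂ Ψ p) :
    thetaY (fun r ↦ Φ r + Ψ r) p = thetaY Φ p + thetaY Ψ p := by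
  rw [thetaY, ((hasDerivAt_snd hΦ).fun_add (hasDerivAt_snd hΨ)).deriv, thetaY_eq hΦ, thetaY_eq hΨ]
  ring

lemma thetaY_mul (hΦ : AnalyticAt ℂ Φ p) (hΨ : AnalyticAt ℂ Ψ p) :
    thetaY (fun r ↦ Φ r * Ψ r) p = thetaY Φ p * Ψ p + Φ p * thetaY Ψ p := by
  rw [thetaY, ((hasDerivAt_snd hΦ).fun_mul (hasDerivAt_snd hΨ)).deriv, thetaY_eq hΦ, thetaY_eq hΨ]
  ring

lemma thetaX_comp_snd (g : ℂ → ℂ) : thetaX (fun r ↦ g r.2) p = 0 := by simp [thetaX]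

lemma thetaY_const (k : ℂ) : thetaY (fun _ ↦ k) p = 0 := by simp [thetaY]

/-- The first equation in expanded form. -/
lemma pdeOne_eq (a b c : ℂ) (hΦ : AnalyticAt ℂ Φ p) :
    pdeOne a b c Φ p = (1 - a * p.1 + c * p.1 ^ 2 + 4 * c * p.1 ^ 2 * p.2) * thetaX (thetaX Φ) p +
      (-2 + c * p.1 ^ 2 * (2 - 8 * p.2)) * thetaX (thetaY Φ) p +
      (-a * p.1 + 2 * c * p.1 ^ 2 + 4 * c * p.1 ^ 2 * p.2) * thetaX Φ p +
      c * p.1 ^ 2 * (2 - 8 * p.2) * thetaY Φ p + (-b * p.1 + c * p.1 ^ 2) * Φ p := by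
  have hX := analyticAt_thetaX hΦ
  have hY := analyticAt_thetaY hΦ
  have h1 : thetaX (fun r ↦ thetaX Φ r - 2 * thetaY Φ r) p =
      thetaX (thetaX Φ) p - 2 * thetaX (thetaY Φ) p := by
    simp only [sub_eq_add_neg, ← neg_mul]
    rw [thetaX_add hX (analyticAt_const.fun_mul hY), thetaX_mul analyticAt_const hY,
      thetaX_comp_snd fun _ ↦ -2]
    ring
  have h2 : thetaX (fun r ↦ 4 * r.2 * thetaX Φ r + (2 - 8 * r.2) * thetaY Φ r) p =
      4 * p.2 * thetaX (thetaX Φ) p + (2 - 8 * p.2) * thetaX (thetaY Φ) p := by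
    have h3 : AnalyticAt ℂ (fun r : ℂ × ℂ ↦ 4 * r.2) p := analyticAt_const.mul analyticAt_snd
    have h4 : AnalyticAt ℂ (fun r : ℂ × ℂ ↦ 2 - 8 * r.2) p :=
      analyticAt_const.sub (analyticAt_const.mul analyticAt_snd)
    rw [thetaX_add (h3.fun_mul hX) (h4.fun_mul hY), thetaX_mul h3 hX, thetaX_mul h4 hY,
      thetaX_comp_snd fun y ↦ 4 * y, thetaX_comp_snd fun y ↦ 2 - 8 * y]
    ring
  rw [pdeOne, h1, h2, thetaX_add hX hΦ]
  ring

/-- The second equation in expanded form. -/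
lemma pdeTwo_eq (hΦ : AnalyticAt ℂ Φ p) :
    pdeTwo Φ p = -p.2 * thetaX (thetaX Φ) p + 4 * p.2 * thetaX (thetaY Φ) p +
      (1 - 4 * p.2) * thetaY (thetaY Φ) p + p.2 * thetaX Φ p - 2 * p.2 * thetaY Φ p := by
  have hX := analyticAt_thetaX hΦ
  have hY := analyticAt_thetaY hΦ
  have h1 : thetaX (fun r ↦ 2 * thetaY Φ r - thetaX Φ r) p =
      2 * thetaX (thetaY Φ) p - thetaX (thetaX Φ) p := by
    simp only [sub_eq_add_neg, ← neg_one_mul (thetaX Φ _)]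
    rw [thetaX_add (analyticAt_const.fun_mul hY) (analyticAt_const.fun_mul hX),
      thetaX_mul analyticAt_const hY, thetaX_mul analyticAt_const hX,
      thetaX_comp_snd fun _ ↦ 2, thetaX_comp_snd fun _ ↦ -1]
    ring
  have h2 : thetaY (fun r ↦ 2 * thetaY Φ r - thetaX Φ r) p =
      2 * thetaY (thetaY Φ) p - thetaX (thetaY Φ) p := by
    simp only [sub_eq_add_neg, ← neg_one_mul (thetaX Φ _)]
    rw [thetaY_add (analyticAt_const.fun_mul hY) (analyticAt_const.fun_mul hX),
      thetaY_mul analyticAt_const hY, thetaY_mul analyticAt_const hX, thetaY_const, thetaY_const,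
      thetaX_thetaY hΦ]
    ring
  rw [pdeTwo, h1, h2]
  ring

lemma analyticAt_pdeOne (a b c : ℂ) (hΦ : AnalyticAt ℂ Φ p) : AnalyticAt ℂ (pdeOne a b c Φ) p := by
  have h1 := analyticAt_thetaX hΦ
  have h2 := analyticAt_thetaY hΦ
  have h3 := analyticAt_thetaX h1
  have h4 := analyticAt_thetaX h2
  have h : pdeOne a b c Φ =ᶠ[𝓝 p] _ :=
    hΦ.eventually_analyticAt.mono fun _ h ↦ pdeOne_eq a b c h
  have hx : AnalyticAt ℂ (fun r : ℂ × ℂ ↦ r.1) p := analyticAt_fst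
  have hy : AnalyticAt ℂ (fun r : ℂ × ℂ ↦ r.2) p := analyticAt_snd
  refine AnalyticAt.congr ?_ h.symm
  fun_prop

lemma analyticAt_pdeTwo (hΦ : AnalyticAt ℂ Φ p) : AnalyticAt ℂ (pdeTwo Φ) p := by
  have h1 := analyticAt_thetaX hΦ
  have h2 := analyticAt_thetaY hΦ
  have h3 := analyticAt_thetaX h1
  have h4 := analyticAt_thetaX h2
  have h5 := analyticAt_thetaY h2
  have h : pdeTwo Φ =ᶠ[𝓝 p] _ := hΦ.eventually_analyticAt.mono fun _ h ↦ pdeTwo_eq h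
  have hx : AnalyticAt ℂ (fun r : ℂ × ℂ ↦ r.1) p := analyticAt_fst
  have hy : AnalyticAt ℂ (fun r : ℂ × ℂ ↦ r.2) p := analyticAt_snd
  refine AnalyticAt.congr ?_ h.symm
  fun_prop

/-- The chain rule along a curve, in terms of logarithmic derivatives. -/
lemma hasDerivAt_comp_curve {X Y : ℂ → ℂ} {z k ξ υ : ℂ} (hX : HasDerivAt X (k * (X z * ξ)) z)
    (hY : HasDerivAt Y (k * (Y z * υ)) z) (hΦ : AnalyticAt ℂ Φ (X z, Y z)) :
    HasDerivAt (fun z ↦ Φ (X z, Y z))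
      (k * (ξ * thetaX Φ (X z, Y z) + υ * thetaY Φ (X z, Y z))) z := by
  refine (hΦ.differentiableAt.hasFDerivAt.comp_hasDerivAt (f := fun z ↦ (X z, Y z)) z
    (hX.prodMk hY)).congr_deriv ?_
  have h1 : ((k * (X z * ξ), k * (Y z * υ)) : ℂ × ℂ) =
      (k * (X z * ξ)) • (1, 0) + (k * (Y z * υ)) • (0, 1) := by simp
  rw [h1, map_add, map_smul, map_smul, thetaX_eq hΦ, thetaY_eq hΦ]
  simp only [smul_eq_mul]
  ring

end Theta

/-! ### The coordinates as rational functions of `t₁` and `t₂` -/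

section Rational

variable (a b c : ℂ)

/-- The quadratic polynomial `1 - a u + c u ^ 2`. -/
def quad (u : ℂ) : ℂ := 1 - a * u + c * u ^ 2

/-- The numerator of `x`, for `t₁ = u` and `t₂ = v`. -/
def numer (u v : ℂ) : ℂ := (u + v) * (1 + c * u * v) - 2 * a * u * v

/-- The function `x`, for `t₁ = u` and `t₂ = v`. -/
noncomputable def fnX (u v : ℂ) : ℂ := numer a c u v / (1 - c * u * v) ^ 2

/-- The function `y`, for `t₁ = u` and `t₂ = v`. -/
noncomputable def fnY (u v : ℂ) : ℂ := u * v * quad a c u * quad a c v / numer a c u v ^ 2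

/-- The factor of the logarithmic derivative of `x` which is linear in `u`. -/
def xiFactor (u v : ℂ) : ℂ :=
  1 - 2 * a * v + 3 * c * v ^ 2 + c * u * (3 * v - 2 * a * v ^ 2 + c * v ^ 3)

/-- The logarithmic derivative of `x` with respect to the derivation `u (1 - a u + c u²) ∂/∂u`. -/
noncomputable def xi (u v : ℂ) : ℂ :=
  quad a c u * u * xiFactor a c u v / (numer a c u v * (1 - c * u * v))

/-- The logarithmic derivative of `y` with respect to the derivation `u (1 - a u + c u²) ∂/∂u`. -/
noncomputable def upsilon (u v : ℂ) : ℂ :=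
  -(u - v) * (1 - c * u * v) * (1 - c * u ^ 2) / numer a c u v

/-- The derivative of `numer` with respect to `u`. -/
def numerDeriv (u v : ℂ) : ℂ := 1 + c * u * v + (u + v) * (c * v) - 2 * a * v

/-- The derivative of `xi` with respect to `u`. -/
noncomputable def xiDeriv (u v : ℂ) : ℂ :=
  (((-a + 2 * c * u) * u * xiFactor a c u v + quad a c u * xiFactor a c u v +
      quad a c u * u * (c * (3 * v - 2 * a * v ^ 2 + c * v ^ 3))) *
      (numer a c u v * (1 - c * u * v)) -
    quad a c u * u * xiFactor a c u v *
      (numerDeriv a c u v * (1 - c * u * v) + numer a c u v * (-c * v))) /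
    (numer a c u v * (1 - c * u * v)) ^ 2

/-- The derivative of `upsilon` with respect to `u`. -/
noncomputable def upsilonDeriv (u v : ℂ) : ℂ :=
  ((-(1 - c * u * v) * (1 - c * u ^ 2) + (u - v) * (c * v) * (1 - c * u ^ 2) +
      (u - v) * (1 - c * u * v) * (2 * c * u)) * numer a c u v -
    -(u - v) * (1 - c * u * v) * (1 - c * u ^ 2) * numerDeriv a c u v) / numer a c u v ^ 2

lemma numer_comm (u v : ℂ) : numer a c u v = numer a c v u := by
  unfold numer; ring

lemma fnX_comm (u v : ℂ) : fnX a c u v = fnX a c v u := by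
  rw [fnX, fnX, numer_comm, mul_right_comm]

lemma fnY_comm (u v : ℂ) : fnY a c u v = fnY a c v u := by
  rw [fnY, fnY, numer_comm]; ring

variable {a b c} {u v : ℂ}

section Deriv

lemma hasDerivAt_quad : HasDerivAt (quad a c) (-a + 2 * c * u) u := by
  have h : HasDerivAt (quad a c) (0 - a * 1 + c * ((2 : ℕ) * u ^ 1)) u :=
    ((hasDerivAt_const u (1 : ℂ)).sub ((hasDerivAt_id u).const_mul a)).add
      ((hasDerivAt_pow 2 u).const_mul c)
  exact h.congr_deriv (by push_cast; ring)

lemma hasDerivAt_numer : HasDerivAt (numer a c · v) (numerDeriv a c u v) u := by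
  have h : HasDerivAt (numer a c · v)
      ((1 : ℂ) * (1 + c * u * v) + (u + v) * (c * 1 * v) - 2 * a * 1 * v) u :=
    (((hasDerivAt_id u).add_const v).mul
      ((((hasDerivAt_id u).const_mul c).mul_const v).const_add 1)).sub
      (((hasDerivAt_id u).const_mul (2 * a)).mul_const v)
  exact h.congr_deriv (by unfold numerDeriv; ring)

lemma hasDerivAt_one_sub : HasDerivAt (fun u ↦ 1 - c * u * v) (-c * v) u := by
  have h : HasDerivAt (fun u ↦ 1 - c * u * v) (-(c * 1 * v)) u :=
    (((hasDerivAt_id u).const_mul c).mul_const v).const_sub 1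
  exact h.congr_deriv (by ring)

lemma hasDerivAt_xiFactor :
    HasDerivAt (xiFactor a c · v) (c * (3 * v - 2 * a * v ^ 2 + c * v ^ 3)) u := by
  have h : HasDerivAt (xiFactor a c · v) (c * 1 * (3 * v - 2 * a * v ^ 2 + c * v ^ 3)) u :=
    (((hasDerivAt_id u).const_mul c).mul_const _).const_add _
  exact h.congr_deriv (by ring)

variable (hN : numer a c u v ≠ 0) (hm : 1 - c * u * v ≠ 0)
include hN hm

lemma hasDerivAt_xi : HasDerivAt (xi a c · v) (xiDeriv a c u v) u := by
  have h : HasDerivAt (xi a c · v) _ u :=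
    ((hasDerivAt_quad.mul (hasDerivAt_id u)).mul hasDerivAt_xiFactor).div
      (hasDerivAt_numer.mul hasDerivAt_one_sub) (mul_ne_zero hN hm)
  refine h.congr_deriv ?_
  rw [xiDeriv]
  simp only [Pi.mul_apply, id]
  ring

omit hm in
lemma hasDerivAt_upsilon : HasDerivAt (upsilon a c · v) (upsilonDeriv a c u v) u := by
  have h : HasDerivAt (upsilon a c · v) _ u :=
    ((((hasDerivAt_id u).sub_const v).neg.mul hasDerivAt_one_sub).mul
      (((hasDerivAt_pow 2 u).const_mul c).const_sub 1)).div hasDerivAt_numer hN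
  refine h.congr_deriv ?_
  rw [upsilonDeriv]
  simp only [Pi.mul_apply, Pi.neg_apply, id]
  push_cast
  ring

lemma hasDerivAt_fnX {t : ℂ → ℂ} {k z : ℂ} (hu : t z = u)
    (ht : HasDerivAt t (k * (u * quad a c u)) z) :
    HasDerivAt (fun z ↦ fnX a c (t z) v) (k * (fnX a c u v * xi a c u v)) z := by
  subst hu
  have h : HasDerivAt (fnX a c · v) _ (t z) :=
    hasDerivAt_numer.div (hasDerivAt_one_sub.fun_pow 2) (pow_ne_zero 2 hm)
  refine (h.comp z ht).congr_deriv ?_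
  have key : numerDeriv a c (t z) v * (1 - c * t z * v) + 2 * c * v * numer a c (t z) v =
      xiFactor a c (t z) v := by
    unfold numerDeriv numer xiFactor; ring
  rw [fnX, xi, ← key]
  field_simp
  ring

omit hm in
lemma hasDerivAt_fnY {t : ℂ → ℂ} {k z : ℂ} (hu : t z = u)
    (ht : HasDerivAt t (k * (u * quad a c u)) z) :
    HasDerivAt (fun z ↦ fnY a c (t z) v) (k * (fnY a c u v * upsilon a c u v)) z := by
  subst hu
  have h : HasDerivAt (fnY a c · v) _ (t z) :=
    ((((hasDerivAt_id (t z)).mul_const v).mul hasDerivAt_quad).mul_const (quad a c v)).div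
      (hasDerivAt_numer.fun_pow 2) (pow_ne_zero 2 hN)
  refine (h.comp z ht).congr_deriv ?_
  have key : (quad a c (t z) + t z * (-a + 2 * c * t z)) * numer a c (t z) v -
      2 * t z * quad a c (t z) * numerDeriv a c (t z) v =
      -(t z - v) * (1 - c * t z * v) * (1 - c * t z ^ 2) := by
    unfold numerDeriv numer quad; ring
  rw [fnY, upsilon, ← key]
  simp only [Pi.mul_apply, id]
  field_simp
  push_cast
  ring

end Deriv

/-! ### The second order equation in one variable -/

/-- The algebraic core of the system. The variables `φ`, `φx`, … stand for the values of `Φ`,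
`θ_x Φ`, … at `(x, y)`. The left side collects the terms of the second order equation in `τ₁`
satisfied by `F = Φ(x, y)`, and the right side is a combination of the expanded forms of the two
equations of the system. -/
lemma coeff_identity (hu : u ≠ 0) (hN : numer a c u v ≠ 0) (hm : 1 - c * u * v ≠ 0)
    (φ φx φy φxx φxy φyy : ℂ) :
    xi a c u v ^ 2 * φxx + 2 * xi a c u v * upsilon a c u v * φxy + upsilon a c u v ^ 2 * φyy +
      (u * quad a c u * xiDeriv a c u v + 2 * c * u * v * quad a c u / (1 - c * u * v) *
        xi a c u v) * φx +
      (u * quad a c u * upsilonDeriv a c u v + 2 * c * u * v * quad a c u / (1 - c * u * v) *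
        upsilon a c u v) * φy -
      (-c * v * u * quad a c u * (1 - 2 * a * u + 3 * c * u ^ 2) / (1 - c * u * v) -
        2 * c ^ 2 * u ^ 2 * v ^ 2 * quad a c u ^ 2 / (1 - c * u * v) ^ 2 +
        quad a c u * u * (b - c * u)) * φ =
    u * quad a c u / fnX a c u v *
      ((1 - a * fnX a c u v + c * fnX a c u v ^ 2 + 4 * c * fnX a c u v ^ 2 * fnY a c u v) * φxx +
      (-2 + c * fnX a c u v ^ 2 * (2 - 8 * fnY a c u v)) * φxy +
      (-a * fnX a c u v + 2 * c * fnX a c u v ^ 2 + 4 * c * fnX a c u v ^ 2 * fnY a c u v) * φx +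
      c * fnX a c u v ^ 2 * (2 - 8 * fnY a c u v) * φy +
      (-b * fnX a c u v + c * fnX a c u v ^ 2) * φ) +
    (1 - c * u ^ 2) ^ 2 *
      (-fnY a c u v * φxx + 4 * fnY a c u v * φxy + (1 - 4 * fnY a c u v) * φyy +
        fnY a c u v * φx - 2 * fnY a c u v * φy) := by
  have e1 : xi a c u v ^ 2 = u * quad a c u / fnX a c u v *
      (1 - a * fnX a c u v + c * fnX a c u v ^ 2 + 4 * c * fnX a c u v ^ 2 * fnY a c u v) +
      (1 - c * u ^ 2) ^ 2 * -fnY a c u v := by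
    rw [xi, fnX, fnY]
    generalize hm' : 1 - c * u * v = m at hm ⊢
    field_simp
    subst hm'
    unfold xiFactor numer quad
    ring
  have e2 : 2 * xi a c u v * upsilon a c u v = u * quad a c u / fnX a c u v *
      (-2 + c * fnX a c u v ^ 2 * (2 - 8 * fnY a c u v)) +
      (1 - c * u ^ 2) ^ 2 * (4 * fnY a c u v) := by
    rw [xi, upsilon, fnX, fnY]
    generalize hm' : 1 - c * u * v = m at hm ⊢
    field_simp
    subst hm'
    unfold xiFactor numer quad
    ring
  have e3 : upsilon a c u v ^ 2 = (1 - c * u ^ 2) ^ 2 * (1 - 4 * fnY a c u v) := by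
    rw [upsilon, fnY]
    field_simp
    unfold numer quad
    ring
  have e4 : u * quad a c u * xiDeriv a c u v + 2 * c * u * v * quad a c u / (1 - c * u * v) *
      xi a c u v = u * quad a c u / fnX a c u v *
      (-a * fnX a c u v + 2 * c * fnX a c u v ^ 2 + 4 * c * fnX a c u v ^ 2 * fnY a c u v) +
      (1 - c * u ^ 2) ^ 2 * fnY a c u v := by
    rw [xi, xiDeriv, fnX, fnY]
    generalize hm' : 1 - c * u * v = m at hm ⊢
    field_simp
    subst hm'
    unfold xiFactor numerDeriv numer quad
    ring
  have e5 : u * quad a c u * upsilonDeriv a c u v + 2 * c * u * v * quad a c u /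
      (1 - c * u * v) * upsilon a c u v = u * quad a c u / fnX a c u v *
      (c * fnX a c u v ^ 2 * (2 - 8 * fnY a c u v)) +
      (1 - c * u ^ 2) ^ 2 * (-2 * fnY a c u v) := by
    rw [upsilon, upsilonDeriv, fnX, fnY]
    generalize hm' : 1 - c * u * v = m at hm ⊢
    field_simp
    subst hm'
    unfold numerDeriv numer quad
    ring
  have e6 : -(-c * v * u * quad a c u * (1 - 2 * a * u + 3 * c * u ^ 2) / (1 - c * u * v) -
        2 * c ^ 2 * u ^ 2 * v ^ 2 * quad a c u ^ 2 / (1 - c * u * v) ^ 2 +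
        quad a c u * u * (b - c * u)) = u * quad a c u / fnX a c u v *
      (-b * fnX a c u v + c * fnX a c u v ^ 2) := by
    rw [fnX]
    generalize hm' : 1 - c * u * v = m at hm ⊢
    field_simp
    subst hm'
    unfold numer quad
    ring
  linear_combination φxx * e1 + φxy * e2 + φyy * e3 + φx * e4 + φy * e5 + φ * e6

end Rational

/-- The differential system of a sporadic case as a first order system on the upper half-plane,
where `h` is the logarithmic derivative of `f` divided by `f`. -/
structure IsFirstOrderSystem (a b c : ℂ) (t f h : ℂ → ℂ) : Prop where
  t_ne_zero : ∀ z : ℂ, 0 < z.im → t z ≠ 0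
  f_ne_zero : ∀ z : ℂ, 0 < z.im → f z ≠ 0
  quad_ne_zero : ∀ z : ℂ, 0 < z.im → quad a c (t z) ≠ 0
  hasDerivAt_t : ∀ z : ℂ, 0 < z.im →
    HasDerivAt t (2 * π * I * f z ^ 2 * (t z * quad a c (t z))) z
  hasDerivAt_f : ∀ z : ℂ, 0 < z.im → HasDerivAt f (2 * π * I * f z ^ 2 * h z) z
  hasDerivAt_h : ∀ z : ℂ, 0 < z.im →
    HasDerivAt h (2 * π * I * f z ^ 2 * (f z * quad a c (t z) * t z * (b - c * t z))) z

lemma IsModularSystem.exists_isFirstOrderSystem {a b c : ℂ} {t f : ℂ → ℂ}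
    (S : IsModularSystem a b c (fun τ ↦ t τ) (fun τ ↦ f τ)) :
    ∃ h, IsFirstOrderSystem a b c t f h := by
  have ht := S.mdiff_t
  have hf := S.mdiff_f
  have hfi := mdifferentiable_inv hf S.f_ne_zero
  have hev {g : ℂ → ℂ} {z : ℂ} (hz : 0 < z.im) :
      (fun τ : ℍ ↦ g τ) ∘ ofComplex =ᶠ[𝓝 z] g := by
    filter_upwards [isOpen_upperHalfPlaneSet.mem_nhds hz] with y hy
    simp [ofComplex_apply_of_im_pos hy]
  refine ⟨fun z ↦ -(D (fun τ : ℍ ↦ (f τ)⁻¹) (ofComplex z)), fun z hz ↦ S.t_ne_zero ⟨z, hz⟩,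
    fun z hz ↦ S.f_ne_zero ⟨z, hz⟩, fun z hz ↦ S.quadratic_ne_zero ⟨z, hz⟩, fun z hz ↦ ?_,
    fun z hz ↦ ?_, fun z hz ↦ ?_⟩
  · have h1 := (hasDerivAt_comp_ofComplex ht ⟨z, hz⟩).congr_of_eventuallyEq (hev hz).symm
    refine h1.congr_deriv ?_
    rw [S.deriv_t, quad]
    ring
  · have h1 := (hasDerivAt_comp_ofComplex hfi ⟨z, hz⟩).congr_of_eventuallyEq
      (hev (g := fun z ↦ (f z)⁻¹) hz).symm
    have hfz : f z ≠ 0 := S.f_ne_zero ⟨z, hz⟩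
    have h2 : HasDerivAt (fun z ↦ ((f z)⁻¹)⁻¹) _ z := h1.inv (inv_ne_zero hfz)
    simp only [inv_inv] at h2
    refine h2.congr_deriv ?_
    rw [ofComplex_apply_of_im_pos hz]
    simp
    ring
  · have h1 : HasDerivAt (fun z ↦ -(D (fun τ : ℍ ↦ (f τ)⁻¹) (ofComplex z))) _ z :=
      (hasDerivAt_comp_ofComplex (mdifferentiable_deriv hfi) ⟨z, hz⟩).neg
    refine h1.congr_deriv ?_
    rw [S.deriv_deriv_inv_f, quad]
    ring

namespace IsFirstOrderSystem

variable {a b c : ℂ} {t f h : ℂ → ℂ} (S : IsFirstOrderSystem a b c t f h)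
include S

/-- For fixed `τ₂`, the second order equation in `τ₁` satisfied by `F` is a combination of the two
equations of the system. Here `v` and `w` are the values of `t` and `f` at `τ₂`. -/
lemma combination_eq_zero {z : ℂ} (hz : 0 < z.im) {v w : ℂ} (hN : numer a c (t z) v ≠ 0)
    (hm : 1 - c * t z * v ≠ 0) {Φ : ℂ × ℂ → ℂ}
    (hΦ : AnalyticAt ℂ Φ (fnX a c (t z) v, fnY a c (t z) v))
    (hG : ∀ᶠ y in 𝓝 z, (1 - c * t y * v) * f y * w = Φ (fnX a c (t y) v, fnY a c (t y) v)) :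
    t z * quad a c (t z) / fnX a c (t z) v *
        pdeOne a b c Φ (fnX a c (t z) v, fnY a c (t z) v) +
      (1 - c * t z ^ 2) ^ 2 * pdeTwo Φ (fnX a c (t z) v, fnY a c (t z) v) = 0 := by
  set X : ℂ → ℂ := fun y ↦ fnX a c (t y) v with hXdef
  set Y : ℂ → ℂ := fun y ↦ fnY a c (t y) v with hYdef
  have hk {y : ℂ} (hy : 0 < y.im) : 2 * π * I * f y ^ 2 ≠ 0 :=
    mul_ne_zero Complex.two_pi_I_ne_zero (pow_ne_zero 2 (S.f_ne_zero y hy))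
  have ht := S.hasDerivAt_t z hz
  have dX {y : ℂ} (hy : 0 < y.im) (hN : numer a c (t y) v ≠ 0) (hm : 1 - c * t y * v ≠ 0) :=
    hasDerivAt_fnX hN hm rfl (S.hasDerivAt_t y hy)
  have dY {y : ℂ} (hy : 0 < y.im) (hN : numer a c (t y) v ≠ 0) :=
    hasDerivAt_fnY hN rfl (S.hasDerivAt_t y hy)
  have dm {y : ℂ} (hy : 0 < y.im) : HasDerivAt (fun y ↦ 1 - c * t y * v) _ y :=
    hasDerivAt_one_sub.comp y (S.hasDerivAt_t y hy)
  -- the first order equation holds in a neighbourhood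
  have hN' : ∀ᶠ y in 𝓝 z, numer a c (t y) v ≠ 0 :=
    (hasDerivAt_numer.comp z ht).continuousAt.eventually_ne hN
  have hm' : ∀ᶠ y in 𝓝 z, 1 - c * t y * v ≠ 0 := (dm hz).continuousAt.eventually_ne hm
  have hXY : ContinuousAt (fun y ↦ (X y, Y y)) z :=
    (dX hz hN hm).continuousAt.prodMk (dY hz hN).continuousAt
  have E1 : (fun y ↦ (-c * v * (t y * quad a c (t y)) * f y + (1 - c * t y * v) * h y) * w) =ᶠ[𝓝 z]
      fun y ↦ xi a c (t y) v * thetaX Φ (X y, Y y) + upsilon a c (t y) v * thetaY Φ (X y, Y y) := by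
    filter_upwards [isOpen_upperHalfPlaneSet.mem_nhds hz, hN', hm',
      hXY.eventually hΦ.eventually_analyticAt, hG.eventually_nhds] with y hy hNy hmy hΦy hGy
    have hy' : 0 < y.im := hy
    have h1 := hasDerivAt_comp_curve (dX hy' hNy hmy) (dY hy' hNy) hΦy
    have h2 : HasDerivAt (fun y ↦ (1 - c * t y * v) * f y * w) _ y :=
      ((dm hy').mul (S.hasDerivAt_f y hy')).mul_const w
    have h3 := h2.unique (h1.congr_of_eventuallyEq hGy)
    refine mul_left_cancel₀ (hk hy') (Eq.trans ?_ h3)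
    ring
  -- its derivative
  have dL : HasDerivAt
      (fun y ↦ (-c * v * (t y * quad a c (t y)) * f y + (1 - c * t y * v) * h y) * w) _ z :=
    (((((ht.mul (hasDerivAt_quad.comp z ht)).const_mul (-c * v)).mul (S.hasDerivAt_f z hz)).add
      ((dm hz).mul (S.hasDerivAt_h z hz))).mul_const w)
  have dR : HasDerivAt (fun y ↦ xi a c (t y) v * thetaX Φ (X y, Y y) +
      upsilon a c (t y) v * thetaY Φ (X y, Y y)) _ z :=
    (((hasDerivAt_xi hN hm).comp z ht).mul
      (hasDerivAt_comp_curve (dX hz hN hm) (dY hz hN) (analyticAt_thetaX hΦ))).add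
    (((hasDerivAt_upsilon hN).comp z ht).mul
      (hasDerivAt_comp_curve (dX hz hN hm) (dY hz hN) (analyticAt_thetaY hΦ)))
  have E2 := dL.unique (dR.congr_of_eventuallyEq E1)
  have E0 := hG.self_of_nhds
  have E1 := E1.self_of_nhds
  have hquad : quad a c (t z) = 1 - a * t z + c * t z ^ 2 := rfl
  rw [pdeOne_eq a b c hΦ, pdeTwo_eq hΦ]
  have id := coeff_identity (b := b) (S.t_ne_zero z hz) hN hm (Φ (X z, Y z))
    (thetaX Φ (X z, Y z)) (thetaY Φ (X z, Y z)) (thetaX (thetaX Φ) (X z, Y z))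
    (thetaX (thetaY Φ) (X z, Y z)) (thetaY (thetaY Φ) (X z, Y z))
  simp only [← thetaX_thetaY hΦ, Function.comp_apply, Pi.mul_apply] at E2
  have E2' : (-c * v * (t z * quad a c (t z) * (1 - 2 * a * t z + 3 * c * t z ^ 2)) * f z -
      2 * c * v * (t z * quad a c (t z)) * h z +
      (1 - c * t z * v) * (f z * quad a c (t z) * t z * (b - c * t z))) * w =
      xiDeriv a c (t z) v * (t z * quad a c (t z)) * thetaX Φ (X z, Y z) +
      xi a c (t z) v * (xi a c (t z) v * thetaX (thetaX Φ) (X z, Y z) +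
        upsilon a c (t z) v * thetaX (thetaY Φ) (X z, Y z)) +
      (upsilonDeriv a c (t z) v * (t z * quad a c (t z)) * thetaY Φ (X z, Y z) +
      upsilon a c (t z) v * (xi a c (t z) v * thetaX (thetaY Φ) (X z, Y z) +
        upsilon a c (t z) v * thetaY (thetaY Φ) (X z, Y z))) := by
    refine mul_left_cancel₀ (hk hz) (Eq.trans (Eq.trans ?_ E2) ?_)
    · have : quad a c (t z) + t z * (-a + 2 * c * t z) = 1 - 2 * a * t z + 3 * c * t z ^ 2 := by
        rw [hquad]; ring
      rw [← this]
      ring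
    · ring
  have hm2 : (1 - c * t z * v) * (1 - c * t z * v)⁻¹ = 1 := mul_inv_cancel₀ hm
  simp only [hXdef, hYdef] at id E1 E2'
  refine Eq.trans ?_ (id.symm.trans ?_)
  · ring
  simp only [div_eq_mul_inv, ← inv_pow]
  generalize (1 - c * t z * v)⁻¹ = n at hm2 ⊢
  linear_combination (-1) * E2' - 2 * c * t z * v * quad a c (t z) * n * E1 + (-c * v * t z *
    quad a c (t z) * (1 - 2 * a * t z + 3 * c * t z ^ 2) * n -
        2 * c ^ 2 * t z ^ 2 * v ^ 2 * quad a c (t z) ^ 2 * n ^ 2 +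
        quad a c (t z) * t z * (b - c * t z)) * E0 +
    (2 * c * t z * v * quad a c (t z) * h z * w + c * v * t z * quad a c (t z) *
      (1 - 2 * a * t z + 3 * c * t z ^ 2) * f z * w +
      2 * c ^ 2 * t z ^ 2 * v ^ 2 * quad a c (t z) ^ 2 * n * f z * w) * hm2

end IsFirstOrderSystem

/-! ### Local coordinates -/

/-- The determinant of the two second order equations in one variable, as combinations of the two
equations of the system; up to a factor without zeros, it is the Jacobian of `x` and `y`. -/
def relationDet (a c u v : ℂ) : ℂ :=
  u * quad a c u * (1 - c * v ^ 2) ^ 2 - v * quad a c v * (1 - c * u ^ 2) ^ 2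

lemma xi_mul_upsilon_sub {a c u v : ℂ} (hN : numer a c u v ≠ 0) (hm : 1 - c * u * v ≠ 0) :
    xi a c u v * upsilon a c v u - xi a c v u * upsilon a c u v =
      relationDet a c u v / numer a c u v := by
  have hm' : 1 - c * v * u = 1 - c * u * v := by ring
  rw [xi, xi, upsilon, upsilon, numer_comm a c v u, hm', relationDet]
  generalize hmm : 1 - c * u * v = m at hm ⊢
  field_simp
  unfold quad xiFactor numer
  ring

/-- For fixed `u`, the locus in `v` where the coordinates degenerate is finite. -/
lemma eventually_nondegenerate {a c u : ℂ} (hu : u ≠ 0) (hq : quad a c u ≠ 0) (v₀ : ℂ) :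
    ∀ᶠ v in 𝓝[≠] v₀, 1 - c * u * v ≠ 0 ∧ numer a c u v ≠ 0 ∧ relationDet a c u v ≠ 0 := by
  open Polynomial in
  let P : ℂ[X] := (1 - C (c * u) * X) *
    ((C u + X) * (1 + C (c * u) * X) - C (2 * a * u) * X) *
    (C (u * quad a c u) * (1 - C c * X ^ 2) ^ 2 -
      X * (1 - C a * X + C c * X ^ 2) * C ((1 - c * u ^ 2) ^ 2))
  have hP (v : ℂ) : P.eval v = (1 - c * u * v) * numer a c u v * relationDet a c u v := by
    simp [P, numer, relationDet, quad]
  have hP0 : P ≠ 0 := by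
    intro h0
    have h1 := hP 0
    rw [h0] at h1
    simp [numer, relationDet, hu, hq] at h1
  have h2 : ∀ᶠ v in 𝓝[≠] v₀, v ∉ ((P.roots.toFinset : Set ℂ) \ {v₀}) := by
    refine nhdsWithin_le_nhds (IsOpen.mem_nhds ?_ (by simp))
    exact (P.roots.toFinset.finite_toSet.subset Set.sdiff_subset).isClosed.isOpen_compl
  filter_upwards [h2, self_mem_nhdsWithin] with v hv hv0
  have h3 : P.eval v ≠ 0 := by
    intro h
    exact hv ⟨by simp [hP0, h], hv0⟩
  rw [hP] at h3
  exact ⟨left_ne_zero_of_mul (left_ne_zero_of_mul h3),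
    right_ne_zero_of_mul (left_ne_zero_of_mul h3), right_ne_zero_of_mul h3⟩

namespace IsFirstOrderSystem

variable {s : SporadicCase} {h : ℂ → ℂ} (S : IsFirstOrderSystem s.a s.b s.c s.t s.f h)

omit S in
lemma x_eq (τ : ℂ × ℂ) : s.x τ = fnX s.a s.c (s.t τ.1) (s.t τ.2) := rfl

omit S in
lemma y_eq (τ : ℂ × ℂ) : s.y τ = fnY s.a s.c (s.t τ.1) (s.t τ.2) := rfl

include S

lemma differentiableAt_t {z : ℂ} (hz : 0 < z.im) : DifferentiableAt ℂ s.t z :=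
  (S.hasDerivAt_t z hz).differentiableAt

lemma analyticAt_t {z : ℂ} (hz : 0 < z.im) : AnalyticAt ℂ s.t z :=
  DifferentiableOn.analyticAt (s := {z | 0 < z.im})
    (fun _ hy ↦ (S.differentiableAt_t hy).differentiableWithinAt)
    (isOpen_upperHalfPlaneSet.mem_nhds hz)

lemma analyticAt_f {z : ℂ} (hz : 0 < z.im) : AnalyticAt ℂ s.f z :=
  DifferentiableOn.analyticAt (s := {z | 0 < z.im})
    (fun y hy ↦ (S.hasDerivAt_f y hy).differentiableAt.differentiableWithinAt)
    (isOpen_upperHalfPlaneSet.mem_nhds hz)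

lemma hasDerivAt_x_fst {τ : ℂ × ℂ} (hτ : τ ∈ s.regularSet) :
    HasDerivAt (fun z ↦ s.x (z, τ.2))
      (2 * π * I * s.f τ.1 ^ 2 * (s.x τ * xi s.a s.c (s.t τ.1) (s.t τ.2))) τ.1 :=
  hasDerivAt_fnX hτ.2.2.2 hτ.2.2.1 rfl (S.hasDerivAt_t _ hτ.1)

lemma hasDerivAt_y_fst {τ : ℂ × ℂ} (hτ : τ ∈ s.regularSet) :
    HasDerivAt (fun z ↦ s.y (z, τ.2))
      (2 * π * I * s.f τ.1 ^ 2 * (s.y τ * upsilon s.a s.c (s.t τ.1) (s.t τ.2))) τ.1 :=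
  hasDerivAt_fnY hτ.2.2.2 rfl (S.hasDerivAt_t _ hτ.1)

omit S in
lemma swap_mem_regularSet {τ : ℂ × ℂ} (hτ : τ ∈ s.regularSet) : τ.swap ∈ s.regularSet := by
  refine ⟨hτ.2.1, hτ.1, ?_, ?_⟩
  · have := hτ.2.2.1
    rwa [mul_right_comm] at this
  · exact (numer_comm s.a s.c (s.t τ.2) (s.t τ.1)).trans_ne hτ.2.2.2

omit S in
lemma x_swap (τ : ℂ × ℂ) : s.x τ.swap = s.x τ := fnX_comm _ _ _ _

omit S in
lemma y_swap (τ : ℂ × ℂ) : s.y τ.swap = s.y τ := fnY_comm _ _ _ _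

lemma hasDerivAt_x_snd {τ : ℂ × ℂ} (hτ : τ ∈ s.regularSet) :
    HasDerivAt (fun z ↦ s.x (τ.1, z))
      (2 * π * I * s.f τ.2 ^ 2 * (s.x τ * xi s.a s.c (s.t τ.2) (s.t τ.1))) τ.2 := by
  have := S.hasDerivAt_x_fst (swap_mem_regularSet hτ)
  rw [x_swap] at this
  exact this.congr_of_eventuallyEq (Eventually.of_forall fun z ↦ x_swap (z, τ.1))

lemma hasDerivAt_y_snd {τ : ℂ × ℂ} (hτ : τ ∈ s.regularSet) :
    HasDerivAt (fun z ↦ s.y (τ.1, z))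
      (2 * π * I * s.f τ.2 ^ 2 * (s.y τ * upsilon s.a s.c (s.t τ.2) (s.t τ.1))) τ.2 := by
  have := S.hasDerivAt_y_fst (swap_mem_regularSet hτ)
  rw [y_swap] at this
  exact this.congr_of_eventuallyEq (Eventually.of_forall fun z ↦ y_swap (z, τ.1))

omit S in
lemma x_ne_zero {τ : ℂ × ℂ} (hτ : τ ∈ s.regularSet) : s.x τ ≠ 0 :=
  div_ne_zero hτ.2.2.2 (pow_ne_zero 2 hτ.2.2.1)

lemma y_ne_zero {τ : ℂ × ℂ} (hτ : τ ∈ s.regularSet) : s.y τ ≠ 0 :=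
  div_ne_zero (mul_ne_zero (mul_ne_zero (mul_ne_zero (S.t_ne_zero _ hτ.1) (S.t_ne_zero _ hτ.2.1))
    (S.quad_ne_zero _ hτ.1)) (S.quad_ne_zero _ hτ.2.1)) (pow_ne_zero 2 hτ.2.2.2)

lemma jacobian_eq {τ : ℂ × ℂ} (hτ : τ ∈ s.regularSet) :
    s.jacobian τ = (2 * π * I * s.f τ.1 ^ 2) * (2 * π * I * s.f τ.2 ^ 2) * s.x τ * s.y τ /
      s.num τ * relationDet s.a s.c (s.t τ.1) (s.t τ.2) := by
  rw [SporadicCase.jacobian, (S.hasDerivAt_x_fst hτ).deriv, (S.hasDerivAt_y_fst hτ).deriv,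
    (S.hasDerivAt_x_snd hτ).deriv, (S.hasDerivAt_y_snd hτ).deriv]
  have := xi_mul_upsilon_sub (a := s.a) hτ.2.2.2 hτ.2.2.1
  have hn : s.num τ = numer s.a s.c (s.t τ.1) (s.t τ.2) := rfl
  rw [hn, div_mul_eq_mul_div, mul_div_assoc, ← this]
  ring

lemma jacobian_ne_zero_iff {τ : ℂ × ℂ} (hτ : τ ∈ s.regularSet) :
    s.jacobian τ ≠ 0 ↔ relationDet s.a s.c (s.t τ.1) (s.t τ.2) ≠ 0 := by
  rw [S.jacobian_eq hτ]
  have h1 := S.f_ne_zero _ hτ.1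
  have h2 := S.f_ne_zero _ hτ.2.1
  have h3 := x_ne_zero hτ
  have h4 := S.y_ne_zero hτ
  have h5 := hτ.2.2.2
  have h6 := Complex.two_pi_I_ne_zero
  refine ⟨right_ne_zero_of_mul, fun h ↦ mul_ne_zero (div_ne_zero ?_ h5) h⟩
  exact mul_ne_zero (mul_ne_zero (mul_ne_zero (mul_ne_zero h6 (pow_ne_zero 2 h1))
    (mul_ne_zero h6 (pow_ne_zero 2 h2))) h3) h4

/-- The coordinate points are dense: varying only `τ₂` suffices. -/
lemma subset_closure_coordinateSet :
    {τ : ℂ × ℂ | 0 < τ.1.im ∧ 0 < τ.2.im} ⊆ closure s.coordinateSet := by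
  rintro ⟨z, w⟩ ⟨hz, hw⟩
  rw [mem_closure_iff_frequently]
  have hz : 0 < z.im := hz
  have hw : 0 < w.im := hw
  have hd := S.hasDerivAt_t w hw
  have hne : 2 * π * I * s.f w ^ 2 * (s.t w * quad s.a s.c (s.t w)) ≠ 0 :=
    mul_ne_zero (mul_ne_zero Complex.two_pi_I_ne_zero (pow_ne_zero 2 (S.f_ne_zero w hw)))
      (mul_ne_zero (S.t_ne_zero w hw) (S.quad_ne_zero w hw))
  have h1 : ∀ᶠ y in 𝓝[≠] w, 1 - s.c * s.t z * s.t y ≠ 0 ∧ numer s.a s.c (s.t z) (s.t y) ≠ 0 ∧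
      relationDet s.a s.c (s.t z) (s.t y) ≠ 0 :=
    (hd.tendsto_nhdsNE hne).eventually
      (eventually_nondegenerate (S.t_ne_zero z hz) (S.quad_ne_zero z hz) (s.t w))
  have h2 : ∀ᶠ y in 𝓝[≠] w, (z, y) ∈ s.coordinateSet := by
    filter_upwards [h1, nhdsWithin_le_nhds (isOpen_upperHalfPlaneSet.mem_nhds hw)] with y hy hy'
    have hr : (z, y) ∈ s.regularSet := ⟨hz, hy', hy.1, hy.2.1⟩
    exact ⟨hr, (S.jacobian_ne_zero_iff hr).2 hy.2.2⟩
  have h3 : Tendsto (fun y : ℂ ↦ (z, y)) (𝓝[≠] w) (𝓝 (z, w)) :=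
    (Continuous.tendsto (by fun_prop) w).mono_left nhdsWithin_le_nhds
  exact h3.frequently h2.frequently

lemma analyticAt_t_fst {τ : ℂ × ℂ} (hτ : τ ∈ s.regularSet) :
    AnalyticAt ℂ (fun σ : ℂ × ℂ ↦ s.t σ.1) τ :=
  (S.analyticAt_t hτ.1).comp analyticAt_fst

lemma analyticAt_t_snd {τ : ℂ × ℂ} (hτ : τ ∈ s.regularSet) :
    AnalyticAt ℂ (fun σ : ℂ × ℂ ↦ s.t σ.2) τ :=
  (S.analyticAt_t hτ.2.1).comp analyticAt_snd

lemma analyticAt_num {τ : ℂ × ℂ} (hτ : τ ∈ s.regularSet) : AnalyticAt ℂ s.num τ := by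
  have h1 := S.analyticAt_t_fst hτ
  have h2 := S.analyticAt_t_snd hτ
  unfold SporadicCase.num
  fun_prop

lemma analyticAt_one_sub {τ : ℂ × ℂ} (hτ : τ ∈ s.regularSet) :
    AnalyticAt ℂ (fun σ : ℂ × ℂ ↦ 1 - s.c * s.t σ.1 * s.t σ.2) τ := by
  have h1 := S.analyticAt_t_fst hτ
  have h2 := S.analyticAt_t_snd hτ
  fun_prop

lemma analyticAt_x {τ : ℂ × ℂ} (hτ : τ ∈ s.regularSet) : AnalyticAt ℂ s.x τ :=
  (S.analyticAt_num hτ).div ((S.analyticAt_one_sub hτ).pow 2) (pow_ne_zero 2 hτ.2.2.1)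

lemma analyticAt_y {τ : ℂ × ℂ} (hτ : τ ∈ s.regularSet) : AnalyticAt ℂ s.y τ := by
  have h1 := S.analyticAt_t_fst hτ
  have h2 := S.analyticAt_t_snd hτ
  refine AnalyticAt.fun_div ?_ ((S.analyticAt_num hτ).pow 2) (pow_ne_zero 2 hτ.2.2.2)
  fun_prop

lemma analyticAt_F {τ : ℂ × ℂ} (hτ : τ ∈ s.regularSet) : AnalyticAt ℂ s.F τ :=
  ((S.analyticAt_one_sub hτ).mul ((S.analyticAt_f hτ.1).comp analyticAt_fst)).mul
    ((S.analyticAt_f hτ.2.1).comp analyticAt_snd)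

lemma regularSet_mem_nhds {τ : ℂ × ℂ} (hτ : τ ∈ s.regularSet) : s.regularSet ∈ 𝓝 τ := by
  filter_upwards [(isOpen_upperHalfPlaneSet.preimage continuous_fst).mem_nhds hτ.1,
    (isOpen_upperHalfPlaneSet.preimage continuous_snd).mem_nhds hτ.2.1,
    (S.analyticAt_one_sub hτ).continuousAt.eventually_ne hτ.2.2.1,
    (S.analyticAt_num hτ).continuousAt.eventually_ne hτ.2.2.2] with σ h1 h2 h3 h4
  exact ⟨h1, h2, h3, h4⟩

lemma analyticAt_coordinates {τ : ℂ × ℂ} (hτ : τ ∈ s.regularSet) :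
    AnalyticAt ℂ (fun σ ↦ (s.x σ, s.y σ)) τ :=
  (S.analyticAt_x hτ).prod (S.analyticAt_y hτ)

lemma coordinateSet_mem_nhds {τ : ℂ × ℂ} (hτ : τ ∈ s.coordinateSet) : s.coordinateSet ∈ 𝓝 τ := by
  have h1 := S.analyticAt_t_fst hτ.1
  have h2 := S.analyticAt_t_snd hτ.1
  have h3 : AnalyticAt ℂ (fun σ : ℂ × ℂ ↦ relationDet s.a s.c (s.t σ.1) (s.t σ.2)) τ := by
    unfold relationDet quad
    fun_prop
  filter_upwards [S.regularSet_mem_nhds hτ.1,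
    h3.continuousAt.eventually_ne ((S.jacobian_ne_zero_iff hτ.1).1 hτ.2)] with σ h4 h5
  exact ⟨h4, (S.jacobian_ne_zero_iff h4).2 h5⟩

/-- The differential of `(x, y)` at a coordinate point is invertible. -/
lemma exists_hasFDerivAt_equiv {τ : ℂ × ℂ} (hτ : τ ∈ s.coordinateSet) :
    ∃ e : (ℂ × ℂ) ≃L[ℂ] ℂ × ℂ, HasFDerivAt (fun σ ↦ (s.x σ, s.y σ)) (e : ℂ × ℂ →L[ℂ] ℂ × ℂ) τ := by
  have hx := S.analyticAt_x hτ.1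
  have hy := S.analyticAt_y hτ.1
  have hd := (S.analyticAt_coordinates hτ.1).differentiableAt.hasFDerivAt
  set L := fderiv ℂ (fun σ ↦ (s.x σ, s.y σ)) τ with hL
  have hL' (v : ℂ × ℂ) : L v = (v.1 * deriv (fun z ↦ s.x (z, τ.2)) τ.1 +
      v.2 * deriv (fun z ↦ s.x (τ.1, z)) τ.2, v.1 * deriv (fun z ↦ s.y (z, τ.2)) τ.1 +
      v.2 * deriv (fun z ↦ s.y (τ.1, z)) τ.2) := by
    rw [hL, DifferentiableAt.fderiv_prodMk hx.differentiableAt hy.differentiableAt,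
      (hasDerivAt_fst hx).deriv, (hasDerivAt_snd hx).deriv, (hasDerivAt_fst hy).deriv,
      (hasDerivAt_snd hy).deriv]
    have h1 : v = v.1 • (1, 0) + v.2 • (0, 1) := by ext <;> simp
    conv_lhs => rw [h1]
    simp only [map_add, map_smul]
    rfl
  have hinj : Function.Injective (L : ℂ × ℂ →ₗ[ℂ] ℂ × ℂ) := by
    rw [injective_iff_map_eq_zero]
    intro v hv
    have hv' : L v = 0 := hv
    rw [hL', Prod.mk_eq_zero] at hv'
    have hJ := hτ.2
    rw [SporadicCase.jacobian] at hJ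
    ext
    · refine (mul_eq_zero.1 ?_).resolve_right hJ
      linear_combination deriv (fun z ↦ s.y (τ.1, z)) τ.2 * hv'.1 -
        deriv (fun z ↦ s.x (τ.1, z)) τ.2 * hv'.2
    · refine (mul_eq_zero.1 ?_).resolve_right hJ
      linear_combination deriv (fun z ↦ s.x (z, τ.2)) τ.1 * hv'.2 -
        deriv (fun z ↦ s.y (z, τ.2)) τ.1 * hv'.1
  refine ⟨(LinearEquiv.ofInjectiveEndo (L : ℂ × ℂ →ₗ[ℂ] ℂ × ℂ) hinj).toContinuousLinearEquiv, ?_⟩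
  exact hd.congr_fderiv (ContinuousLinearMap.ext fun v ↦ rfl)

/-- At coordinate points, `F` is a holomorphic function of `x` and `y` by the inverse function
theorem. -/
lemma exists_isLocalExpression {τ : ℂ × ℂ} (hτ : τ ∈ s.coordinateSet) :
    ∃ Φ, s.IsLocalExpression τ Φ := by
  obtain ⟨e, he⟩ := S.exists_hasFDerivAt_equiv hτ
  have hc : ContDiffAt ℂ ⊤ (fun σ ↦ (s.x σ, s.y σ)) τ := (S.analyticAt_coordinates hτ.1).contDiffAt
  have htop : (⊤ : WithTop ℕ∞) ≠ 0 := by simp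
  have hinv := hc.to_localInverse he htop
  have himg := hc.localInverse_apply_image he htop
  refine ⟨s.F ∘ hc.localInverse he htop, ?_, ?_⟩
  · refine AnalyticAt.comp ?_ hinv.analyticAt
    rw [himg]
    exact S.analyticAt_F hτ.1
  · have h1 := (hc.hasStrictFDerivAt' he htop).eventually_left_inverse
    filter_upwards [h1] with σ hσ
    exact (congrArg s.F hσ).symm

/-- At a coordinate point, a local expression of `F` satisfies both equations: the second order
equations in `τ₁` and in `τ₂` are independent combinations of them. -/
lemma pde_eq_zero {τ : ℂ × ℂ} (hτ : τ ∈ s.coordinateSet) {Φ : ℂ × ℂ → ℂ}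
    (hΦ : s.IsLocalExpression τ Φ) :
    pdeOne s.a s.b s.c Φ (s.x τ, s.y τ) = 0 ∧ pdeTwo Φ (s.x τ, s.y τ) = 0 := by
  have hr := hτ.1
  have hΔ := (S.jacobian_ne_zero_iff hr).1 hτ.2
  have h1 := S.combination_eq_zero hr.1 (v := s.t τ.2) (w := s.f τ.2) hr.2.2.2 hr.2.2.1 hΦ.1 <| by
    have : Tendsto (fun z : ℂ ↦ (z, τ.2)) (𝓝 τ.1) (𝓝 τ) := Continuous.tendsto (by fun_prop) τ.1
    exact this.eventually hΦ.2
  have hr' := swap_mem_regularSet hr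
  have h2 := S.combination_eq_zero hr.2.1 (v := s.t τ.1) (w := s.f τ.1) (Φ := Φ) hr'.2.2.2
    hr'.2.2.1 (by rw [fnX_comm, fnY_comm]; exact hΦ.1) <| by
    have : Tendsto (fun z : ℂ ↦ (τ.1, z)) (𝓝 τ.2) (𝓝 τ) := Continuous.tendsto (by fun_prop) τ.2
    filter_upwards [this.eventually hΦ.2] with z hz
    rw [fnX_comm, fnY_comm]
    refine Eq.trans ?_ hz
    simp only [SporadicCase.F]
    ring
  rw [fnX_comm s.a s.c (s.t τ.2), fnY_comm s.a s.c (s.t τ.2)] at h2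
  rw [← x_eq, ← y_eq] at h1 h2
  have hx := x_ne_zero hr
  have hx' : s.x τ * (s.x τ)⁻¹ = 1 := mul_inv_cancel₀ hx
  rw [div_eq_mul_inv] at h1 h2
  have e1 : (s.x τ)⁻¹ * relationDet s.a s.c (s.t τ.1) (s.t τ.2) *
      pdeOne s.a s.b s.c Φ (s.x τ, s.y τ) = 0 := by
    rw [relationDet]
    linear_combination (1 - s.c * s.t τ.2 ^ 2) ^ 2 * h1 - (1 - s.c * s.t τ.1 ^ 2) ^ 2 * h2
  have e2 : relationDet s.a s.c (s.t τ.1) (s.t τ.2) * pdeTwo Φ (s.x τ, s.y τ) = 0 := by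
    rw [relationDet]
    linear_combination s.t τ.1 * quad s.a s.c (s.t τ.1) * h2 -
      s.t τ.2 * quad s.a s.c (s.t τ.2) * h1
  exact ⟨(mul_eq_zero.1 e1).resolve_left (mul_ne_zero (inv_ne_zero hx) hΔ),
    (mul_eq_zero.1 e2).resolve_left hΔ⟩

/-- By the identity theorem, a local expression at an arbitrary regular point satisfies the system,
because there are coordinate points nearby. -/
lemma eventually_pde_eq_zero {τ : ℂ × ℂ} (hτ : τ ∈ s.regularSet) {Φ : ℂ × ℂ → ℂ}
    (hΦ : s.IsLocalExpression τ Φ) :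
    ∀ᶠ p in 𝓝 (s.x τ, s.y τ), pdeOne s.a s.b s.c Φ p = 0 ∧ pdeTwo Φ p = 0 := by
  obtain ⟨r, hr, hball⟩ := Metric.eventually_nhds_iff_ball.1 hΦ.1.eventually_analyticAt
  have hnear : ∀ᶠ σ in 𝓝 τ, (s.x σ, s.y σ) ∈ Metric.ball (s.x τ, s.y τ) r ∧
      ∀ᶠ ρ in 𝓝 σ, s.F ρ = Φ (s.x ρ, s.y ρ) :=
    ((S.analyticAt_coordinates hτ).continuousAt.eventually (Metric.ball_mem_nhds _ hr)).and
      hΦ.2.eventually_nhds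
  obtain ⟨σ, hσ, hσc⟩ : ∃ σ, ((s.x σ, s.y σ) ∈ Metric.ball (s.x τ, s.y τ) r ∧
      ∀ᶠ ρ in 𝓝 σ, s.F ρ = Φ (s.x ρ, s.y ρ)) ∧ σ ∈ s.coordinateSet := by
    have h1 := S.subset_closure_coordinateSet (show τ ∈ _ from ⟨hτ.1, hτ.2.1⟩)
    rw [mem_closure_iff_frequently] at h1
    exact (h1.and_eventually hnear).exists.imp fun _ h ↦ ⟨h.2, h.1⟩
  obtain ⟨e, he⟩ := S.exists_hasFDerivAt_equiv hσc
  have hmap : map (fun ρ ↦ (s.x ρ, s.y ρ)) (𝓝 σ) = 𝓝 (s.x σ, s.y σ) :=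
    HasStrictFDerivAt.map_nhds_eq_of_equiv (f' := e)
      ((S.analyticAt_coordinates hσc.1).contDiffAt (n := ⊤) |>.hasStrictFDerivAt' he (by simp))
  have hpde : ∀ᶠ p in 𝓝 (s.x σ, s.y σ), pdeOne s.a s.b s.c Φ p = 0 ∧ pdeTwo Φ p = 0 := by
    rw [← hmap, eventually_map]
    have hb : ∀ᶠ ρ in 𝓝 σ, (s.x ρ, s.y ρ) ∈ Metric.ball (s.x τ, s.y τ) r :=
      (S.analyticAt_coordinates hσc.1).continuousAt.eventually (Metric.isOpen_ball.mem_nhds hσ.1)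
    filter_upwards [S.coordinateSet_mem_nhds hσc, hσ.2.eventually_nhds, hb] with ρ h1 h2 h3
    exact S.pde_eq_zero h1 ⟨hball _ h3, h2⟩
  have hpre : IsPreconnected (Metric.ball (s.x τ, s.y τ) r) :=
    (convex_ball _ _).isPreconnected
  have hone : AnalyticOnNhd ℂ (pdeOne s.a s.b s.c Φ) (Metric.ball (s.x τ, s.y τ) r) :=
    fun p hp ↦ analyticAt_pdeOne _ _ _ (hball p hp)
  have htwo : AnalyticOnNhd ℂ (pdeTwo Φ) (Metric.ball (s.x τ, s.y τ) r) :=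
    fun p hp ↦ analyticAt_pdeTwo (hball p hp)
  filter_upwards [Metric.ball_mem_nhds _ hr] with p hp
  exact ⟨hone.eqOn_zero_of_preconnected_of_eventuallyEq_zero hpre hσ.1
      (hpde.mono fun _ h ↦ h.1) hp,
    htwo.eqOn_zero_of_preconnected_of_eventuallyEq_zero hpre hσ.1
      (hpde.mono fun _ h ↦ h.2) hp⟩

end IsFirstOrderSystem

end Bimodular

/-- In each sporadic case, `F`, as a function of `x` and `y`, satisfies the system. -/
theorem mainTheorem4 (s : SporadicCase) :
    -- `x` and `y` are local coordinates on a dense subset of `ℍ × ℍ`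
    {τ : ℂ × ℂ | 0 < τ.1.im ∧ 0 < τ.2.im} ⊆ closure s.coordinateSet ∧
    -- there, `F` is locally a holomorphic function of `x` and `y`
    (∀ τ ∈ s.coordinateSet, ∃ Φ : ℂ × ℂ → ℂ, s.IsLocalExpression τ Φ) ∧
    -- wherever `F` is a holomorphic function of `x` and `y`, this function satisfies the system
    (∀ τ ∈ s.regularSet, ∀ Φ : ℂ × ℂ → ℂ, s.IsLocalExpression τ Φ →
      ∀ᶠ p in 𝓝 (s.x τ, s.y τ), pdeOne s.a s.b s.c Φ p = 0 ∧ pdeTwo Φ p = 0) := by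
  obtain ⟨h, S⟩ : ∃ h, Bimodular.IsFirstOrderSystem s.a s.b s.c s.t s.f h := by
    cases s
    · exact Bimodular.isModularSystem_case7.exists_isFirstOrderSystem
    · exact Bimodular.isModularSystem_case10.exists_isFirstOrderSystem
    · exact Bimodular.isModularSystem_case17.exists_isFirstOrderSystem
    · exact Bimodular.isModularSystem_case12.exists_isFirstOrderSystem
    · exact Bimodular.isModularSystem_case9.exists_isFirstOrderSystem
    · exact Bimodular.isModularSystem_case11.exists_isFirstOrderSystem
  exact ⟨S.subset_closure_coordinateSet, fun _ hτ ↦ S.exists_isLocalExpression hτ,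
    fun _ hτ _ hΦ ↦ S.eventually_pde_eq_zero hτ hΦ⟩
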